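/- Let $d\ge 1$, $k\ge 2$ be integers, $\alpha=d/k$, and let $\epsilon>0$. Let $\mathcal X$ and $S$ be finite sets, and write $\mathcal F(\mathcal X)$ for the set of functions $\mathcal X\to\mathbb R_{\ge 0}$. Let $h\in\mathcal F(\mathcal X)$, $b\in\mathbb R^S$ and $f=(f_s)_{s\in S}\in\mathcal F(\mathcal X)^S$ be random; let $f_1,\dots,f_k$ be i.i.d. copies of $f$, independent of $b$, and set $$\theta(x_1,\dots,x_k)=\sum_{s\in S}b_s\prod_{j=1}^k f_{s,j}(x_j).$$ Assume that almost surely $\epsilon\le h\le 1/\epsilon$ on $\mathcal X$ and $\epsilon\le 1-\theta\le 1/\epsilon$ on $\mathcal X^k$, and that for all $p\ge1$ and $(s_1,\dots,s_p)\in S^p$ the moment $b^p(s_1,\dots,s_p)=\mathbb E[\prod_{\ell=1}^p b_{s_\ell}]$ exists and is nonnegative. For $n,m\ge 1$ with $nd=mk$, let $\mathscr G$ be the random $(d,k)$-regular bipartite graph (multi-edges allowed) with $n$ variables and $m$ clauses, given by a uniformly random perfect matching between the $d$ labelled half-edges at each variable and the $k$ labelled half-edges at each clause, together with independent labels: i.i.d.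 copies $h_v$ of $h$ at the variables and i.i.d. copies $\theta_a$ of $\theta$ at the clauses. Let $$Z(\mathscr G)=\sum_{x\in\mathcal X^V}\prod_{v}h_v(x_v)\prod_{a}\bigl(1-\theta_a(x_{\delta a})\bigr),\qquad F_n=\frac1n\,\mathbb E\log Z(\mathscr G),$$ where $x_{\delta a}\in\mathcal X^k$ lists the values of $x$ at the variables joined to the $k$ half-edges of $a$. Let $\mathcal M_0$ be the space of probability measures on $\mathcal X$, $\mathcal M_1$ that of probability measures on $\mathcal M_0$, and $\mathcal M_2$ that of probability measures on $\mathcal M_1$. For $\zeta\in\mathcal M_2$ let $(\eta_{a,j})_{a\ge0,j\ge 0}$ be i.i.d. samples from $\zeta$, let $\rho_{a,j}$ be conditionally independent samples from $\eta_{a,j}$, and, independently of these, let $h$ be as above, $h_{a,j}$ be i.i.d. copies of $h$ and $\theta_a$ be i.i.d. copies of $\theta$, all independent. Put $(h\rho)_{a,j}(x)=h_{a,j}(x)\rho_{a,j}(x)$ and $$u_a(x)=\sum_{\vec x\in\mathcal X^k}\mathbf 1\{x_1=x\}\,[1-\theta_a(\vec x)]\prod_{j=2}^k(h\rho)_{a,j}(x_j),\qquad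 u_a=\sum_{\vec x\in\mathcal X^k}[1-\theta_a(\vec x)]\prod_{j=1}^k(h\rho)_{a,j}(x_j).$$ Let $\mathbb E'$ denote the expectation over the $\rho_{a,j}$ conditioned on all else, and $\mathbb E$ the overall expectation. Then there is a constant $C$ depending only on $d,k,\epsilon$ such that for every such model, all $n,m\ge1$ with $nd=mk$, every $\lambda\in(0,1)$ and every $\zeta\in\mathcal M_2$, $$F_n\le \frac1\lambda\,\mathbb E\log\mathbb E'\Bigl[\Bigl(\sum_{x\in\mathcal X}h(x)\prod_{a=1}^d u_a(x)\Bigr)^{\lambda}\Bigr]-(k-1)\,\alpha\,\frac1\lambda\,\mathbb E\log\mathbb E'\bigl[(u_0)^\lambda\bigr]+C\,n^{-1/3}.$$ -/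

import Mathlib

open MeasureTheory
open scoped NNReal

noncomputable section

namespace RegularFactorModel

/-- The space of functions `𝒳 → ℝ_{≥0}`. -/
abbrev Potential (X : Type*) : Type _ := X → ℝ≥0

/-- The laws of the random inputs of the model: `h` is a random nonnegative function on the
alphabet `X`, `b` is a random real vector indexed by `S`, and `f` is a random `S`-indexed vector of
nonnegative functions on `X`. -/
structure FactorModel (X S : Type*) where
  hLaw : ProbabilityMeasure (Potential X)
  bLaw : ProbabilityMeasure (S → ℝ)
  fLaw : ProbabilityMeasure (S → Potential X)

/-- The randomness carried by one clause: a vector `b` and functions `f_1, …, f_k`. -/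
abbrev ClauseLabel (X S : Type*) (k : ℕ) : Type _ := (S → ℝ) × (Fin k → S → Potential X)

/-- The clause function `θ(x₁,…,x_k) = ∑_s b_s ∏_j f_{s,j}(x_j)`. -/
def theta {X S : Type*} [Fintype S] {k : ℕ} (c : ClauseLabel X S k) (x : Fin k → X) : ℝ :=
  ∑ s, c.1 s * ∏ j, (c.2 j s (x j) : ℝ)

namespace FactorModel

variable {X S : Type*} [Fintype S]

/-- The law of the label of one clause: `f_1, …, f_k` are i.i.d. copies of `f`, independent
of `b`. -/
def clauseLaw (M : FactorModel X S) (k : ℕ) : Measure (ClauseLabel X S k) :=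
  (M.bLaw : Measure (S → ℝ)).prod
    (Measure.pi fun _ : Fin k => (M.fLaw : Measure (S → Potential X)))

/-- Almost surely, `ε ≤ h ≤ 1/ε` and `ε ≤ 1 - θ ≤ 1/ε` pointwise. -/
def BoundedPotentials (M : FactorModel X S) (k : ℕ) (ε : ℝ) : Prop :=
  (∀ᵐ h ∂(M.hLaw : Measure (Potential X)), ∀ x : X, ε ≤ (h x : ℝ) ∧ (h x : ℝ) ≤ 1 / ε) ∧
  (∀ᵐ c ∂(M.clauseLaw k), ∀ x : Fin k → X, ε ≤ 1 - theta c x ∧ 1 - theta c x ≤ 1 / ε)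

/-- All mixed moments `𝔼[b_{s_1} ⋯ b_{s_p}]`, `p ≥ 1`, exist and are nonnegative. -/
def NonnegMoments (M : FactorModel X S) : Prop :=
  ∀ p : ℕ, 1 ≤ p → ∀ s : Fin p → S,
    Integrable (fun b : S → ℝ => ∏ l, b (s l)) (M.bLaw : Measure (S → ℝ)) ∧
      0 ≤ ∫ b : S → ℝ, ∏ l, b (s l) ∂(M.bLaw : Measure (S → ℝ))

end FactorModel

/-! The random `(d,k)`-regular bipartite graph, with multi-edges allowed: `n` variables, each with
`d` labelled half-edges, `m` clauses, each with `k` labelled half-edges, and a perfect matching of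
the two sets of half-edges. -/

/-- A `(d,k)`-regular bipartite (multi)graph on `n` variables and `m` clauses. -/
abbrev RegularGraph (n m d k : ℕ) : Type := (Fin n × Fin d) ≃ (Fin m × Fin k)

/-- The variable incident to the `j`-th edge of clause `a`. -/
def RegularGraph.var {n m d k : ℕ} (G : RegularGraph n m d k) (a : Fin m) (j : Fin k) : Fin n :=
  (G.symm (a, j)).1

/-- The partition function
`Z = ∑_{x ∈ X^V} ∏_v h_v(x_v) ∏_a (1 - θ_a(x_{δa}))`. -/
def partitionFn {X S : Type*} [Fintype X] [Fintype S] {n m d k : ℕ} (G : RegularGraph n m d k)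
    (h : Fin n → Potential X) (c : Fin m → ClauseLabel X S k) : ℝ :=
  ∑ x : Fin n → X,
    (∏ v, (h v (x v) : ℝ)) * ∏ a, (1 - theta (c a) fun j => x (G.var a j))

/-- The free energy `F_n = n⁻¹ 𝔼_n log Z`: the graph is uniformly random, the `h_v` are i.i.d.
copies of `h`, the `θ_a` are i.i.d. copies of `θ`, and all of these are independent. -/
def freeEnergy {X S : Type*} [Fintype X] [Fintype S] (M : FactorModel X S) (n m d k : ℕ) : ℝ :=
  (n : ℝ)⁻¹ *
    ((Fintype.card (RegularGraph n m d k) : ℝ)⁻¹ * ∑ G : RegularGraph n m d k,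
      ∫ ω : (Fin n → Potential X) × (Fin m → ClauseLabel X S k),
        Real.log (partitionFn G ω.1 ω.2)
        ∂((Measure.pi fun _ : Fin n => (M.hLaw : Measure (Potential X))).prod
          (Measure.pi fun _ : Fin m => M.clauseLaw k)))

section Bound

variable {X S : Type*} [MeasurableSpace X]

/-- `𝓜₀`: probability measures over the alphabet. -/
abbrev M0 (X : Type*) [MeasurableSpace X] : Type _ := ProbabilityMeasure X

/-- `𝓜₁`: probability measures over `𝓜₀`. -/
abbrev M1 (X : Type*) [MeasurableSpace X] : Type _ := ProbabilityMeasure (M0 X)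

/-- `𝓜₂`: probability measures over `𝓜₁`. -/
abbrev M2 (X : Type*) [MeasurableSpace X] : Type _ := ProbabilityMeasure (M1 X)

/-- Everything attached to one clause `a` except the `ρ_{a,j}`: the clause label, the functions
`(h_{a,j})_j` and the measures `(η_{a,j})_j`. -/
abbrev ClauseEnv (X S : Type*) [MeasurableSpace X] (k : ℕ) : Type _ :=
  ClauseLabel X S k × (Fin k → Potential X) × (Fin k → M1 X)

/-- The clause label, the i.i.d. copies `h_{a,j}` of `h` and the i.i.d. samples `η_{a,j}` from `ζ`
are independent. -/
def envLaw [Fintype S] (M : FactorModel X S) (ζ : M2 X) (k : ℕ) : Measure (ClauseEnv X S k) :=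
  (M.clauseLaw k).prod
    ((Measure.pi fun _ : Fin k => (M.hLaw : Measure (Potential X))).prod
      (Measure.pi fun _ : Fin k => (ζ : Measure (M1 X))))

/-- The conditional law of `(ρ_{a,j})_j` given the environment: independent samples from the
`η_{a,j}`. -/
def rhoLaw {k : ℕ} (e : ClauseEnv X S k) : Measure (Fin k → M0 X) :=
  Measure.pi fun j => (e.2.2 j : Measure (M0 X))

/-- `(hρ)_{a,j}(x) = h_{a,j}(x) ρ_{a,j}(x)`. -/
def hRho {k : ℕ} (e : ClauseEnv X S k) (ρ : Fin k → M0 X) (j : Fin k) (x : X) : ℝ :=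
  (e.2.1 j x : ℝ) * (ρ j {x} : ℝ)

variable [Fintype X] [DecidableEq X] [Fintype S]

/-- `u_a(y) = ∑_{x ∈ X^k} 1{x_1 = y} (1 - θ_a(x)) ∏_{j = 2}^k (hρ)_{a,j}(x_j)`
(the first coordinate has index `0 : Fin k`). -/
def uVar {k : ℕ} [NeZero k] (e : ClauseEnv X S k) (ρ : Fin k → M0 X) (y : X) : ℝ :=
  ∑ x : Fin k → X, if x 0 = y then
    (1 - theta e.1 x) * ∏ j ∈ Finset.univ.erase (0 : Fin k), hRho e ρ j (x j) else 0

/-- `u_a = ∑_{x ∈ X^k} (1 - θ_a(x)) ∏_{j = 1}^k (hρ)_{a,j}(x_j)`. -/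
def uClause {k : ℕ} (e : ClauseEnv X S k) (ρ : Fin k → M0 X) : ℝ :=
  ∑ x : Fin k → X, (1 - theta e.1 x) * ∏ j, hRho e ρ j (x j)

/-- `𝔼 log 𝔼'[(∑_x h(x) ∏_{a=1}^d u_a(x))^λ]`, where `𝔼'` averages over the `ρ`'s only. -/
def variableTerm (M : FactorModel X S) (ζ : M2 X) (d k : ℕ) [NeZero k] (lam : ℝ) : ℝ :=
  ∫ ω : Potential X × (Fin d → ClauseEnv X S k),
    Real.log (∫ ρ : Fin d → Fin k → M0 X,
      (∑ x : X, (ω.1 x : ℝ) * ∏ a, uVar (ω.2 a) (ρ a) x) ^ lam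
      ∂(Measure.pi fun a => rhoLaw (ω.2 a)))
    ∂((M.hLaw : Measure (Potential X)).prod (Measure.pi fun _ : Fin d => envLaw M ζ k))

/-- `𝔼 log 𝔼'[(u_0)^λ]`, where `𝔼'` averages over the `ρ`'s only. -/
def clauseTerm (M : FactorModel X S) (ζ : M2 X) (k : ℕ) (lam : ℝ) : ℝ :=
  ∫ e : ClauseEnv X S k,
    Real.log (∫ ρ : Fin k → M0 X, (uClause e ρ) ^ lam ∂(rhoLaw e)) ∂(envLaw M ζ k)

end Bound

end RegularFactorModel

end

noncomputable section

namespace RegularFactorModel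

open scoped ENNReal

/-! The bound is a discrete interpolation of Guerra–Franz–Leone type. A hybrid system has `a`
genuine clauses and `b` cavity factors `uVar`, each cavity factor attached to a single half-edge.
The half-edges of the variables are put in uniformly random order, the clauses taking successive
blocks of `k` from the front and the cavity factors single half-edges from the back. Let Φ(a, b)
(`meanEnergy`) be the mean of log 𝔼'[Z^λ]. Then Φ(m, 0) = λ n F_n, and Φ(0, mk) = n times
`variableTerm`, because without clauses the variables decouple.

The local step says that, c being `clauseTerm` and f = mk - ak - b the number of free half-edges,
Φ(a+1, b) + (k-1)(Φ(a, b) + c) ≤ k Φ(a, b+1) + O(1/f). With the rest of the system frozen and the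
attachment points independent and uniform it holds without error (`base_interpolation`). To see
this, write 1 - θ = (1 - τ)/ε with τ = (1-ε) + εθ, which lies in [0, 1-ε²] and is again a sum of
products whose coefficients have nonnegative moments. After normalisation, the negative log of the
λ-th moment becomes -log of a tilted mean of (1 - Θ)^λ, where Θ averages τ. Since 0 < λ < 1, both 1
- (1-t)^λ and -log(1-x) have power series with nonnegative coefficients, so this quantity is a
nonnegative combination of replica moments of τ (`ofReal_gap`). Averaged over the clause label, each
moment is a nonnegative combination of products over the `k` slots (`lintegral_prod_theta`). If A is
the contribution of a slot attached to the system and B that of a slot filled from ζ, the three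
kinds of factor give A^k, A B^(k-1) and B^k, and k A B^(k-1) ≤ A^k + (k-1) B^k. The sign of -log
turns this into the step.

In the regular graph the `k` points of a clause are distinct half-edges rather than independent
ones. By exchangeability of the ordering all injective choices have the same mean, and non-injective
choices have probability at most k²/f; this is the error O(1/f).

Read backwards in `b`, the step is a random walk: removing a cavity factor adds a clause with
probability 1/k, so f performs a martingale. Started with about n^(2/3) free half-edges, it ends
with b = 0 and a discrepancy from `m` clauses controlled by its variance of order n and the
Lipschitz property of Φ. A quadratic barrier (`recursion_barrier`) makes this deterministic and also
absorbs the region where f is too small for the step. The total loss is λ O(n^(2/3)); division by λ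
n gives the claim with a constant independent of λ and of the model. -/

theorem measurable_measure_pi {α ι : Type*} [MeasurableSpace α] [Fintype ι] {X : ι → Type*}
    [∀ i, MeasurableSpace (X i)] (μ : α → ∀ i, Measure (X i))
    [∀ a i, IsProbabilityMeasure (μ a i)] (h : ∀ i, Measurable fun a => μ a i) :
    Measurable fun a => Measure.pi (μ a) := by
  refine Measurable.measure_of_isPiSystem_of_isProbabilityMeasure generateFrom_pi.symm
    isPiSystem_pi ?_
  rintro _ ⟨s, hs, rfl⟩
  simp only [Measure.pi_pi]
  refine Finset.measurable_prod _ fun i _ => ?_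
  exact (Measure.measurable_coe (hs i (Set.mem_univ i))).comp (h i)

theorem lintegral_pi_prod {ι : Type*} [Fintype ι] {X : ι → Type*} [∀ i, MeasurableSpace (X i)]
    (μ : ∀ i, Measure (X i)) [∀ i, IsProbabilityMeasure (μ i)] (f : ∀ i, X i → ℝ≥0∞)
    (hf : ∀ i, Measurable (f i)) :
    ∫⁻ x, ∏ i, f i (x i) ∂(Measure.pi μ) = ∏ i, ∫⁻ y, f i y ∂(μ i) := by
  have h := ProbabilityTheory.lintegral_prod_eq_prod_lintegral_of_indepFun (μ := Measure.pi μ) Finset.univ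
    (fun i x => f i (x i)) (ProbabilityTheory.iIndepFun_pi fun i => (hf i).aemeasurable)
    fun i => (hf i).comp (measurable_pi_apply i)
  rw [h]
  refine Finset.prod_congr rfl fun i _ => ?_
  exact (measurePreserving_eval μ i).lintegral_comp (hf i)

/-! ### Nonnegative power series for -log of a tilted mean of (1 - Θ)^λ -/

/-- Minus the coefficients of the binomial series of `(1 - t) ^ lam` at `t ^ (p + 1)`. -/
def binomCoeff (lam : ℝ) (p : ℕ) : ℝ := (-1) ^ p * Ring.choose lam (p + 1)

theorem choose_succ_mul (a : ℝ) (p : ℕ) :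
    Ring.choose a (p + 1) * (p + 1) = Ring.choose a p * (a - p) := by
  have h1 := Ring.descPochhammer_eq_factorial_smul_choose a p
  have h2 := Ring.descPochhammer_eq_factorial_smul_choose a (p + 1)
  rw [descPochhammer_succ_right, Polynomial.smeval_mul, h1] at h2
  have hp : (p.factorial : ℝ) ≠ 0 := by positivity
  simp only [Polynomial.smeval_sub, Polynomial.smeval_X, Polynomial.smeval_natCast, pow_one,
    nsmul_eq_mul, Nat.factorial_succ, Nat.cast_mul, pow_zero, mul_one] at h2
  have : (p.factorial : ℝ) * (Ring.choose a (p + 1) * (p + 1))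
      = p.factorial * (Ring.choose a p * (a - p)) := by
    push_cast at h2
    linarith
  exact mul_left_cancel₀ hp this

/-- The ratio of consecutive coefficients is (p + 1 - λ)/(p + 2), positive because λ < 1, and the
first coefficient is λ. -/
theorem binomCoeff_nonneg {lam : ℝ} (h0 : 0 < lam) (h1 : lam < 1) (p : ℕ) :
    0 ≤ binomCoeff lam p := by
  induction p with
  | zero => simp [binomCoeff, h0.le]
  | succ p ih =>
    have h := choose_succ_mul lam (p + 1)
    have hp : (0 : ℝ) < ((p + 1 : ℕ) : ℝ) + 1 := by positivity
    have e : binomCoeff lam (p + 1) * (((p + 1 : ℕ) : ℝ) + 1)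
        = binomCoeff lam p * (((p + 1 : ℕ) : ℝ) - lam) := by
      unfold binomCoeff
      rw [mul_assoc, h, pow_succ]
      ring
    have hn : 0 ≤ binomCoeff lam p * (((p + 1 : ℕ) : ℝ) - lam) := by
      refine mul_nonneg ih ?_
      push_cast
      have : (0 : ℝ) ≤ p := Nat.cast_nonneg p
      linarith
    rw [← e] at hn
    exact nonneg_of_mul_nonneg_left hn hp

theorem hasSum_binomCoeff (lam : ℝ) {t : ℝ} (h0 : 0 ≤ t) (h1 : t < 1) :
    HasSum (fun p => binomCoeff lam p * t ^ (p + 1)) (1 - (1 - t) ^ lam) := by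
  have h := (Real.one_add_rpow_hasFPowerSeriesOnBall_zero (a := lam)).hasSum (y := -t) (by
    rw [← ENNReal.ofReal_one, Metric.eball_ofReal]
    simpa [abs_of_nonneg h0] using h1)
  simp only [binomialSeries_apply, List.ofFn_const, List.prod_replicate, zero_add,
    smul_eq_mul] at h
  have h2 := (hasSum_nat_add_iff' 1).mpr h
  have h3 := h2.neg
  simp only [Finset.range_one, Finset.sum_singleton, Ring.choose_zero_right, pow_zero, mul_one,
    neg_sub] at h3
  have e : (1 + -t) = 1 - t := by ring
  rw [e] at h3
  refine h3.congr_fun ?_ |> fun h => h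
  intro p
  unfold binomCoeff
  rw [neg_pow t, pow_succ (-1 : ℝ)]
  ring

theorem ENNReal_tsum_pow (a : ℕ → ℝ≥0∞) (q : ℕ) :
    (∑' p, a p) ^ q = ∑' p : Fin q → ℕ, ∏ i, a (p i) := by
  induction q with
  | zero => simp
  | succ q ih =>
    rw [pow_succ', ih, ← (Fin.consEquiv fun _ : Fin (q + 1) => ℕ).tsum_eq, ENNReal.tsum_prod']
    simp only [Fin.consEquiv, Equiv.coe_fn_mk, Fin.prod_univ_succ, Fin.cons_zero, Fin.cons_succ,
      ENNReal.tsum_mul_left, ENNReal.tsum_mul_right]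

/-- The index set of the monomials in the expansion of `-log (1 - ∑ c_p M_p)`. -/
abbrev LogIndex : Type := Σ q : ℕ, (Fin (q + 1) → ℕ)

/-- The coefficient of the monomial `∏ i, M_{p i + 1}`. -/
def logCoeff (lam : ℝ) (I : LogIndex) : ℝ≥0∞ :=
  ENNReal.ofReal ((I.1 + 1 : ℝ)⁻¹) * ∏ i, ENNReal.ofReal (binomCoeff lam (I.2 i))

/-- Since `D` has mean one, the integral is 1 - x with x the mean of D (1 - (1 - Θ)^λ). The binomial
series expands x, the logarithmic series expands -log(1 - x), and all terms are nonnegative, so in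
`ℝ≥0∞` sums, powers and integrals may be exchanged freely. -/
theorem neg_log_series {lam : ℝ} (h0 : 0 < lam) (h1 : lam < 1) {Q : Type*} [MeasurableSpace Q]
    (π : Measure Q) {D Θ : Q → ℝ} {δ : ℝ} (hδ : 0 < δ)
    (hD : Measurable D) (hΘ : Measurable Θ) (hD0 : ∀ q, 0 ≤ D q) (hDi : Integrable D π)
    (hD1 : ∫ q, D q ∂π = 1) (hΘ0 : ∀ q, 0 ≤ Θ q) (hΘ1 : ∀ q, Θ q ≤ 1 - δ) :
    ENNReal.ofReal (-Real.log (∫ q, D q * (1 - Θ q) ^ lam ∂π))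
      = ∑' I : LogIndex, logCoeff lam I *
          ∏ i, ∫⁻ q, ENNReal.ofReal (D q) * ENNReal.ofReal (Θ q) ^ (I.2 i + 1) ∂π := by
  have hb : ∀ q, 0 ≤ (1 - Θ q) ^ lam ∧ (1 - Θ q) ^ lam ≤ 1 := fun q =>
    ⟨Real.rpow_nonneg (by linarith [hΘ1 q]) _,
      Real.rpow_le_one (by linarith [hΘ1 q]) (by linarith [hΘ0 q]) h0.le⟩
  have hmeas : Measurable fun q => (1 - Θ q) ^ lam := (measurable_const.sub hΘ).pow_const _
  have hint : Integrable (fun q => D q * (1 - Θ q) ^ lam) π := by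
    refine hDi.mono (hD.mul hmeas).aestronglyMeasurable (Filter.Eventually.of_forall fun q => ?_)
    rw [norm_mul, Real.norm_of_nonneg (hb q).1]
    exact mul_le_of_le_one_right (norm_nonneg _) (hb q).2
  set x : ℝ := 1 - ∫ q, D q * (1 - Θ q) ^ lam ∂π with hx
  have hx' : x = ∫ q, D q * (1 - (1 - Θ q) ^ lam) ∂π := by
    have e : ∀ q, D q * (1 - (1 - Θ q) ^ lam) = D q - D q * (1 - Θ q) ^ lam := fun q => by ring
    simp_rw [e]
    rw [hx, integral_sub hDi hint, hD1]
  have hx0 : 0 ≤ x := by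
    rw [hx']
    exact integral_nonneg fun q => mul_nonneg (hD0 q) (by linarith [(hb q).2])
  -- The margin δ below 1 keeps the tilted mean at least δ^λ, so the logarithmic series is used
  -- strictly inside its disc of convergence.
  have hx1 : x < 1 := by
    have hlow : δ ^ lam ≤ ∫ q, D q * (1 - Θ q) ^ lam ∂π := by
      calc δ ^ lam = ∫ q, D q * δ ^ lam ∂π := by rw [integral_mul_const, hD1, one_mul]
        _ ≤ _ := integral_mono (hDi.mul_const _) hint fun q =>
          mul_le_mul_of_nonneg_left
            (Real.rpow_le_rpow hδ.le (by linarith [hΘ1 q]) h0.le) (hD0 q)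
    have : 0 < δ ^ lam := Real.rpow_pos_of_pos hδ _
    linarith
  have hlog : -Real.log (∫ q, D q * (1 - Θ q) ^ lam ∂π) = -Real.log (1 - x) := by
    rw [hx, sub_sub_cancel]
  have hs := Real.hasSum_pow_div_log_of_abs_lt_one (x := x) (by rwa [abs_of_nonneg hx0])
  have hxe : ENNReal.ofReal x = ∑' p, ENNReal.ofReal (binomCoeff lam p) *
      ∫⁻ q, ENNReal.ofReal (D q) * ENNReal.ofReal (Θ q) ^ (p + 1) ∂π := by
    have hi : Integrable (fun q => D q * (1 - (1 - Θ q) ^ lam)) π := by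
      have : (fun q => D q * (1 - (1 - Θ q) ^ lam))
          = fun q => D q - D q * (1 - Θ q) ^ lam := by
        ext q; ring
      rw [this]
      exact hDi.sub hint
    rw [hx', ofReal_integral_eq_lintegral_ofReal hi (Filter.Eventually.of_forall fun q =>
      mul_nonneg (hD0 q) (by linarith [(hb q).2]))]
    have : ∀ q, ENNReal.ofReal (D q * (1 - (1 - Θ q) ^ lam))
        = ∑' p, ENNReal.ofReal (binomCoeff lam p) *
          (ENNReal.ofReal (D q) * ENNReal.ofReal (Θ q) ^ (p + 1)) := by
      intro q
      have hq := hasSum_binomCoeff lam (hΘ0 q) (by linarith [hΘ1 q] : Θ q < 1)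
      rw [ENNReal.ofReal_mul (hD0 q), ← hq.tsum_eq, ENNReal.ofReal_tsum_of_nonneg
        (fun p => mul_nonneg (binomCoeff_nonneg h0 h1 p) (pow_nonneg (hΘ0 q) _)) hq.summable,
        ← ENNReal.tsum_mul_left]
      refine tsum_congr fun p => ?_
      rw [ENNReal.ofReal_mul (binomCoeff_nonneg h0 h1 p), ENNReal.ofReal_pow (hΘ0 q)]
      ring
    simp_rw [this]
    rw [lintegral_tsum fun p => by fun_prop]
    refine tsum_congr fun p => ?_
    rw [lintegral_const_mul _ (by fun_prop)]
  rw [hlog, ← hs.tsum_eq, ENNReal.ofReal_tsum_of_nonneg (fun q => by positivity) hs.summable,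
    ENNReal.tsum_sigma']
  refine tsum_congr fun q => ?_
  rw [div_eq_inv_mul, ENNReal.ofReal_mul (by positivity), ENNReal.ofReal_pow hx0, hxe,
    ENNReal_tsum_pow, ← ENNReal.tsum_mul_left]
  refine tsum_congr fun p => ?_
  simp only [logCoeff, Finset.prod_mul_distrib]
  ring

/-! ### Replica moments -/

/-- The replicas entering the monomial `I`. -/
abbrev Replica (I : LogIndex) : Type := Σ i : Fin (I.1 + 1), Fin (I.2 i + 1)

/-- The mixed replica moment of the random weights `κ`. -/
def replicaMoment {Q Z : Type*} [MeasurableSpace Q] (π : Measure Q) (D : Q → ℝ≥0∞)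
    (κ : Q → Z → ℝ≥0∞) (I : LogIndex) (z : Replica I → Z) : ℝ≥0∞ :=
  ∏ i, ∫⁻ q, D q * ∏ l, κ q (z ⟨i, l⟩) ∂π

/-- Expanding a power chooses one `z` per replica. Replicas in the same group `i` share a sample of
π and different groups are independent; this separates the weights `κ` from the values `t`, so that
`t` can later be averaged over the clause label. -/
theorem prod_lintegral_pow {Q Z : Type*} [MeasurableSpace Q] [Fintype Z] (π : Measure Q)
    {D : Q → ℝ≥0∞} {κ : Q → Z → ℝ≥0∞} (hD : Measurable D) (hκ : ∀ z, Measurable fun q => κ q z)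
    (t : Z → ℝ≥0∞) (I : LogIndex) :
    ∏ i, ∫⁻ q, D q * (∑ z, κ q z * t z) ^ (I.2 i + 1) ∂π
      = ∑ z : Replica I → Z, replicaMoment π D κ I z * ∏ r, t (z r) := by
  have h : ∀ i, ∫⁻ q, D q * (∑ z, κ q z * t z) ^ (I.2 i + 1) ∂π
      = ∑ z : Fin (I.2 i + 1) → Z, (∫⁻ q, D q * ∏ l, κ q (z l) ∂π) * ∏ l, t (z l) := by
    intro i
    have e : ∀ q, D q * (∑ z, κ q z * t z) ^ (I.2 i + 1)
        = ∑ z : Fin (I.2 i + 1) → Z, (D q * ∏ l, κ q (z l)) * ∏ l, t (z l) := by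
      intro q
      rw [← Fin.prod_const, Finset.prod_univ_sum, Fintype.piFinset_univ, Finset.mul_sum]
      refine Finset.sum_congr rfl fun z _ => ?_
      rw [Finset.prod_mul_distrib, mul_assoc]
    simp_rw [e]
    rw [lintegral_finsetSum _ fun z _ => by fun_prop]
    refine Finset.sum_congr rfl fun z _ => ?_
    rw [lintegral_mul_const _ (by fun_prop)]
  simp_rw [h]
  rw [Finset.prod_univ_sum, Fintype.piFinset_univ]
  rw [← (Equiv.piCurry fun (_ : Fin (I.1 + 1)) (_ : Fin (I.2 _ + 1)) => Z).sum_comp]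
  refine Finset.sum_congr rfl fun z _ => ?_
  rw [Finset.prod_mul_distrib, Fintype.prod_sigma]
  rfl

/-- This is the only inequality behind the interpolation step. The induction rests on (a^(k+1) -
b^(k+1))(a - b) ≥ 0. -/
theorem ENNReal_weighted_amgm (k : ℕ) (A B : ℝ≥0∞) :
    ((k + 1 : ℕ) : ℝ≥0∞) * (A * B ^ k) ≤ A ^ (k + 1) + k * B ^ (k + 1) := by
  rcases Nat.eq_zero_or_pos k with rfl | hk
  · simp
  by_cases hA : A = ⊤
  · simp [hA]
  by_cases hB : B = ⊤
  · have hk' : (k : ℝ≥0∞) ≠ 0 := by exact_mod_cast hk.ne'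
    simp [hB, ENNReal.mul_top hk']
  lift A to ℝ≥0 using hA
  lift B to ℝ≥0 using hB
  norm_cast
  rw [← NNReal.coe_le_coe]
  push_cast
  generalize hA : (A : ℝ) = a
  generalize hB : (B : ℝ) = b
  have ha : 0 ≤ a := hA ▸ A.coe_nonneg
  have hb : 0 ≤ b := hB ▸ B.coe_nonneg
  clear hA hB hk
  induction k with
  | zero => simp
  | succ k ih =>
    have h1 : 0 ≤ (a ^ (k + 1) - b ^ (k + 1)) * (a - b) := by
      rcases le_total a b with h | h
      · exact mul_nonneg_of_nonpos_of_nonpos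
          (sub_nonpos.2 (pow_le_pow_left₀ ha h _)) (sub_nonpos.2 h)
      · exact mul_nonneg (sub_nonneg.2 (pow_le_pow_left₀ hb h _)) (sub_nonneg.2 h)
    have h2 := mul_le_mul_of_nonneg_right ih hb
    push_cast at h2 ⊢
    simp only [pow_succ] at *
    nlinarith

/-! ### Slot-product form of the moments of a clause -/

section Positivity

variable {X S : Type*}

/-- The coefficients of `(1 - ε) + ε θ` as a sum of products, indexed by `Option S`. -/
def extCoeff (ε : ℝ) (b : S → ℝ) (o : Option S) : ℝ := o.elim (1 - ε) fun s => ε * b s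

/-- The factors of `(1 - ε) + ε θ` as a sum of products, indexed by `Option S`. -/
def extFactor (f : S → Potential X) (o : Option S) (x : X) : ℝ≥0 := o.elim 1 fun s => f s x

theorem one_sub_mul_one_sub_theta [Fintype S] {k : ℕ} (ε : ℝ) (c : ClauseLabel X S k) (x : Fin k → X) :
    1 - ε * (1 - theta c x)
      = ∑ o : Option S, extCoeff ε c.1 o * ∏ j, (extFactor (c.2 j) o (x j) : ℝ) := by
  rw [Fintype.sum_option]
  simp only [extCoeff, extFactor, Option.elim, theta, NNReal.coe_one,
    Finset.prod_const_one, mul_one]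
  rw [Finset.sum_congr rfl fun s _ => mul_assoc ε (c.1 s) _, ← Finset.mul_sum]
  ring

@[fun_prop]
theorem measurable_extFactor (o : Option S) (x : X) :
    Measurable fun f : S → Potential X => extFactor f o x := by
  cases o with
  | none => exact measurable_const
  | some s => simp only [extFactor, Option.elim]; fun_prop

theorem FactorModel.NonnegMoments.extCoeff {M : FactorModel X S} (hM : M.NonnegMoments) {ε : ℝ}
    (h0 : 0 ≤ ε) (h1 : ε ≤ 1) {r : Type*} [Fintype r] (s : r → Option S) :
    Integrable (fun b => ∏ i, extCoeff ε b (s i)) (M.bLaw : Measure (S → ℝ)) ∧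
      0 ≤ ∫ b, ∏ i, extCoeff ε b (s i) ∂(M.bLaw : Measure (S → ℝ)) := by
  -- Every index `none` contributes the constant 1 - ε ≥ 0 and every `some s` a factor ε b_s;
  -- peeling them off leaves a nonnegative constant times a pure moment of `b`.
  have key : ∀ l : List (Option S), ∃ C : ℝ, 0 ≤ C ∧ ∃ l' : List S, ∀ b : S → ℝ,
      (l.map fun o => RegularFactorModel.extCoeff ε b o).prod = C * (l'.map b).prod := by
    intro l
    induction l with
    | nil => exact ⟨1, zero_le_one, [], fun b => by simp⟩
    | cons o l ih =>
      obtain ⟨C, hC, l', h⟩ := ih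
      cases o with
      | none =>
        refine ⟨(1 - ε) * C, mul_nonneg (by linarith) hC, l', fun b => ?_⟩
        rw [List.map_cons, List.prod_cons, h]
        simp [RegularFactorModel.extCoeff, mul_assoc]
      | some s =>
        refine ⟨ε * C, mul_nonneg h0 hC, s :: l', fun b => ?_⟩
        rw [List.map_cons, List.prod_cons, h, List.map_cons, List.prod_cons]
        simp only [RegularFactorModel.extCoeff, Option.elim]
        ring
  obtain ⟨C, hC, l', h⟩ := key (Finset.univ.toList.map s)
  have h' : (fun b => ∏ i, RegularFactorModel.extCoeff ε b (s i))
      = fun b => C * (l'.map b).prod := by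
    ext b
    rw [← h, List.map_map, ← Finset.prod_map_toList]
    rfl
  simp_rw [h']
  rcases Nat.eq_zero_or_pos l'.length with hl | hl
  -- The empty moment is not covered by `NonnegMoments`, which starts at p = 1; here it is simply 1.
  · rw [List.length_eq_zero_iff] at hl
    subst hl
    simp [hC]
  · have hm := hM l'.length hl l'.get
    have e : ∀ b : S → ℝ, (l'.map b).prod = ∏ i, b (l'.get i) := by
      intro b
      simp
    simp_rw [e]
    exact ⟨hm.1.const_mul C, by rw [integral_const_mul]; exact mul_nonneg hC hm.2⟩

/-- Mixed moments of `(1 - ε) + ε θ` over replicas are nonnegative combinations of products over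
the `k` slots. -/
theorem lintegral_prod_theta [Fintype S] {k : ℕ} [NeZero k] {M : FactorModel X S}
    (hM : M.NonnegMoments) {ε : ℝ} (h0 : 0 ≤ ε) (h1 : ε ≤ 1)
    (hτ : ∀ᵐ c ∂(M.clauseLaw k), ∀ x : Fin k → X, 0 ≤ 1 - ε * (1 - theta c x))
    (r : Type*) [Fintype r] [DecidableEq r] :
    ∃ (β : (r → Option S) → ℝ≥0∞) (F : (r → Option S) → (r → X) → ℝ≥0∞),
      ∀ z : Fin k → r → X,
        ∫⁻ c, ∏ i, ENNReal.ofReal (1 - ε * (1 - theta c fun j => z j i)) ∂(M.clauseLaw k)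
          = ∑ s, β s * ∏ j, F s (z j) := by
  classical
  refine ⟨fun s => ENNReal.ofReal (∫ b, ∏ i, extCoeff ε b (s i) ∂(M.bLaw : Measure (S → ℝ))),
    fun s ζ => ∫⁻ f, ∏ i, (extFactor f (s i) (ζ i) : ℝ≥0∞) ∂(M.fLaw : Measure (S → Potential X)),
    fun z => ?_⟩
  have hmt : ∀ x : Fin k → X, Measurable fun c : ClauseLabel X S k => theta c x := by
    intro x
    unfold theta
    fun_prop
  unfold FactorModel.clauseLaw at hτ ⊢
  -- The vector `b` is integrated first, with `f` frozen: the b_s themselves may be negative, and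
  -- only their moments have a sign. The passage between `ℝ≥0∞` and `ℝ` is legitimate because τ
  -- itself is nonnegative almost surely.
  rw [lintegral_prod_symm _ (by fun_prop)]
  have hτ' := (Measure.ae_ae_of_ae_prod (Measure.measurePreserving_swap.quasiMeasurePreserving.ae hτ))
  have hin : ∀ᵐ f ∂(Measure.pi fun _ : Fin k => (M.fLaw : Measure (S → Potential X))),
      ∫⁻ b, ∏ i, ENNReal.ofReal (1 - ε * (1 - theta (k := k) (b, f) fun j => z j i))
        ∂(M.bLaw : Measure (S → ℝ))
      = ∑ s : r → Option S,
          ENNReal.ofReal (∫ b, ∏ i, extCoeff ε b (s i) ∂(M.bLaw : Measure (S → ℝ)))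
          * ∏ j, ∏ i, (extFactor (f j) (s i) (z j i) : ℝ≥0∞) := by
    filter_upwards [hτ'] with f hf
    have e : ∀ b : S → ℝ, ∏ i, (1 - ε * (1 - theta (k := k) (b, f) fun j => z j i))
        = ∑ s : r → Option S, (∏ i, extCoeff ε b (s i)) *
          ∏ j, ∏ i, (extFactor (f j) (s i) (z j i) : ℝ) := by
      intro b
      simp_rw [one_sub_mul_one_sub_theta]
      rw [Finset.prod_univ_sum, Fintype.piFinset_univ]
      refine Finset.sum_congr rfl fun s _ => ?_
      rw [Finset.prod_mul_distrib, Finset.prod_comm]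
    have hi : ∀ s : r → Option S, Integrable (fun b => (∏ i, extCoeff ε b (s i)) *
          ∏ j, ∏ i, (extFactor (f j) (s i) (z j i) : ℝ)) (M.bLaw : Measure (S → ℝ)) :=
      fun s => (hM.extCoeff h0 h1 s).1.mul_const _
    calc ∫⁻ b, ∏ i, ENNReal.ofReal (1 - ε * (1 - theta (k := k) (b, f) fun j => z j i))
          ∂(M.bLaw : Measure (S → ℝ))
        = ∫⁻ b, ENNReal.ofReal (∏ i, (1 - ε * (1 - theta (k := k) (b, f) fun j => z j i)))
          ∂(M.bLaw : Measure (S → ℝ)) := by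
          refine lintegral_congr_ae ?_
          filter_upwards [hf] with b hb
          exact (ENNReal.ofReal_prod_of_nonneg fun i _ => hb _).symm
      _ = ENNReal.ofReal (∫ b, ∏ i, (1 - ε * (1 - theta (k := k) (b, f) fun j => z j i))
          ∂(M.bLaw : Measure (S → ℝ))) := by
          rw [ofReal_integral_eq_lintegral_ofReal]
          · simp_rw [e]
            exact integrable_finsetSum _ fun s _ => hi s
          · filter_upwards [hf] with b hb
            exact Finset.prod_nonneg fun i _ => hb _
      _ = _ := by
          simp_rw [e]
          rw [integral_finsetSum _ fun s _ => hi s]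
          simp_rw [integral_mul_const]
          rw [ENNReal.ofReal_sum_of_nonneg]
          · refine Finset.sum_congr rfl fun s _ => ?_
            rw [ENNReal.ofReal_mul (hM.extCoeff h0 h1 s).2]
            congr 1
            rw [ENNReal.ofReal_prod_of_nonneg fun j _ =>
              Finset.prod_nonneg fun i _ => NNReal.coe_nonneg _]
            refine Finset.prod_congr rfl fun j _ => ?_
            rw [ENNReal.ofReal_prod_of_nonneg fun i _ => NNReal.coe_nonneg _]
            simp
          · intro s _
            exact mul_nonneg (hM.extCoeff h0 h1 s).2
              (Finset.prod_nonneg fun j _ => Finset.prod_nonneg fun i _ => NNReal.coe_nonneg _)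
  rw [lintegral_congr_ae hin, lintegral_finsetSum _ fun s _ => by fun_prop]
  refine Finset.sum_congr rfl fun s _ => ?_
  rw [lintegral_const_mul _ (by fun_prop)]
  congr 1
  exact lintegral_pi_prod (fun _ : Fin k => (M.fLaw : Measure (S → Potential X)))
    (fun j f => ∏ i, (extFactor f (s i) (z j i) : ℝ≥0∞)) fun j => by fun_prop

end Positivity

/-! ### Averaging over uniform attachment points -/

/-- The average of `f` over all maps `p : Fin k → ι`. -/
def ENNReal_avg_pi {ι : Type*} [Fintype ι] {k : ℕ} (f : (Fin k → ι) → ℝ≥0∞) : ℝ≥0∞ :=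
  ((Fintype.card ι : ℝ≥0∞)⁻¹) ^ k * ∑ p, f p

/-- The replica moment when the slots in `J` are filled from independent sources with moments `mc`
and the slots outside `J` are read off a common configuration with moments `m`. -/
def mixedMoment {r X Y ι : Type*} [Fintype r] [DecidableEq r] [Fintype X] [Fintype Y] [DecidableEq X] {k : ℕ}
    (m : (r → Y) → ℝ≥0∞) (mc : (r → X) → ℝ≥0∞) (pos : ι → Y → X)
    (W : (Fin k → r → X) → ℝ≥0∞) (J : Finset (Fin k)) (p : Fin k → ι) : ℝ≥0∞ :=
  ∑ y : r → Y, m y * ∑ z : Fin k → r → X,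
    (∏ j, if j ∈ J then mc (z j) else if z j = fun i => pos (p j) (y i) then 1 else 0) * W z

/-- For a fixed term `s` and fixed replica configurations `y` the slots no longer interact.
Averaging over independent positions therefore gives a product: one position average for each slot
outside `J`, one source moment for each slot in `J`. -/
theorem avg_mixedMoment {r X Y ι T : Type*} [Fintype r] [DecidableEq r] [Fintype X] [Fintype Y]
    [DecidableEq Y]
    [DecidableEq X] [Fintype ι] [Nonempty ι] [Fintype T] {k : ℕ}
    (m : (r → Y) → ℝ≥0∞) (mc : (r → X) → ℝ≥0∞) (pos : ι → Y → X)
    {W : (Fin k → r → X) → ℝ≥0∞} {β : T → ℝ≥0∞} {F : T → (r → X) → ℝ≥0∞}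
    (hW : ∀ z, W z = ∑ s, β s * ∏ j, F s (z j)) (J : Finset (Fin k)) :
    ENNReal_avg_pi (mixedMoment m mc pos W J)
      = ∑ y : r → Y, m y * ∑ s, β s *
        (((Fintype.card ι : ℝ≥0∞)⁻¹ * ∑ i, F s fun l => pos i (y l)) ^ (Jᶜ).card
          * (∑ ζ, mc ζ * F s ζ) ^ J.card) := by
  have hcard : (Fintype.card ι : ℝ≥0∞)⁻¹ * (Fintype.card ι : ℝ≥0∞) = 1 :=
    ENNReal.inv_mul_cancel (by simp) (by simp)
  have hz : ∀ (p : Fin k → ι) (y : r → Y) (s : T),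
      ∑ z : Fin k → r → X, (∏ j, if j ∈ J then mc (z j)
          else if z j = fun i => pos (p j) (y i) then 1 else 0) * ∏ j, F s (z j)
        = ∏ j, if j ∈ J then ∑ ζ, mc ζ * F s ζ else F s fun i => pos (p j) (y i) := by
    intro p y s
    simp_rw [← Finset.prod_mul_distrib]
    rw [← Fintype.piFinset_univ, ← Finset.prod_univ_sum (fun _ => Finset.univ)
      (fun j ζ => (if j ∈ J then mc ζ
          else if ζ = fun i => pos (p j) (y i) then 1 else 0) * F s ζ)]
    refine Finset.prod_congr rfl fun j _ => ?_
    split_ifs with hj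
    · rfl
    · simp
  have hp : ∀ (y : r → Y) (s : T),
      ((Fintype.card ι : ℝ≥0∞)⁻¹) ^ k * ∑ p : Fin k → ι,
        (∏ j, if j ∈ J then ∑ ζ, mc ζ * F s ζ else F s fun i => pos (p j) (y i))
      = ((Fintype.card ι : ℝ≥0∞)⁻¹ * ∑ i, F s fun l => pos i (y l)) ^ (Jᶜ).card
          * (∑ ζ, mc ζ * F s ζ) ^ J.card := by
    intro y s
    rw [← Fintype.piFinset_univ, ← Finset.prod_univ_sum (fun _ => (Finset.univ : Finset ι))
      (fun j i => if j ∈ J then ∑ ζ, mc ζ * F s ζ else F s fun l => pos i (y l)),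
      ← Fin.prod_const, ← Finset.prod_mul_distrib]
    have : ∀ j, (Fintype.card ι : ℝ≥0∞)⁻¹ *
        ∑ i : ι, (if j ∈ J then ∑ ζ, mc ζ * F s ζ else F s fun l => pos i (y l))
        = if j ∈ J then ∑ ζ, mc ζ * F s ζ
          else (Fintype.card ι : ℝ≥0∞)⁻¹ * ∑ i, F s fun l => pos i (y l) := by
      intro j
      split_ifs
      · rw [Finset.sum_const, Finset.card_univ, nsmul_eq_mul, ← mul_assoc, hcard, one_mul]
      · rfl
    simp_rw [this]
    rw [Finset.prod_ite, Finset.prod_const, Finset.prod_const, mul_comm]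
    congr 3
    · ext; simp
    · simp
  unfold ENNReal_avg_pi mixedMoment
  simp_rw [hW, Finset.mul_sum (Finset.univ : Finset T)]
  have hcomm : ∀ (p : Fin k → ι) (y : r → Y),
      ∑ z : Fin k → r → X, ∑ s, (∏ j, if j ∈ J then mc (z j)
          else if z j = fun i => pos (p j) (y i) then 1 else 0) * (β s * ∏ j, F s (z j))
        = ∑ s, β s * ∏ j, if j ∈ J then ∑ ζ, mc ζ * F s ζ else F s fun i => pos (p j) (y i) := by
    intro p y
    rw [Finset.sum_comm]
    refine Finset.sum_congr rfl fun s _ => ?_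
    rw [← hz, Finset.mul_sum]
    exact Finset.sum_congr rfl fun z _ => by ring
  simp_rw [hcomm]
  rw [Finset.sum_comm, Finset.mul_sum]
  refine Finset.sum_congr rfl fun y _ => ?_
  rw [← Finset.mul_sum, Finset.sum_comm, mul_left_comm, ← Finset.mul_sum]
  congr 1
  rw [Finset.mul_sum]
  refine Finset.sum_congr rfl fun s _ => ?_
  rw [← Finset.mul_sum, mul_left_comm, hp]

/-- Term by term in `y` and `s`, the three choices of `J` give A B^(k-1), A^k and B^k, and the
weighted AM–GM inequality applies since all weights are nonnegative. -/
theorem mixedMoment_interpolation {r X Y ι T : Type*} [Fintype r] [DecidableEq r] [Fintype X]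
    [Fintype Y] [DecidableEq Y]
    [DecidableEq X] [Fintype ι] [Nonempty ι] [Fintype T] {k : ℕ} [NeZero k]
    (m : (r → Y) → ℝ≥0∞) (mc : (r → X) → ℝ≥0∞) (pos : ι → Y → X)
    {W : (Fin k → r → X) → ℝ≥0∞} {β : T → ℝ≥0∞} {F : T → (r → X) → ℝ≥0∞}
    (hW : ∀ z, W z = ∑ s, β s * ∏ j, F s (z j)) :
    (k : ℝ≥0∞) * ENNReal_avg_pi (mixedMoment m mc pos W (Finset.univ.erase 0))
      ≤ ENNReal_avg_pi (mixedMoment m mc pos W ∅)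
        + ((k - 1 : ℕ) : ℝ≥0∞) * ENNReal_avg_pi (mixedMoment m mc pos W Finset.univ) := by
  simp_rw [avg_mixedMoment m mc pos hW]
  rw [Finset.mul_sum, Finset.mul_sum, ← Finset.sum_add_distrib]
  refine Finset.sum_le_sum fun y _ => ?_
  rw [mul_left_comm, mul_left_comm _ (m y), ← mul_add]
  gcongr
  rw [Finset.mul_sum, Finset.mul_sum, ← Finset.sum_add_distrib]
  refine Finset.sum_le_sum fun s _ => ?_
  rw [mul_left_comm, mul_left_comm _ (β s), ← mul_add]
  gcongr
  obtain ⟨l, rfl⟩ : ∃ l, k = l + 1 := ⟨k - 1, (Nat.succ_pred_eq_of_pos (NeZero.pos k)).symm⟩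
  have h := ENNReal_weighted_amgm l ((Fintype.card ι : ℝ≥0∞)⁻¹ * ∑ i, F s fun l => pos i (y l))
    (∑ ζ, mc ζ * F s ζ)
  have hc : ((Finset.univ.erase (0 : Fin (l + 1)))ᶜ).card = 1 := by
    rw [Finset.card_compl, Finset.card_erase_of_mem (Finset.mem_univ _)]
    simp
  rw [hc]
  simpa using h

/-! ### One cavity slot: normalisation, weights and tilted measure -/

section Slots

variable {X S : Type*} [MeasurableSpace X]

/-- The normalisation `∑_x h(x) ρ(x)`. -/
def slotNorm [Fintype X] (h : Potential X) (ρ : M0 X) : ℝ := ∑ x, (h x : ℝ) * (ρ {x} : ℝ)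

/-- The probability weights proportional to `h(x) ρ(x)`. -/
def slotProb [Fintype X] (h : Potential X) (ρ : M0 X) (x : X) : ℝ :=
  (h x : ℝ) * (ρ {x} : ℝ) / slotNorm h ρ

/-- The clause environment has potentials with values between `ε` and `1 / ε`. -/
structure GoodEnv [Fintype S] {k : ℕ} (ε : ℝ) (e : ClauseEnv X S k) : Prop where
  clause : ∀ x : Fin k → X, ε ≤ 1 - theta e.1 x ∧ 1 - theta e.1 x ≤ 1 / ε
  slot : ∀ j x, ε ≤ (e.2.1 j x : ℝ) ∧ (e.2.1 j x : ℝ) ≤ 1 / ε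

@[fun_prop]
theorem measurable_theta [Fintype S] {k : ℕ} (x : Fin k → X) :
    Measurable fun c : ClauseLabel X S k => theta c x := by
  unfold theta
  fun_prop

variable [Fintype X] [DiscreteMeasurableSpace X]

@[fun_prop]
theorem measurable_mass (x : X) : Measurable fun ρ : M0 X => ρ {x} := by
  have h : Measurable fun ρ : M0 X => (ρ : Measure X) {x} :=
    (Measure.measurable_coe (MeasurableSet.singleton x)).comp measurable_subtype_coe
  exact h.ennreal_toNNReal

omit [DiscreteMeasurableSpace X] in
theorem sum_mass [MeasurableSingletonClass X] (ρ : M0 X) : ∑ x, (ρ {x} : ℝ) = 1 := by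
  have h := sum_measureReal_singleton (μ := (ρ : Measure X)) Finset.univ
  simp only [Finset.coe_univ] at h
  rw [probReal_univ] at h
  exact h

theorem slotNorm_bounds {h : Potential X} {ε : ℝ}
    (hh : ∀ x, ε ≤ (h x : ℝ) ∧ (h x : ℝ) ≤ 1 / ε) (ρ : M0 X) :
    ε ≤ slotNorm h ρ ∧ slotNorm h ρ ≤ 1 / ε := by
  have h1 := sum_mass ρ
  constructor
  · calc ε = ∑ x, ε * (ρ {x} : ℝ) := by rw [← Finset.mul_sum, h1, mul_one]
      _ ≤ _ := Finset.sum_le_sum fun x _ =>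
        mul_le_mul_of_nonneg_right (hh x).1 (NNReal.coe_nonneg _)
  · calc _ ≤ ∑ x, 1 / ε * (ρ {x} : ℝ) := Finset.sum_le_sum fun x _ =>
          mul_le_mul_of_nonneg_right (hh x).2 (NNReal.coe_nonneg _)
      _ = 1 / ε := by rw [← Finset.mul_sum, h1, mul_one]

omit [DiscreteMeasurableSpace X] in
theorem slotProb_nonneg (h : Potential X) (ρ : M0 X) (x : X) : 0 ≤ slotProb h ρ x := by
  unfold slotProb slotNorm
  positivity

omit [DiscreteMeasurableSpace X] in
theorem sum_slotProb {h : Potential X} {ρ : M0 X} (h0 : 0 < slotNorm h ρ) :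
    ∑ x, slotProb h ρ x = 1 := by
  unfold slotProb
  rw [← Finset.sum_div]
  exact div_self h0.ne'

@[fun_prop]
theorem measurable_slotNorm : Measurable fun p : Potential X × M0 X => slotNorm p.1 p.2 := by
  unfold slotNorm
  refine Finset.measurable_sum _ fun x _ => ?_
  exact (((measurable_pi_apply x).comp measurable_fst).coe_nnreal_real).mul
    ((measurable_mass x).comp measurable_snd).coe_nnreal_real

@[fun_prop]
theorem measurable_slotProb (x : X) :
    Measurable fun p : Potential X × M0 X => slotProb p.1 p.2 x := by
  unfold slotProb
  exact ((((measurable_pi_apply x).comp measurable_fst).coe_nnreal_real).mul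
    ((measurable_mass x).comp measurable_snd).coe_nnreal_real).div measurable_slotNorm

/-- `log 𝔼'[(∑_x h(x) ρ(x)) ^ lam]`. -/
def slotLog (lam : ℝ) (h : Potential X) (η : M1 X) : ℝ :=
  Real.log (∫ ρ, slotNorm h ρ ^ lam ∂(η : Measure (M0 X)))

/-- The density of the measure on `M0 X` tilted by `(∑_x h(x) ρ(x)) ^ lam`. -/
def slotDensity (lam : ℝ) (h : Potential X) (η : M1 X) (ρ : M0 X) : ℝ :=
  slotNorm h ρ ^ lam / ∫ ρ, slotNorm h ρ ^ lam ∂(η : Measure (M0 X))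

/-- The kernel `(h, η) ↦ η`. -/
def slotKernel (X : Type*) [MeasurableSpace X] :
    ProbabilityTheory.Kernel (Potential X × M1 X) (M0 X) :=
  ⟨fun p => (p.2 : Measure (M0 X)), measurable_subtype_coe.comp measurable_snd⟩

instance : ProbabilityTheory.IsMarkovKernel (slotKernel X) :=
  ⟨fun p => inferInstanceAs (IsProbabilityMeasure (p.2 : Measure (M0 X)))⟩

theorem measurable_integral_slotNorm (lam : ℝ) : Measurable fun p : Potential X × M1 X =>
    ∫ ρ, slotNorm p.1 ρ ^ lam ∂(p.2 : Measure (M0 X)) := by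
  have : StronglyMeasurable fun a : (Potential X × M1 X) × M0 X => slotNorm a.1.1 a.2 ^ lam := by
    refine Measurable.stronglyMeasurable ?_
    exact (measurable_slotNorm.comp
      ((measurable_fst.comp measurable_fst).prodMk measurable_snd)).pow_const _
  exact (this.integral_kernel_prod_right' (κ := slotKernel X)).measurable

theorem measurable_slotLog (lam : ℝ) :
    Measurable fun p : Potential X × M1 X => slotLog lam p.1 p.2 :=
  (measurable_integral_slotNorm lam).log

theorem measurable_slotDensity (lam : ℝ) :
    Measurable fun a : (Potential X × M1 X) × M0 X => slotDensity lam a.1.1 a.1.2 a.2 := by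
  unfold slotDensity
  refine Measurable.div ?_ ((measurable_integral_slotNorm lam).comp measurable_fst)
  exact (measurable_slotNorm.comp
      ((measurable_fst.comp measurable_fst).prodMk measurable_snd)).pow_const _

theorem measurable_slotNorm_right (h : Potential X) : Measurable (slotNorm h) :=
  measurable_slotNorm.comp measurable_prodMk_left

theorem integrable_slotNorm_rpow {h : Potential X} {ε lam : ℝ} (hε : 0 < ε) (hl : 0 ≤ lam)
    (hh : ∀ x, ε ≤ (h x : ℝ) ∧ (h x : ℝ) ≤ 1 / ε) (η : M1 X) :
    Integrable (fun ρ => slotNorm h ρ ^ lam) (η : Measure (M0 X)) := by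
  refine Integrable.of_bound ((measurable_slotNorm_right h).pow_const _).aestronglyMeasurable
    ((1 / ε) ^ lam) (Filter.Eventually.of_forall fun ρ => ?_)
  have hb := slotNorm_bounds hh ρ
  rw [Real.norm_of_nonneg (Real.rpow_nonneg (hε.le.trans hb.1) _)]
  exact Real.rpow_le_rpow (hε.le.trans hb.1) hb.2 hl

theorem integral_slotNorm_bounds {h : Potential X} {ε lam : ℝ} (hε : 0 < ε) (hl : 0 ≤ lam)
    (hh : ∀ x, ε ≤ (h x : ℝ) ∧ (h x : ℝ) ≤ 1 / ε) (η : M1 X) :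
    ε ^ lam ≤ ∫ ρ, slotNorm h ρ ^ lam ∂(η : Measure (M0 X)) ∧
      ∫ ρ, slotNorm h ρ ^ lam ∂(η : Measure (M0 X)) ≤ (1 / ε) ^ lam := by
  have hi := integrable_slotNorm_rpow hε hl hh η
  constructor
  · calc ε ^ lam = ∫ _ρ, ε ^ lam ∂(η : Measure (M0 X)) := by simp
      _ ≤ _ := integral_mono (integrable_const _) hi fun ρ =>
        Real.rpow_le_rpow hε.le (slotNorm_bounds hh ρ).1 hl
  · calc _ ≤ ∫ _ρ, (1 / ε) ^ lam ∂(η : Measure (M0 X)) :=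
          integral_mono hi (integrable_const _) fun ρ =>
            Real.rpow_le_rpow (hε.le.trans (slotNorm_bounds hh ρ).1) (slotNorm_bounds hh ρ).2 hl
      _ = _ := by simp

theorem integral_slotDensity {h : Potential X} {ε lam : ℝ} (hε : 0 < ε) (hl : 0 ≤ lam)
    (hh : ∀ x, ε ≤ (h x : ℝ) ∧ (h x : ℝ) ≤ 1 / ε) (η : M1 X) :
    ∫ ρ, slotDensity lam h η ρ ∂(η : Measure (M0 X)) = 1 := by
  unfold slotDensity
  rw [integral_div]
  exact div_self ((Real.rpow_pos_of_pos hε _).trans_le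
    (integral_slotNorm_bounds hε hl hh η).1).ne'

omit [DiscreteMeasurableSpace X] in
theorem slotDensity_nonneg (lam : ℝ) (h : Potential X) (η : M1 X) (ρ : M0 X) :
    0 ≤ slotDensity lam h η ρ := by
  have : ∀ ρ : M0 X, 0 ≤ slotNorm h ρ ^ lam := fun ρ =>
    Real.rpow_nonneg (by unfold slotNorm; positivity) _
  exact div_nonneg (this ρ) (integral_nonneg this)

theorem slotLog_bounds {h : Potential X} {ε lam : ℝ} (hε : 0 < ε) (hl : 0 ≤ lam)
    (hh : ∀ x, ε ≤ (h x : ℝ) ∧ (h x : ℝ) ≤ 1 / ε) (η : M1 X) :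
    |slotLog lam h η| ≤ lam * Real.log (1 / ε) := by
  have hb := integral_slotNorm_bounds hε hl hh η
  have hp : 0 < ε ^ lam := Real.rpow_pos_of_pos hε _
  unfold slotLog
  rw [abs_le]
  constructor
  · rw [one_div, Real.log_inv, mul_neg, neg_neg, ← Real.log_rpow hε]
    exact Real.log_le_log hp hb.1
  · rw [← Real.log_rpow (by positivity)]
    exact Real.log_le_log (hp.trans_le hb.1) hb.2

end Slots

/-! ### A factor with some slots filled from the environment -/

section Mixed

variable {X S : Type*} [MeasurableSpace X] [Fintype X] [DecidableEq X] [Fintype S] {k : ℕ}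

/-- The clause sum in which the slots of `J` are filled from the environment, and the others are
set to the values prescribed by `a`. -/
def mixedU (J : Finset (Fin k)) (e : ClauseEnv X S k) (q : Fin k → M0 X) (a : Fin k → X) : ℝ :=
  ∑ x : Fin k → X, (1 - theta e.1 x) *
    ∏ j, if j ∈ J then hRho e q j (x j) else if x j = a j then 1 else 0

/-- The normalised weights of `mixedU`. -/
def mixedWeight (J : Finset (Fin k)) (e : ClauseEnv X S k) (q : Fin k → M0 X) (a : Fin k → X)
    (x : Fin k → X) : ℝ :=
  ∏ j, if j ∈ J then slotProb (e.2.1 j) (q j) (x j) else if x j = a j then 1 else 0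

theorem mixedU_empty (e : ClauseEnv X S k) (q : Fin k → M0 X) (a : Fin k → X) :
    mixedU ∅ e q a = 1 - theta e.1 a := by
  unfold mixedU
  rw [Finset.sum_eq_single a]
  · simp
  · intro x _ hx
    obtain ⟨j, hj⟩ := Function.ne_iff.1 hx
    rw [Finset.prod_eq_zero (Finset.mem_univ j) (by simp [hj]), mul_zero]
  · simp

theorem mixedU_univ (e : ClauseEnv X S k) (q : Fin k → M0 X) (a : Fin k → X) :
    mixedU Finset.univ e q a = uClause e q := by
  simp [mixedU, uClause]

theorem mixedU_erase [NeZero k] (e : ClauseEnv X S k) (q : Fin k → M0 X) (a : Fin k → X) :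
    mixedU (Finset.univ.erase 0) e q a = uVar e q (a 0) := by
  unfold mixedU uVar
  refine Finset.sum_congr rfl fun x _ => ?_
  rw [← Finset.mul_prod_erase _ _ (Finset.mem_univ (0 : Fin k))]
  have : ∏ j ∈ Finset.univ.erase (0 : Fin k), (if j ∈ Finset.univ.erase (0 : Fin k)
      then hRho e q j (x j) else if x j = a j then 1 else 0)
      = ∏ j ∈ Finset.univ.erase (0 : Fin k), hRho e q j (x j) :=
    Finset.prod_congr rfl fun j hj => if_pos hj
  rw [this]
  by_cases h : x 0 = a 0 <;> simp [h]

theorem mixedWeight_nonneg (J : Finset (Fin k)) (e : ClauseEnv X S k) (q : Fin k → M0 X)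
    (a x : Fin k → X) : 0 ≤ mixedWeight J e q a x := by
  refine Finset.prod_nonneg fun j _ => ?_
  split_ifs
  · exact slotProb_nonneg _ _ _
  · exact zero_le_one
  · exact le_rfl

variable [DiscreteMeasurableSpace X]

theorem sum_mixedWeight {ε : ℝ} (hε : 0 < ε) (J : Finset (Fin k)) {e : ClauseEnv X S k}
    (he : GoodEnv ε e) (q : Fin k → M0 X) (a : Fin k → X) :
    ∑ x, mixedWeight J e q a x = 1 := by
  unfold mixedWeight
  rw [← Fintype.piFinset_univ, ← Finset.prod_univ_sum (fun _ => Finset.univ)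
    (fun j ζ => if j ∈ J then slotProb (e.2.1 j) (q j) ζ else if ζ = a j then 1 else 0)]
  refine Finset.prod_eq_one fun j _ => ?_
  split_ifs
  · exact sum_slotProb (hε.trans_le (slotNorm_bounds (he.slot j) _).1)
  · simp

/-- The expectation of `1 - ε (1 - θ)` under `mixedWeight`. -/
def mixedTheta (ε : ℝ) (J : Finset (Fin k)) (e : ClauseEnv X S k) (q : Fin k → M0 X)
    (a : Fin k → X) : ℝ :=
  ∑ x, mixedWeight J e q a x * (1 - ε * (1 - theta e.1 x))

theorem GoodEnv.tau_bounds {ε : ℝ} (hε : 0 < ε) {e : ClauseEnv X S k} (he : GoodEnv ε e)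
    (x : Fin k → X) :
    0 ≤ 1 - ε * (1 - theta e.1 x) ∧ 1 - ε * (1 - theta e.1 x) ≤ 1 - ε ^ 2 := by
  have h := he.clause x
  have h1 := mul_le_mul_of_nonneg_left h.1 hε.le
  have h2 := mul_le_mul_of_nonneg_left h.2 hε.le
  rw [mul_one_div_cancel hε.ne'] at h2
  constructor <;> nlinarith

theorem mixedTheta_bounds {ε : ℝ} (hε : 0 < ε) (J : Finset (Fin k)) {e : ClauseEnv X S k}
    (he : GoodEnv ε e) (q : Fin k → M0 X) (a : Fin k → X) :
    0 ≤ mixedTheta ε J e q a ∧ mixedTheta ε J e q a ≤ 1 - ε ^ 2 := by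
  have hs := sum_mixedWeight hε J he q a
  constructor
  · exact Finset.sum_nonneg fun x _ =>
      mul_nonneg (mixedWeight_nonneg _ _ _ _ _) (he.tau_bounds hε x).1
  · calc _ ≤ ∑ x, mixedWeight J e q a x * (1 - ε ^ 2) := Finset.sum_le_sum fun x _ =>
          mul_le_mul_of_nonneg_left (he.tau_bounds hε x).2 (mixedWeight_nonneg _ _ _ _ _)
      _ = _ := by rw [← Finset.sum_mul, hs, one_mul]

/-- A filled slot is its norm times probability weights, so the norms come out. Because the weights
sum to one, averaging 1 - θ = (1 - τ)/ε leaves ε⁻¹ times one minus the average of τ. -/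
theorem mixedU_eq {ε : ℝ} (hε : 0 < ε) (J : Finset (Fin k)) {e : ClauseEnv X S k}
    (he : GoodEnv ε e) (q : Fin k → M0 X) (a : Fin k → X) :
    mixedU J e q a
      = ε⁻¹ * (∏ j, if j ∈ J then slotNorm (e.2.1 j) (q j) else 1) * (1 - mixedTheta ε J e q a) := by
  have hs := sum_mixedWeight hε J he q a
  have h1 : 1 - mixedTheta ε J e q a = ∑ x, mixedWeight J e q a x * (ε * (1 - theta e.1 x)) := by
    nth_rewrite 1 [← hs]
    unfold mixedTheta
    rw [← Finset.sum_sub_distrib]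
    exact Finset.sum_congr rfl fun x _ => by ring
  rw [h1, Finset.mul_sum]
  unfold mixedU
  refine Finset.sum_congr rfl fun x _ => ?_
  have hw : (∏ j, if j ∈ J then hRho e q j (x j) else if x j = a j then 1 else 0)
      = (∏ j, if j ∈ J then slotNorm (e.2.1 j) (q j) else 1) * mixedWeight J e q a x := by
    unfold mixedWeight
    rw [← Finset.prod_mul_distrib]
    refine Finset.prod_congr rfl fun j _ => ?_
    split_ifs
    · have : slotNorm (e.2.1 j) (q j) ≠ 0 :=
        (hε.trans_le (slotNorm_bounds (he.slot j) _).1).ne'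
      unfold slotProb hRho
      field_simp
    · simp
    · simp
  rw [hw]
  field_simp

/-- The exponent counts at most `k` slot norms and one factor 1 - θ. The hypothesis ε ≤ 1 lets
unfilled slots, with factor 1, obey the same bound. -/
theorem mixedU_bounds {ε : ℝ} (hε : 0 < ε) (hε1 : ε ≤ 1) (J : Finset (Fin k))
    {e : ClauseEnv X S k} (he : GoodEnv ε e) (q : Fin k → M0 X) (a : Fin k → X) :
    ε ^ (k + 1) ≤ mixedU J e q a ∧ mixedU J e q a ≤ (1 / ε) ^ (k + 1) := by
  have hprod : ε ^ k ≤ (∏ j, if j ∈ J then slotNorm (e.2.1 j) (q j) else 1) ∧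
      (∏ j, if j ∈ J then slotNorm (e.2.1 j) (q j) else 1) ≤ (1 / ε) ^ k := by
    rw [← Fin.prod_const k ε, ← Fin.prod_const k (1 / ε)]
    constructor
    · refine Finset.prod_le_prod (fun _ _ => hε.le) fun j _ => ?_
      split_ifs
      · exact (slotNorm_bounds (he.slot j) _).1
      · exact hε1
    · refine Finset.prod_le_prod (fun j _ => ?_) fun j _ => ?_
      · split_ifs
        · exact hε.le.trans (slotNorm_bounds (he.slot j) _).1
        · exact zero_le_one
      · split_ifs
        · exact (slotNorm_bounds (he.slot j) _).2
        · exact (one_le_div hε).2 hε1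
  have ht := mixedTheta_bounds hε J he q a
  rw [mixedU_eq hε J he]
  have h0 : 0 < ε ^ k := by positivity
  have hi : ε⁻¹ * ε = 1 := inv_mul_cancel₀ hε.ne'
  constructor
  · calc ε ^ (k + 1) = ε⁻¹ * ε ^ k * ε ^ 2 := by
          rw [pow_succ, pow_two]
          linear_combination (-(ε ^ k * ε)) * hi
      _ ≤ _ := by
        have := hprod.1
        have : 0 ≤ ∏ j, if j ∈ J then slotNorm (e.2.1 j) (q j) else 1 := h0.le.trans this
        gcongr
        linarith
  · calc _ ≤ ε⁻¹ * (1 / ε) ^ k * 1 := by gcongr; exacts [by linarith [sq_nonneg ε], hprod.2, by linarith]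
      _ = _ := by rw [pow_succ, one_div]; ring

end Mixed

/-! ### A frozen system with Gibbs weights and tilted measure -/

/-- A measurable family of weights on configurations `Y`, bounded away from zero and infinity. -/
structure BaseWeight (R Y : Type*) [MeasurableSpace R] where
  w : R → Y → ℝ
  lo : ℝ
  hi : ℝ
  lo_pos : 0 < lo
  lo_le : ∀ r y, lo ≤ w r y
  le_hi : ∀ r y, w r y ≤ hi
  meas : ∀ y, Measurable fun r => w r y

namespace BaseWeight

variable {R Y : Type*} [MeasurableSpace R] [Fintype Y] (B : BaseWeight R Y)

/-- The partition function. -/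
def total (r : R) : ℝ := ∑ y, B.w r y

/-- The Gibbs weights. -/
def gibbs (r : R) (y : Y) : ℝ := B.w r y / B.total r

theorem measurable_total : Measurable B.total := by
  unfold total
  exact Finset.measurable_sum _ fun y _ => B.meas y

theorem measurable_gibbs (y : Y) : Measurable fun r => B.gibbs r y :=
  (B.meas y).div B.measurable_total

variable [Nonempty Y]

theorem total_pos (r : R) : 0 < B.total r :=
  Finset.sum_pos (fun y _ => B.lo_pos.trans_le (B.lo_le r y)) Finset.univ_nonempty

theorem lo_le_total (r : R) : B.lo ≤ B.total r := by
  obtain ⟨y⟩ := ‹Nonempty Y›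
  refine (B.lo_le r y).trans ?_
  exact Finset.single_le_sum (f := fun y => B.w r y)
    (fun y _ => B.lo_pos.le.trans (B.lo_le r y)) (Finset.mem_univ y)

theorem total_le (r : R) : B.total r ≤ Fintype.card Y * B.hi := by
  calc _ ≤ ∑ _y : Y, B.hi := Finset.sum_le_sum fun y _ => B.le_hi r y
    _ = _ := by simp

theorem gibbs_nonneg (r : R) (y : Y) : 0 ≤ B.gibbs r y :=
  div_nonneg (B.lo_pos.le.trans (B.lo_le r y)) (B.total_pos r).le

theorem sum_gibbs (r : R) : ∑ y, B.gibbs r y = 1 := by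
  unfold gibbs
  rw [← Finset.sum_div]
  exact div_self (B.total_pos r).ne'

variable (ν : Measure R) [IsProbabilityMeasure ν] (lam : ℝ)

theorem integrable_total_rpow : Integrable (fun r => B.total r ^ lam) ν := by
  refine Integrable.of_bound (B.measurable_total.pow_const _).aestronglyMeasurable
    (max (B.lo ^ lam) ((Fintype.card Y * B.hi) ^ lam)) (Filter.Eventually.of_forall fun r => ?_)
  rw [Real.norm_of_nonneg (Real.rpow_nonneg (B.total_pos r).le _)]
  rcases le_total 0 lam with h | h
  · exact (Real.rpow_le_rpow (B.total_pos r).le (B.total_le r) h).trans (le_max_right _ _)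
  · exact (Real.rpow_le_rpow_of_nonpos B.lo_pos (B.lo_le_total r) h).trans (le_max_left _ _)

theorem integral_total_rpow_pos : 0 < ∫ r, B.total r ^ lam ∂ν := by
  refine (integral_pos_iff_support_of_nonneg
    (fun r => Real.rpow_nonneg (B.total_pos r).le _) (B.integrable_total_rpow ν lam)).2 ?_
  have : Function.support (fun r => B.total r ^ lam) = Set.univ := by
    ext r
    simpa using (Real.rpow_pos_of_pos (B.total_pos r) lam).ne'
  rw [this]
  simp

/-- The density of the measure tilted by the `lam`-th power of the partition function. -/
def density (r : R) : ℝ := B.total r ^ lam / ∫ r, B.total r ^ lam ∂ν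

theorem density_nonneg (r : R) : 0 ≤ B.density ν lam r :=
  div_nonneg (Real.rpow_nonneg (B.total_pos r).le _) (B.integral_total_rpow_pos ν lam).le

omit [Nonempty Y] [IsProbabilityMeasure ν] in
theorem measurable_density : Measurable (B.density ν lam) :=
  (B.measurable_total.pow_const _).div_const _

theorem integral_density : ∫ r, B.density ν lam r ∂ν = 1 := by
  unfold density
  rw [integral_div]
  exact div_self (B.integral_total_rpow_pos ν lam).ne'

end BaseWeight

/-! ### Attaching one factor to a frozen system -/

section Fixed

variable {X S R Y ι : Type*} [MeasurableSpace X] [Fintype X] [DecidableEq X]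
  [DiscreteMeasurableSpace X] [Fintype S] {k : ℕ} [MeasurableSpace R] [Fintype Y]

omit [Fintype X] [DecidableEq X] [DiscreteMeasurableSpace X] [Fintype S] in
instance (e : ClauseEnv X S k) : IsProbabilityMeasure (rhoLaw e) := by
  unfold rhoLaw
  infer_instance

/-- `rhoLaw` as a kernel. -/
def rhoKernel (X S : Type*) [MeasurableSpace X] (k : ℕ) :
    ProbabilityTheory.Kernel (ClauseEnv X S k) (Fin k → M0 X) :=
  ⟨rhoLaw, measurable_measure_pi (fun (e : ClauseEnv X S k) j => (e.2.2 j : Measure (M0 X)))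
    fun j => measurable_subtype_coe.comp ((measurable_pi_apply j).comp
      (measurable_snd.comp measurable_snd))⟩

instance : ProbabilityTheory.IsMarkovKernel (rhoKernel X S k) :=
  ⟨fun e => inferInstanceAs (IsProbabilityMeasure (rhoLaw e))⟩

theorem measurable_hRho (j : Fin k) (x : X) :
    Measurable fun a : ClauseEnv X S k × (Fin k → M0 X) => hRho a.1 a.2 j x := by
  unfold hRho
  exact (((measurable_pi_apply x).comp ((measurable_pi_apply j).comp (measurable_fst.comp
    (measurable_snd.comp measurable_fst)))).coe_nnreal_real).mul
    ((measurable_mass x).comp ((measurable_pi_apply j).comp measurable_snd)).coe_nnreal_real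

theorem measurable_mixedU (J : Finset (Fin k)) (a : Fin k → X) :
    Measurable fun p : ClauseEnv X S k × (Fin k → M0 X) => mixedU J p.1 p.2 a := by
  unfold mixedU
  refine Finset.measurable_sum _ fun x _ => ?_
  refine Measurable.mul (measurable_const.sub
    ((measurable_theta x).comp (measurable_fst.comp measurable_fst))) ?_
  refine Finset.measurable_prod _ fun j _ => ?_
  split_ifs
  · exact measurable_hRho j _
  · exact measurable_const
  · exact measurable_const

/-- `log 𝔼'` of the `lam`-th power of the partition function with one more factor. -/
def mixedLog (B : BaseWeight R Y) (ν : Measure R) (lam : ℝ) (pos : ι → Y → X)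
    (J : Finset (Fin k)) (p : Fin k → ι) (e : ClauseEnv X S k) : ℝ :=
  Real.log (∫ a, (∑ y, B.w a.1 y * mixedU J e a.2 fun j => pos (p j) y) ^ lam
    ∂(ν.prod (rhoLaw e)))

theorem measurable_mixedLog (B : BaseWeight R Y) (ν : Measure R) [IsProbabilityMeasure ν]
    (lam : ℝ) (pos : ι → Y → X) (J : Finset (Fin k)) (p : Fin k → ι) :
    Measurable fun e : ClauseEnv X S k => mixedLog B ν lam pos J p e := by
  refine Measurable.log ?_
  have hm : StronglyMeasurable fun b : ClauseEnv X S k × (R × (Fin k → M0 X)) =>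
      (∑ y, B.w b.2.1 y * mixedU J b.1 b.2.2 fun j => pos (p j) y) ^ lam := by
    refine Measurable.stronglyMeasurable (Measurable.pow_const ?_ _)
    refine Finset.measurable_sum _ fun y _ => ?_
    have h1 : Measurable fun b : ClauseEnv X S k × (R × (Fin k → M0 X)) => B.w b.2.1 y :=
      (B.meas y).comp (measurable_fst.comp measurable_snd)
    have h2 : Measurable fun b : ClauseEnv X S k × (R × (Fin k → M0 X)) => (b.1, b.2.2) := by
      fun_prop
    have h3 := (measurable_mixedU (S := S) J fun j => pos (p j) y).comp h2
    exact h1.mul h3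
  have := hm.integral_kernel_prod_right'
    (κ := ProbabilityTheory.Kernel.prod
      (ProbabilityTheory.Kernel.const (ClauseEnv X S k) ν) (rhoKernel X S k))
  simp only [ProbabilityTheory.Kernel.prod_apply, ProbabilityTheory.Kernel.const_apply] at this
  exact this.measurable

/-- The law of the tilted measure of a fresh source. -/
def tiltDensity (B : BaseWeight R Y) (ν : Measure R) (lam : ℝ) (J : Finset (Fin k))
    (e : ClauseEnv X S k) (a : R × (Fin k → M0 X)) : ℝ :=
  B.density ν lam a.1 * ∏ j, if j ∈ J then slotDensity lam (e.2.1 j) (e.2.2 j) (a.2 j) else 1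

/-- The annealed value of `1 - ε (1 - θ)`. -/
def annealedTheta (ε : ℝ) (B : BaseWeight R Y) (pos : ι → Y → X)
    (J : Finset (Fin k)) (p : Fin k → ι) (e : ClauseEnv X S k) (a : R × (Fin k → M0 X)) : ℝ :=
  ∑ y, B.gibbs a.1 y * mixedTheta ε J e a.2 fun j => pos (p j) y

/-- Minus the logarithm of the normalised `lam`-th moment. -/
def gap (ε : ℝ) (B : BaseWeight R Y) (ν : Measure R) (lam : ℝ) (pos : ι → Y → X)
    (J : Finset (Fin k)) (p : Fin k → ι) (e : ClauseEnv X S k) : ℝ :=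
  lam * Real.log (1 / ε) + Real.log (∫ r, B.total r ^ lam ∂ν)
    + ∑ j ∈ J, slotLog lam (e.2.1 j) (e.2.2 j) - mixedLog B ν lam pos J p e

theorem measurable_slotDensity_right (lam : ℝ) (h : Potential X) (η : M1 X) :
    Measurable (slotDensity lam h η) :=
  ((measurable_slotNorm_right h).pow_const lam).div_const _

theorem measurable_tiltDensity (B : BaseWeight R Y) (ν : Measure R) (lam : ℝ)
    (J : Finset (Fin k)) (e : ClauseEnv X S k) : Measurable (tiltDensity B ν lam J e) := by
  unfold tiltDensity
  refine ((B.measurable_density ν lam).comp measurable_fst).mul ?_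
  refine Finset.measurable_prod _ fun j _ => ?_
  split_ifs
  · exact (measurable_slotDensity_right lam _ _).comp
      ((measurable_pi_apply j).comp measurable_snd)
  · exact measurable_const

theorem measurable_slotProb_right (h : Potential X) (x : X) :
    Measurable fun ρ => slotProb h ρ x :=
  (measurable_slotProb x).comp measurable_prodMk_left

theorem measurable_mixedWeight (J : Finset (Fin k)) (e : ClauseEnv X S k) (a x : Fin k → X) :
    Measurable fun q => mixedWeight J e q a x := by
  refine Finset.measurable_prod _ fun j _ => ?_
  split_ifs
  · exact (measurable_slotProb_right _ _).comp (measurable_pi_apply j)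
  · exact measurable_const
  · exact measurable_const

theorem measurable_annealedTheta (ε : ℝ) (B : BaseWeight R Y) (pos : ι → Y → X)
    (J : Finset (Fin k)) (p : Fin k → ι) (e : ClauseEnv X S k) :
    Measurable (annealedTheta ε B pos J p e) := by
  unfold annealedTheta
  refine Finset.measurable_sum _ fun y _ => ?_
  refine ((B.measurable_gibbs y).comp measurable_fst).mul ?_
  unfold mixedTheta
  refine Finset.measurable_sum _ fun x _ => Measurable.mul_const ?_ _
  exact (measurable_mixedWeight J e _ x).comp measurable_snd

variable [Nonempty Y]

theorem annealedTheta_bounds {ε : ℝ} (hε : 0 < ε) (B : BaseWeight R Y) (pos : ι → Y → X)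
    (J : Finset (Fin k)) (p : Fin k → ι) {e : ClauseEnv X S k} (he : GoodEnv ε e)
    (a : R × (Fin k → M0 X)) :
    0 ≤ annealedTheta ε B pos J p e a ∧ annealedTheta ε B pos J p e a ≤ 1 - ε ^ 2 := by
  have hs := B.sum_gibbs a.1
  constructor
  · exact Finset.sum_nonneg fun y _ => mul_nonneg (B.gibbs_nonneg _ _)
      (mixedTheta_bounds hε J he _ _).1
  · calc _ ≤ ∑ y, B.gibbs a.1 y * (1 - ε ^ 2) := Finset.sum_le_sum fun y _ =>
          mul_le_mul_of_nonneg_left (mixedTheta_bounds hε J he _ _).2 (B.gibbs_nonneg _ _)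
      _ = _ := by rw [← Finset.sum_mul, hs, one_mul]

theorem sum_weight_mixedU {ε : ℝ} (hε : 0 < ε) (B : BaseWeight R Y) (pos : ι → Y → X)
    (J : Finset (Fin k)) (p : Fin k → ι) {e : ClauseEnv X S k} (he : GoodEnv ε e)
    (a : R × (Fin k → M0 X)) :
    ∑ y, B.w a.1 y * mixedU J e a.2 (fun j => pos (p j) y)
      = ε⁻¹ * (B.total a.1 * (∏ j, if j ∈ J then slotNorm (e.2.1 j) (a.2 j) else 1))
        * (1 - annealedTheta ε B pos J p e a) := by
  have h1 : 1 - annealedTheta ε B pos J p e a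
      = ∑ y, B.gibbs a.1 y * (1 - mixedTheta ε J e a.2 fun j => pos (p j) y) := by
    nth_rewrite 1 [← B.sum_gibbs a.1]
    unfold annealedTheta
    rw [← Finset.sum_sub_distrib]
    exact Finset.sum_congr rfl fun x _ => by ring
  rw [h1, Finset.mul_sum]
  refine Finset.sum_congr rfl fun y _ => ?_
  rw [mixedU_eq hε J he]
  have := (B.total_pos a.1).ne'
  unfold BaseWeight.gibbs
  field_simp

theorem integral_tiltDensity (B : BaseWeight R Y) (ν : Measure R) [IsProbabilityMeasure ν]
    {ε lam : ℝ} (hε : 0 < ε) (hl : 0 ≤ lam) (J : Finset (Fin k)) {e : ClauseEnv X S k}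
    (he : GoodEnv ε e) :
    ∫ a, tiltDensity B ν lam J e a ∂(ν.prod (rhoLaw e)) = 1 := by
  unfold tiltDensity
  rw [integral_prod_mul (fun r => B.density ν lam r)
    (fun q : Fin k → M0 X =>
      ∏ j, if j ∈ J then slotDensity lam (e.2.1 j) (e.2.2 j) (q j) else 1),
    B.integral_density, one_mul]
  unfold rhoLaw
  rw [integral_fintype_prod_eq_prod
    (f := fun j ρ => if j ∈ J then slotDensity lam (e.2.1 j) (e.2.2 j) ρ else 1)]
  refine Finset.prod_eq_one fun j _ => ?_
  split_ifs
  · exact integral_slotDensity hε hl (he.slot j) _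
  · simp

theorem tiltDensity_nonneg (B : BaseWeight R Y) (ν : Measure R) [IsProbabilityMeasure ν]
    (lam : ℝ) (J : Finset (Fin k)) (e : ClauseEnv X S k)
    (a : R × (Fin k → M0 X)) : 0 ≤ tiltDensity B ν lam J e a := by
  refine mul_nonneg (B.density_nonneg ν lam _) (Finset.prod_nonneg fun j _ => ?_)
  split_ifs
  · exact slotDensity_nonneg _ _ _ _
  · exact zero_le_one

/-- Each factor of the partition function, raised to the power λ and divided by its own λ-moment, is
a density of `tiltDensity`. The logarithms of these moments, with λ log(1/ε) from the scaling of 1 -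
θ, are exactly the terms that `gap` adds. -/
theorem gap_eq (B : BaseWeight R Y) (ν : Measure R) [IsProbabilityMeasure ν]
    {ε lam : ℝ} (hε : 0 < ε) (hl : 0 < lam) (pos : ι → Y → X)
    (J : Finset (Fin k)) (p : Fin k → ι) {e : ClauseEnv X S k} (he : GoodEnv ε e) :
    gap ε B ν lam pos J p e
      = -Real.log (∫ a, tiltDensity B ν lam J e a * (1 - annealedTheta ε B pos J p e a) ^ lam
          ∂(ν.prod (rhoLaw e))) := by
  have hN : ∀ (ρ : M0 X) (j : Fin k), 0 < slotNorm (e.2.1 j) ρ := fun ρ j =>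
    hε.trans_le (slotNorm_bounds (he.slot j) ρ).1
  have hI : ∀ j, 0 < ∫ ρ, slotNorm (e.2.1 j) ρ ^ lam ∂(e.2.2 j : Measure (M0 X)) := fun j =>
    (Real.rpow_pos_of_pos hε _).trans_le (integral_slotNorm_bounds hε hl.le (he.slot j) _).1
  have hT := B.integral_total_rpow_pos ν lam
  set K : ℝ := ε⁻¹ ^ lam * ((∫ r, B.total r ^ lam ∂ν) *
    ∏ j ∈ J, ∫ ρ, slotNorm (e.2.1 j) ρ ^ lam ∂(e.2.2 j : Measure (M0 X))) with hK
  have hprod : 0 < ∏ j ∈ J, ∫ ρ, slotNorm (e.2.1 j) ρ ^ lam ∂(e.2.2 j : Measure (M0 X)) :=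
    Finset.prod_pos fun j _ => hI j
  have hpt : ∀ a : R × (Fin k → M0 X),
      (∑ y, B.w a.1 y * mixedU J e a.2 (fun j => pos (p j) y)) ^ lam
        = K * (tiltDensity B ν lam J e a * (1 - annealedTheta ε B pos J p e a) ^ lam) := by
    intro a
    have hθ := (annealedTheta_bounds hε B pos J p he a).2
    have hP : (0 : ℝ) ≤ ∏ j, if j ∈ J then slotNorm (e.2.1 j) (a.2 j) else 1 := by
      refine Finset.prod_nonneg fun j _ => ?_
      split_ifs
      · exact (hN _ _).le
      · exact zero_le_one
    rw [sum_weight_mixedU hε B pos J p he, Real.mul_rpow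
      (mul_nonneg (inv_nonneg.2 hε.le) (mul_nonneg (B.total_pos _).le hP))
      (by nlinarith [sq_nonneg ε]),
      Real.mul_rpow (inv_nonneg.2 hε.le) (mul_nonneg (B.total_pos _).le hP),
      Real.mul_rpow (B.total_pos _).le hP, ← mul_assoc K]
    congr 1
    rw [hK, mul_assoc]
    congr 1
    unfold tiltDensity
    rw [mul_mul_mul_comm]
    congr 1
    · unfold BaseWeight.density
      field_simp
    · have hJ : ∏ j ∈ J, ∫ ρ, slotNorm (e.2.1 j) ρ ^ lam ∂(e.2.2 j : Measure (M0 X))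
          = ∏ j, if j ∈ J then ∫ ρ, slotNorm (e.2.1 j) ρ ^ lam ∂(e.2.2 j : Measure (M0 X))
            else 1 := by simp
      rw [hJ, ← Finset.prod_mul_distrib, ← Real.finsetProd_rpow _ _ fun j _ => ?_]
      · refine Finset.prod_congr rfl fun j _ => ?_
        split_ifs
        · have := (hI j).ne'
          unfold slotDensity
          field_simp
        · simp
      · split_ifs
        · exact (hN _ _).le
        · exact zero_le_one
  have hD := integral_tiltDensity B ν hε hl.le J he
  -- Integrability comes for free: the Bochner integral of a non-integrable function is 0, and this
  -- one is 1.
  have hDi : Integrable (tiltDensity B ν lam J e) (ν.prod (rhoLaw e)) := by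
    by_contra h
    rw [integral_undef h] at hD
    exact zero_ne_one hD
  have hlow : 0 < ∫ a, tiltDensity B ν lam J e a * (1 - annealedTheta ε B pos J p e a) ^ lam
      ∂(ν.prod (rhoLaw e)) := by
    have hδ : 0 < (ε ^ 2) ^ lam := by positivity
    refine hδ.trans_le ?_
    have hm : Measurable fun a => (1 - annealedTheta ε B pos J p e a) ^ lam :=
      (measurable_const.sub (measurable_annealedTheta ε B pos J p e)).pow_const _
    calc (ε ^ 2) ^ lam = ∫ a, tiltDensity B ν lam J e a * (ε ^ 2) ^ lam ∂(ν.prod (rhoLaw e)) := by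
          rw [integral_mul_const, hD, one_mul]
      _ ≤ _ := by
        refine integral_mono (hDi.mul_const _) ?_ fun a => ?_
        · refine hDi.mono ((measurable_tiltDensity B ν lam J e).mul hm).aestronglyMeasurable
            (Filter.Eventually.of_forall fun a => ?_)
          have hb := annealedTheta_bounds hε B pos J p he a
          rw [norm_mul, Real.norm_of_nonneg (Real.rpow_nonneg (by nlinarith [sq_nonneg ε]) lam)]
          exact mul_le_of_le_one_right (norm_nonneg _)
            (Real.rpow_le_one (by nlinarith [sq_nonneg ε]) (by linarith) hl.le)
        · have hb := annealedTheta_bounds hε B pos J p he a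
          exact mul_le_mul_of_nonneg_left
            (Real.rpow_le_rpow (sq_nonneg ε) (by linarith) hl.le) (tiltDensity_nonneg B ν lam J e a)
  have hε' : 0 < ε⁻¹ ^ lam := Real.rpow_pos_of_pos (inv_pos.2 hε) _
  unfold gap mixedLog
  simp_rw [hpt]
  rw [integral_const_mul, Real.log_mul (by positivity) hlow.ne', hK,
    Real.log_mul hε'.ne' (by positivity), Real.log_mul hT.ne' hprod.ne',
    Real.log_prod fun j _ => (hI j).ne', Real.log_rpow (inv_pos.2 hε), one_div]
  unfold slotLog
  ring

end Fixed

theorem lintegral_pi_prod_pi {κ A B : Type*} [Fintype κ] [MeasurableSpace A] [MeasurableSpace B]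
    (μ : Measure A) (ν : Measure B) [IsProbabilityMeasure μ] [IsProbabilityMeasure ν]
    (f : κ → A × B → ℝ≥0∞) (hf : ∀ j, Measurable (f j)) :
    ∫⁻ p : (κ → A) × (κ → B), ∏ j, f j (p.1 j, p.2 j)
        ∂((Measure.pi fun _ => μ).prod (Measure.pi fun _ => ν))
      = ∏ j, ∫⁻ p, f j p ∂(μ.prod ν) := by
  rw [lintegral_prod _ (by
    refine (Finset.measurable_prod _ fun j _ => (hf j).comp ?_).aemeasurable
    fun_prop)]
  have h1 : ∀ a : κ → A, ∫⁻ b : κ → B, ∏ j, f j (a j, b j) ∂(Measure.pi fun _ => ν)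
      = ∏ j, ∫⁻ b, f j (a j, b) ∂ν := fun a =>
    lintegral_pi_prod (fun _ : κ => ν) (fun j b => f j (a j, b))
      fun j => (hf j).comp measurable_prodMk_left
  simp_rw [h1]
  rw [lintegral_pi_prod (fun _ : κ => μ) (fun j a => ∫⁻ b, f j (a, b) ∂ν)
    fun j => (hf j).lintegral_prod_right']
  refine Finset.prod_congr rfl fun j _ => ?_
  rw [lintegral_prod _ (hf j).aemeasurable]

/-! ### Replica expansion of the gap and the interpolation inequality -/

section Fixed

variable {X S R Y ι : Type*} [MeasurableSpace X] [Fintype X] [DecidableEq X]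
  [DiscreteMeasurableSpace X] [Fintype S] {k : ℕ} [MeasurableSpace R] [Fintype Y]

/-- The replica moment of one fresh source. -/
def slotMoment (lam : ℝ) (I : LogIndex) (ζ : Replica I → X) (s : Potential X × M1 X) : ℝ≥0∞ :=
  replicaMoment (s.2 : Measure (M0 X)) (fun ρ => ENNReal.ofReal (slotDensity lam s.1 s.2 ρ))
    (fun ρ x => ENNReal.ofReal (slotProb s.1 ρ x)) I ζ

theorem measurable_slotMoment (lam : ℝ) (I : LogIndex) (ζ : Replica I → X) :
    Measurable (slotMoment lam I ζ) := by
  unfold slotMoment replicaMoment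
  refine Finset.measurable_prod _ fun i _ => ?_
  have hm : Measurable fun a : (Potential X × M1 X) × M0 X =>
      ENNReal.ofReal (slotDensity lam a.1.1 a.1.2 a.2) *
        ∏ l, ENNReal.ofReal (slotProb a.1.1 a.2 (ζ ⟨i, l⟩)) := by
    refine (measurable_slotDensity lam).ennreal_ofReal.mul
      (Finset.measurable_prod _ fun l _ => ?_)
    have h2 : Measurable fun a : (Potential X × M1 X) × M0 X => (a.1.1, a.2) := by fun_prop
    exact ((measurable_slotProb (ζ ⟨i, l⟩)).comp h2).ennreal_ofReal
  exact hm.lintegral_kernel_prod_right' (κ := slotKernel X)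

/-- The replica moment of the Gibbs measure. -/
def gibbsMoment (B : BaseWeight R Y) (ν : Measure R) (lam : ℝ) (I : LogIndex)
    (y : Replica I → Y) : ℝ≥0∞ :=
  replicaMoment ν (fun r => ENNReal.ofReal (B.density ν lam r))
    (fun r y => ENNReal.ofReal (B.gibbs r y)) I y

/-- Under the tilted law the Gibbs part and the slots are independent, hence every replica moment
splits into one factor for the system and one per slot. For an unfilled slot the indicators of all
replicas merge into a single indicator. -/
theorem replicaMoment_mixed (B : BaseWeight R Y) (ν : Measure R) [IsProbabilityMeasure ν]
    [Nonempty Y]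
    (lam : ℝ) (pos : ι → Y → X) (J : Finset (Fin k)) (p : Fin k → ι) (e : ClauseEnv X S k)
    (I : LogIndex) (y : Replica I → Y) (x : Replica I → Fin k → X) :
    replicaMoment (ν.prod (rhoLaw e)) (fun a => ENNReal.ofReal (tiltDensity B ν lam J e a))
      (fun a (yx : Y × (Fin k → X)) => ENNReal.ofReal (B.gibbs a.1 yx.1) *
        ∏ j, if j ∈ J then ENNReal.ofReal (slotProb (e.2.1 j) (a.2 j) (yx.2 j))
          else if yx.2 j = pos (p j) yx.1 then 1 else 0) I (fun r => (y r, x r))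
      = gibbsMoment B ν lam I y *
        ∏ j, if j ∈ J then slotMoment lam I (fun r => x r j) (e.2.1 j, e.2.2 j)
          else if (fun r => x r j) = fun r => pos (p j) (y r) then 1 else 0 := by
  unfold gibbsMoment slotMoment replicaMoment
  have key : ∀ i, ∫⁻ a, ENNReal.ofReal (tiltDensity B ν lam J e a) *
      ∏ l, (ENNReal.ofReal (B.gibbs a.1 (y ⟨i, l⟩)) *
        ∏ j, if j ∈ J then ENNReal.ofReal (slotProb (e.2.1 j) (a.2 j) (x ⟨i, l⟩ j))
          else if x ⟨i, l⟩ j = pos (p j) (y ⟨i, l⟩) then 1 else 0) ∂(ν.prod (rhoLaw e))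
      = (∫⁻ r, ENNReal.ofReal (B.density ν lam r) * ∏ l, ENNReal.ofReal (B.gibbs r (y ⟨i, l⟩)) ∂ν)
        * ∏ j, if j ∈ J then
            ∫⁻ ρ, ENNReal.ofReal (slotDensity lam (e.2.1 j) (e.2.2 j) ρ) *
              ∏ l, ENNReal.ofReal (slotProb (e.2.1 j) ρ (x ⟨i, l⟩ j)) ∂(e.2.2 j : Measure (M0 X))
          else ∏ l, if x ⟨i, l⟩ j = pos (p j) (y ⟨i, l⟩) then 1 else 0 := by
    intro i
    set φ : Fin k → M0 X → ℝ≥0∞ := fun j ρ => if j ∈ J then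
        ENNReal.ofReal (slotDensity lam (e.2.1 j) (e.2.2 j) ρ) *
          ∏ l, ENNReal.ofReal (slotProb (e.2.1 j) ρ (x ⟨i, l⟩ j))
      else ∏ l, if x ⟨i, l⟩ j = pos (p j) (y ⟨i, l⟩) then 1 else 0 with hφ
    have hφm : ∀ j, Measurable (φ j) := by
      intro j
      by_cases hj : j ∈ J
      · simp only [hφ, if_pos hj]
        exact (measurable_slotDensity_right lam _ _).ennreal_ofReal.mul
          (Finset.measurable_prod _ fun l _ => (measurable_slotProb_right _ _).ennreal_ofReal)
      · simp only [hφ, if_neg hj]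
        exact measurable_const
    have hpt : ∀ a : R × (Fin k → M0 X), ENNReal.ofReal (tiltDensity B ν lam J e a) *
      ∏ l, (ENNReal.ofReal (B.gibbs a.1 (y ⟨i, l⟩)) *
        ∏ j, if j ∈ J then ENNReal.ofReal (slotProb (e.2.1 j) (a.2 j) (x ⟨i, l⟩ j))
          else if x ⟨i, l⟩ j = pos (p j) (y ⟨i, l⟩) then 1 else 0)
        = (ENNReal.ofReal (B.density ν lam a.1) * ∏ l, ENNReal.ofReal (B.gibbs a.1 (y ⟨i, l⟩)))
          * ∏ j, φ j (a.2 j) := by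
      intro a
      rw [Finset.prod_mul_distrib, Finset.prod_comm]
      unfold tiltDensity
      rw [ENNReal.ofReal_mul (B.density_nonneg ν lam a.1), mul_mul_mul_comm,
        ENNReal.ofReal_prod_of_nonneg, ← Finset.prod_mul_distrib]
      · congr 1
        refine Finset.prod_congr rfl fun j _ => ?_
        by_cases hj : j ∈ J
        · simp only [hφ, if_pos hj]
        · simp only [hφ, if_neg hj, ENNReal.ofReal_one, one_mul]
      · intro j _
        split_ifs
        · exact slotDensity_nonneg _ _ _ _
        · exact zero_le_one
    simp_rw [hpt]
    rw [lintegral_prod_mul (f := fun r => ENNReal.ofReal (B.density ν lam r) *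
        ∏ l, ENNReal.ofReal (B.gibbs r (y ⟨i, l⟩))) (g := fun q : Fin k → M0 X => ∏ j, φ j (q j))]
    · congr 1
      unfold rhoLaw
      rw [lintegral_pi_prod _ _ hφm]
      refine Finset.prod_congr rfl fun j _ => ?_
      by_cases hj : j ∈ J
      · simp only [hφ, if_pos hj]
      · simp only [hφ, if_neg hj, lintegral_const, measure_univ, mul_one]
    · exact ((B.measurable_density ν lam).ennreal_ofReal.mul (Finset.measurable_prod _ fun l _ =>
        (B.measurable_gibbs _).ennreal_ofReal)).aemeasurable
    · exact (Finset.measurable_prod _ fun j _ =>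
        (hφm j).comp (measurable_pi_apply j)).aemeasurable
  simp_rw [key]
  rw [Finset.prod_mul_distrib]
  congr 1
  rw [Finset.prod_comm]
  refine Finset.prod_congr rfl fun j _ => ?_
  by_cases hj : j ∈ J
  · simp only [if_pos hj]
  · simp only [if_neg hj]
    rw [← Fintype.prod_sigma (fun r : Replica I => if x r j = pos (p j) (y r) then (1 : ℝ≥0∞) else 0),
      Finset.prod_ite_zero]
    simp [funext_iff]

variable [Nonempty Y]

/-- In this form the clause label enters only through the product of τ over replicas and each
environment slot only through its own `slotMoment`, with nonnegative coefficients throughout. That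
is what allows averaging term by term. -/
theorem ofReal_gap (B : BaseWeight R Y) (ν : Measure R) [IsProbabilityMeasure ν]
    {ε lam : ℝ} (hε : 0 < ε) (hl : 0 < lam) (hl1 : lam < 1) (pos : ι → Y → X)
    (J : Finset (Fin k)) (p : Fin k → ι) {e : ClauseEnv X S k} (he : GoodEnv ε e) :
    ENNReal.ofReal (gap ε B ν lam pos J p e)
      = ∑' I : LogIndex, logCoeff lam I *
        ∑ y : Replica I → Y, gibbsMoment B ν lam I y * ∑ z : Fin k → Replica I → X,
          (∏ j, if j ∈ J then slotMoment lam I (z j) (e.2.1 j, e.2.2 j)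
            else if z j = fun r => pos (p j) (y r) then 1 else 0) *
          ∏ r, ENNReal.ofReal (1 - ε * (1 - theta e.1 fun j => z j r)) := by
  classical
  have hD1 := integral_tiltDensity B ν hε hl.le J he
  have hDi : Integrable (tiltDensity B ν lam J e) (ν.prod (rhoLaw e)) := by
    by_contra h
    rw [integral_undef h] at hD1
    exact zero_ne_one hD1
  have hδ : 0 < ε ^ 2 := by positivity
  rw [gap_eq B ν hε hl pos J p he, neg_log_series hl hl1 _ hδ
    (measurable_tiltDensity B ν lam J e) (measurable_annealedTheta ε B pos J p e)
    (tiltDensity_nonneg B ν lam J e) hDi hD1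
    (fun a => (annealedTheta_bounds hε B pos J p he a).1)
    (fun a => (annealedTheta_bounds hε B pos J p he a).2)]
  refine tsum_congr fun I => ?_
  congr 1
  have hΘ : ∀ a : R × (Fin k → M0 X), ENNReal.ofReal (annealedTheta ε B pos J p e a)
      = ∑ yx : Y × (Fin k → X), (ENNReal.ofReal (B.gibbs a.1 yx.1) *
        ∏ j, if j ∈ J then ENNReal.ofReal (slotProb (e.2.1 j) (a.2 j) (yx.2 j))
          else if yx.2 j = pos (p j) yx.1 then 1 else 0)
        * ENNReal.ofReal (1 - ε * (1 - theta e.1 yx.2)) := by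
    intro a
    have hw : ∀ (y : Y) (x : Fin k → X),
        ENNReal.ofReal (mixedWeight J e a.2 (fun j => pos (p j) y) x)
        = ∏ j, if j ∈ J then ENNReal.ofReal (slotProb (e.2.1 j) (a.2 j) (x j))
          else if x j = pos (p j) y then 1 else 0 := by
      intro y x
      unfold mixedWeight
      rw [ENNReal.ofReal_prod_of_nonneg]
      · refine Finset.prod_congr rfl fun j _ => ?_
        split_ifs <;> simp
      · intro j _
        split_ifs
        · exact slotProb_nonneg _ _ _
        · exact zero_le_one
        · exact le_rfl
    unfold annealedTheta
    rw [ENNReal.ofReal_sum_of_nonneg fun y _ => mul_nonneg (B.gibbs_nonneg _ _)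
      (mixedTheta_bounds hε J he _ _).1, Fintype.sum_prod_type]
    refine Finset.sum_congr rfl fun y _ => ?_
    rw [ENNReal.ofReal_mul (B.gibbs_nonneg _ _)]
    unfold mixedTheta
    rw [ENNReal.ofReal_sum_of_nonneg fun x _ => mul_nonneg (mixedWeight_nonneg _ _ _ _ _)
      (he.tau_bounds hε x).1, Finset.mul_sum]
    refine Finset.sum_congr rfl fun x _ => ?_
    rw [ENNReal.ofReal_mul (mixedWeight_nonneg _ _ _ _ _), hw, mul_assoc]
  simp_rw [hΘ]
  rw [prod_lintegral_pow (ν.prod (rhoLaw e))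
    (D := fun a => ENNReal.ofReal (tiltDensity B ν lam J e a))
    (κ := fun a (yx : Y × (Fin k → X)) => ENNReal.ofReal (B.gibbs a.1 yx.1) *
        ∏ j, if j ∈ J then ENNReal.ofReal (slotProb (e.2.1 j) (a.2 j) (yx.2 j))
          else if yx.2 j = pos (p j) yx.1 then 1 else 0)
    (measurable_tiltDensity B ν lam J e).ennreal_ofReal ?_
    (fun yx => ENNReal.ofReal (1 - ε * (1 - theta e.1 yx.2)))]
  -- A replica carries a pair of a system configuration and a `k`-tuple. The pairs are split and the
  -- tuples transposed, so that the sum is indexed by slot before replica.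
  · rw [← (Equiv.arrowProdEquivProdArrow (Replica I) (fun _ => Y)
        (fun _ => Fin k → X)).symm.sum_comp,
      Fintype.sum_prod_type]
    refine Finset.sum_congr rfl fun y _ => ?_
    rw [← (Equiv.piComm fun (_ : Fin k) (_ : Replica I) => X).sum_comp, Finset.mul_sum]
    refine Finset.sum_congr rfl fun z _ => ?_
    rw [← mul_assoc]
    congr 1
    exact replicaMoment_mixed B ν lam pos J p e I y fun r j => z j r
  · intro yx
    refine ((B.measurable_gibbs _).comp measurable_fst).ennreal_ofReal.mul
      (Finset.measurable_prod _ fun j _ => ?_)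
    split_ifs
    · exact ((measurable_slotProb_right _ _).comp
        ((measurable_pi_apply j).comp measurable_snd)).ennreal_ofReal
    · exact measurable_const
    · exact measurable_const

omit [DecidableEq X] [Fintype X] [DiscreteMeasurableSpace X] in
instance (M : FactorModel X S) : IsProbabilityMeasure (M.clauseLaw k) := by
  unfold FactorModel.clauseLaw
  infer_instance

instance (M : FactorModel X S) (ζ : M2 X) : IsProbabilityMeasure (envLaw M ζ k) := by
  unfold envLaw
  infer_instance

omit [DecidableEq X] [DiscreteMeasurableSpace X] in
theorem ae_goodEnv {M : FactorModel X S} {ε : ℝ} (hM : M.BoundedPotentials k ε) (ζ : M2 X) :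
    ∀ᵐ e ∂(envLaw M ζ k), GoodEnv ε e := by
  have h1 : ∀ᵐ e ∂(envLaw M ζ k), ∀ x : Fin k → X,
      ε ≤ 1 - theta e.1 x ∧ 1 - theta e.1 x ≤ 1 / ε :=
    Measure.quasiMeasurePreserving_fst.ae hM.2
  have h2 : ∀ᵐ e ∂(envLaw M ζ k), ∀ (j : Fin k) (x : X),
      ε ≤ (e.2.1 j x : ℝ) ∧ (e.2.1 j x : ℝ) ≤ 1 / ε := by
    rw [ae_all_iff]
    intro j
    have hq : Measure.QuasiMeasurePreserving (fun e : ClauseEnv X S k => e.2.1 j)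
        (envLaw M ζ k) (M.hLaw : Measure (Potential X)) :=
      (measurePreserving_eval _ j).quasiMeasurePreserving.comp
        (Measure.quasiMeasurePreserving_fst.comp Measure.quasiMeasurePreserving_snd)
    exact hq.ae hM.1
  filter_upwards [h1, h2] with e h1 h2
  exact ⟨h1, h2⟩

/-- Tonelli moves the expectation inside the series. The clause label is independent of the `k`
pairs (h_j, η_j), and these are independent of each other, so the mean of each summand is the
product that `mixedMoment` records. -/
theorem lintegral_gap (B : BaseWeight R Y) (ν : Measure R) [IsProbabilityMeasure ν]
    {M : FactorModel X S} {ε lam : ℝ} (hM : M.BoundedPotentials k ε) (ζ : M2 X)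
    (hε : 0 < ε) (hl : 0 < lam) (hl1 : lam < 1) (pos : ι → Y → X)
    (J : Finset (Fin k)) (p : Fin k → ι) :
    ∫⁻ e, ENNReal.ofReal (gap ε B ν lam pos J p e) ∂(envLaw M ζ k)
      = ∑' I : LogIndex, logCoeff lam I * mixedMoment (gibbsMoment B ν lam I)
          (fun ξ => ∫⁻ s, slotMoment lam I ξ s
            ∂((M.hLaw : Measure (Potential X)).prod (ζ : Measure (M1 X)))) pos
          (fun z => ∫⁻ c, ∏ r, ENNReal.ofReal (1 - ε * (1 - theta c fun j => z j r))
            ∂(M.clauseLaw k)) J p := by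
  have hms : ∀ (I : LogIndex) (y : Replica I → Y) (z : Fin k → Replica I → X) (j : Fin k),
      Measurable fun s : Potential X × M1 X => if j ∈ J then slotMoment lam I (z j) s
        else if z j = fun r => pos (p j) (y r) then (1 : ℝ≥0∞) else 0 := by
    intro I y z j
    split_ifs
    · exact measurable_slotMoment lam I (z j)
    · exact measurable_const
    · exact measurable_const
  have hmp : ∀ (I : LogIndex) (y : Replica I → Y) (z : Fin k → Replica I → X),
      Measurable fun s : (Fin k → Potential X) × (Fin k → M1 X) =>
        ∏ j, if j ∈ J then slotMoment lam I (z j) (s.1 j, s.2 j)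
        else if z j = fun r => pos (p j) (y r) then (1 : ℝ≥0∞) else 0 := by
    intro I y z
    refine Finset.measurable_prod _ fun j _ => ?_
    have h2 : Measurable fun s : (Fin k → Potential X) × (Fin k → M1 X) => (s.1 j, s.2 j) := by
      fun_prop
    exact (hms I y z j).comp h2
  have hmt : ∀ (I : LogIndex) (z : Fin k → Replica I → X),
      Measurable fun c : ClauseLabel X S k =>
        ∏ r, ENNReal.ofReal (1 - ε * (1 - theta c fun j => z j r)) := by
    intro I z
    fun_prop
  have hmz : ∀ (I : LogIndex) (y : Replica I → Y) (z : Fin k → Replica I → X),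
      Measurable fun e : ClauseEnv X S k =>
        (∏ j, if j ∈ J then slotMoment lam I (z j) (e.2.1 j, e.2.2 j)
            else if z j = fun r => pos (p j) (y r) then 1 else 0) *
          ∏ r, ENNReal.ofReal (1 - ε * (1 - theta e.1 fun j => z j r)) := fun I y z =>
    ((hmp I y z).comp measurable_snd).mul ((hmt I z).comp measurable_fst)
  have hae : ∀ᵐ e ∂(envLaw M ζ k), _ := (ae_goodEnv hM ζ).mono fun e he =>
    ofReal_gap B ν hε hl hl1 pos J p he
  rw [lintegral_congr_ae hae, lintegral_tsum]
  · refine tsum_congr fun I => ?_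
    have h1 : ∀ y : Replica I → Y, Measurable fun e : ClauseEnv X S k =>
        ∑ z : Fin k → Replica I → X,
        (∏ j, if j ∈ J then slotMoment lam I (z j) (e.2.1 j, e.2.2 j)
            else if z j = fun r => pos (p j) (y r) then 1 else 0) *
          ∏ r, ENNReal.ofReal (1 - ε * (1 - theta e.1 fun j => z j r)) :=
      fun y => Finset.measurable_sum _ fun z _ => hmz I y z
    rw [lintegral_const_mul _ (Finset.measurable_sum _ fun y _ => (h1 y).const_mul _),
      lintegral_finsetSum _ fun y _ => (h1 y).const_mul _]
    congr 1
    unfold mixedMoment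
    refine Finset.sum_congr rfl fun y _ => ?_
    rw [lintegral_const_mul _ (h1 y), lintegral_finsetSum _ fun z _ => hmz I y z]
    congr 1
    refine Finset.sum_congr rfl fun z _ => ?_
    unfold envLaw
    have hcomm : ∀ e : ClauseEnv X S k,
        (∏ j, if j ∈ J then slotMoment lam I (z j) (e.2.1 j, e.2.2 j)
            else if z j = fun r => pos (p j) (y r) then 1 else 0) *
          ∏ r, ENNReal.ofReal (1 - ε * (1 - theta e.1 fun j => z j r))
        = (∏ r, ENNReal.ofReal (1 - ε * (1 - theta e.1 fun j => z j r))) *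
          (∏ j, if j ∈ J then slotMoment lam I (z j) (e.2.1 j, e.2.2 j)
            else if z j = fun r => pos (p j) (y r) then 1 else 0) := fun e => mul_comm _ _
    simp_rw [hcomm]
    rw [lintegral_prod_mul (f := fun c : ClauseLabel X S k =>
        ∏ r, ENNReal.ofReal (1 - ε * (1 - theta c fun j => z j r)))
      (g := fun s : (Fin k → Potential X) × (Fin k → M1 X) =>
        ∏ j, if j ∈ J then slotMoment lam I (z j) (s.1 j, s.2 j)
        else if z j = fun r => pos (p j) (y r) then (1 : ℝ≥0∞) else 0)
      (hmt I z).aemeasurable (hmp I y z).aemeasurable,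
      lintegral_pi_prod_pi _ _ (fun j s => if j ∈ J then slotMoment lam I (z j) s
        else if z j = fun r => pos (p j) (y r) then (1 : ℝ≥0∞) else 0) (hms I y z), mul_comm]
    congr 1
    refine Finset.prod_congr rfl fun j _ => ?_
    split_ifs
    · rfl
    · simp
    · simp
  · intro I
    exact (Measurable.const_mul (Finset.measurable_sum _ fun y _ =>
      (Finset.measurable_sum _ fun z _ => hmz I y z).const_mul _) _).aemeasurable

/-- The series coefficients are nonnegative and do not depend on `J`, so `mixedMoment_interpolation`
may be summed over all monomials. -/
theorem lintegral_gap_interpolation [Fintype ι] [Nonempty ι] [NeZero k]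
    (B : BaseWeight R Y) (ν : Measure R) [IsProbabilityMeasure ν]
    {M : FactorModel X S} {ε lam : ℝ} (hM : M.BoundedPotentials k ε) (hM2 : M.NonnegMoments)
    (ζ : M2 X) (hε : 0 < ε) (hε1 : ε ≤ 1) (hl : 0 < lam) (hl1 : lam < 1) (pos : ι → Y → X) :
    (k : ℝ≥0∞) * ENNReal_avg_pi (fun p : Fin k → ι =>
        ∫⁻ e, ENNReal.ofReal (gap ε B ν lam pos (Finset.univ.erase 0) p e) ∂(envLaw M ζ k))
      ≤ ENNReal_avg_pi (fun p : Fin k → ι =>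
          ∫⁻ e, ENNReal.ofReal (gap ε B ν lam pos ∅ p e) ∂(envLaw M ζ k))
        + ((k - 1 : ℕ) : ℝ≥0∞) * ENNReal_avg_pi (fun p : Fin k → ι =>
          ∫⁻ e, ENNReal.ofReal (gap ε B ν lam pos Finset.univ p e) ∂(envLaw M ζ k)) := by
  classical
  have hτ : ∀ᵐ c ∂(M.clauseLaw k), ∀ x : Fin k → X, 0 ≤ 1 - ε * (1 - theta c x) := by
    filter_upwards [hM.2] with c hc x
    have := mul_le_mul_of_nonneg_left (hc x).2 hε.le
    rw [mul_one_div_cancel hε.ne'] at this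
    linarith
  simp_rw [lintegral_gap B ν hM ζ hε hl hl1 pos]
  have hsum : ∀ J : Finset (Fin k), ENNReal_avg_pi (fun p : Fin k → ι =>
      ∑' I : LogIndex, logCoeff lam I * mixedMoment (gibbsMoment B ν lam I)
          (fun ξ => ∫⁻ s, slotMoment lam I ξ s
            ∂((M.hLaw : Measure (Potential X)).prod (ζ : Measure (M1 X)))) pos
          (fun z => ∫⁻ c, ∏ r, ENNReal.ofReal (1 - ε * (1 - theta c fun j => z j r))
            ∂(M.clauseLaw k)) J p)
      = ∑' I : LogIndex, logCoeff lam I * ENNReal_avg_pi (mixedMoment (gibbsMoment B ν lam I)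
          (fun ξ => ∫⁻ s, slotMoment lam I ξ s
            ∂((M.hLaw : Measure (Potential X)).prod (ζ : Measure (M1 X)))) pos
          (fun z => ∫⁻ c, ∏ r, ENNReal.ofReal (1 - ε * (1 - theta c fun j => z j r))
            ∂(M.clauseLaw k)) J) := by
    intro J
    unfold ENNReal_avg_pi
    rw [← Summable.tsum_finsetSum fun _ _ => ENNReal.summable, ← ENNReal.tsum_mul_left]
    refine tsum_congr fun I => ?_
    rw [← Finset.mul_sum, mul_left_comm]
  simp_rw [hsum]
  rw [← ENNReal.tsum_mul_left, ← ENNReal.tsum_mul_left, ← ENNReal.tsum_add]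
  refine ENNReal.tsum_le_tsum fun I => ?_
  obtain ⟨β, F, hW⟩ := lintegral_prod_theta hM2 hε.le hε1 hτ (Replica I)
  rw [mul_left_comm, mul_left_comm _ (logCoeff lam I), ← mul_add]
  gcongr
  exact mixedMoment_interpolation _ _ pos hW

end Fixed

/-- Pointwise comparison of f with g up to κ survives the λ-th power as κ^λ. The resulting factor λ
in the bound is what makes the final constant independent of λ after division by λ. -/
theorem abs_log_integral_rpow_sub_le {Q : Type*} [MeasurableSpace Q] {π : Measure Q}
    {f g : Q → ℝ} {κ lam : ℝ} (hκ : 0 < κ) (hl : 0 ≤ lam) (hf : Measurable f)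
    (hg0 : ∀ q, 0 ≤ g q) (hgi : Integrable (fun q => g q ^ lam) π)
    (hgp : 0 < ∫ q, g q ^ lam ∂π)
    (h1 : ∀ q, κ * g q ≤ f q) (h2 : ∀ q, f q ≤ κ⁻¹ * g q) :
    Integrable (fun q => f q ^ lam) π ∧ 0 < ∫ q, f q ^ lam ∂π ∧
    |Real.log (∫ q, f q ^ lam ∂π) - Real.log (∫ q, g q ^ lam ∂π)| ≤ lam * Real.log κ⁻¹ := by
  have hf0 : ∀ q, 0 ≤ f q := fun q => (mul_nonneg hκ.le (hg0 q)).trans (h1 q)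
  have hu : ∀ q, f q ^ lam ≤ κ⁻¹ ^ lam * g q ^ lam := fun q => by
    rw [← Real.mul_rpow (inv_nonneg.2 hκ.le) (hg0 q)]
    exact Real.rpow_le_rpow (hf0 q) (h2 q) hl
  have hlo : ∀ q, κ ^ lam * g q ^ lam ≤ f q ^ lam := fun q => by
    rw [← Real.mul_rpow hκ.le (hg0 q)]
    exact Real.rpow_le_rpow (mul_nonneg hκ.le (hg0 q)) (h1 q) hl
  have hfi : Integrable (fun q => f q ^ lam) π := by
    refine (hgi.const_mul (κ⁻¹ ^ lam)).mono (hf.pow_const _).aestronglyMeasurable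
      (Filter.Eventually.of_forall fun q => ?_)
    rw [Real.norm_of_nonneg (Real.rpow_nonneg (hf0 q) _)]
    exact (hu q).trans (le_abs_self _)
  have i1 : κ ^ lam * ∫ q, g q ^ lam ∂π ≤ ∫ q, f q ^ lam ∂π := by
    rw [← integral_const_mul]
    exact integral_mono (hgi.const_mul _) hfi hlo
  have i2 : ∫ q, f q ^ lam ∂π ≤ κ⁻¹ ^ lam * ∫ q, g q ^ lam ∂π := by
    rw [← integral_const_mul]
    exact integral_mono hfi (hgi.const_mul _) hu
  have hκl : 0 < κ ^ lam := Real.rpow_pos_of_pos hκ _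
  have hκl' : 0 < κ⁻¹ ^ lam := Real.rpow_pos_of_pos (inv_pos.2 hκ) _
  have hfp : 0 < ∫ q, f q ^ lam ∂π := (mul_pos hκl hgp).trans_le i1
  refine ⟨hfi, hfp, ?_⟩
  have l1 := Real.log_le_log (mul_pos hκl hgp) i1
  have l2 := Real.log_le_log hfp i2
  rw [Real.log_mul hκl.ne' hgp.ne', Real.log_rpow hκ] at l1
  rw [Real.log_mul hκl'.ne' hgp.ne', Real.log_rpow (inv_pos.2 hκ)] at l2
  rw [Real.log_inv] at l2 ⊢
  rw [abs_le]
  constructor <;> linarith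

/-! ### Real-valued averages over attachment points -/

/-- The average of `f` over all maps `p : Fin k → ι`. -/
def avgPi {ι : Type*} [Fintype ι] {k : ℕ} (f : (Fin k → ι) → ℝ) : ℝ :=
  ((Fintype.card ι : ℝ)⁻¹) ^ k * ∑ p, f p

section AvgPi

variable {ι : Type*} [Fintype ι] [Nonempty ι] {k : ℕ}

omit [Nonempty ι] in
theorem avgPi_sub (f g : (Fin k → ι) → ℝ) :
    avgPi (fun p => f p - g p) = avgPi f - avgPi g := by
  unfold avgPi
  rw [Finset.sum_sub_distrib, mul_sub]

theorem avgPi_const (c : ℝ) : avgPi (fun _ : Fin k → ι => c) = c := by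
  have : (Fintype.card ι : ℝ) ≠ 0 := by simp
  unfold avgPi
  simp only [Finset.sum_const, Finset.card_univ, Fintype.card_pi, Finset.prod_const,
    Fintype.card_fin, nsmul_eq_mul, Nat.cast_pow]
  rw [← mul_assoc, ← mul_pow, inv_mul_cancel₀ this, one_pow, one_mul]

theorem avgPi_eval [NeZero k] (f : ι → ℝ) :
    avgPi (fun p : Fin k → ι => f (p 0)) = (Fintype.card ι : ℝ)⁻¹ * ∑ i, f i := by
  classical
  have h0 : (Fintype.card ι : ℝ) ≠ 0 := by simp
  unfold avgPi
  obtain ⟨l, rfl⟩ : ∃ l, k = l + 1 := ⟨k - 1, (Nat.succ_pred_eq_of_pos (NeZero.pos k)).symm⟩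
  rw [← (Fin.consEquiv fun _ : Fin (l + 1) => ι).sum_comp, Fintype.sum_prod_type]
  simp only [Fin.consEquiv, Equiv.coe_fn_mk, Fin.cons_zero, Finset.sum_const, Finset.card_univ,
    Fintype.card_pi, Finset.prod_const, Fintype.card_fin, nsmul_eq_mul, Nat.cast_pow,
    ← Finset.mul_sum]
  have hc : ((Fintype.card ι : ℝ)⁻¹) ^ l * (Fintype.card ι : ℝ) ^ l = 1 := by
    rw [← mul_pow, inv_mul_cancel₀ h0, one_pow]
  rw [pow_succ]
  linear_combination ((Fintype.card ι : ℝ)⁻¹ * ∑ i, f i) * hc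

omit [Nonempty ι] in
theorem toReal_avg_pi {f : (Fin k → ι) → ℝ≥0∞} (hf : ∀ p, f p ≠ ⊤) :
    (ENNReal_avg_pi f).toReal = avgPi fun p => (f p).toReal := by
  unfold ENNReal_avg_pi avgPi
  rw [ENNReal.toReal_mul, ENNReal.toReal_pow, ENNReal.toReal_inv, ENNReal.toReal_natCast,
    ENNReal.toReal_sum fun p _ => hf p]

theorem avg_pi_ne_top {f : (Fin k → ι) → ℝ≥0∞} (hf : ∀ p, f p ≠ ⊤) :
    ENNReal_avg_pi f ≠ ⊤ := by
  refine ENNReal.mul_ne_top (ENNReal.pow_ne_top (ENNReal.inv_ne_top.2 ?_))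
    (ENNReal.sum_ne_top.2 fun p _ => hf p)
  simp

end AvgPi

/-! ### The interpolation step over a frozen system, in terms of logarithms -/

section Fixed

variable {X S R Y ι : Type*} [MeasurableSpace X] [Fintype X] [DecidableEq X]
  [DiscreteMeasurableSpace X] [Fintype S] {k : ℕ} [MeasurableSpace R] [Fintype Y] [Nonempty Y]

omit [Nonempty Y] [Fintype Y] [MeasurableSpace R] in
theorem measurable_mixedU_right (J : Finset (Fin k)) (e : ClauseEnv X S k) (a : Fin k → X) :
    Measurable fun q => mixedU J e q a := by
  have h : Measurable fun q : Fin k → M0 X => (e, q) := measurable_prodMk_left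
  have h2 := (measurable_mixedU J a).comp h
  exact h2

theorem abs_mixedLog_sub_le (B : BaseWeight R Y) (ν : Measure R) [IsProbabilityMeasure ν]
    {ε lam : ℝ} (hε : 0 < ε) (hε1 : ε ≤ 1) (hl : 0 ≤ lam) (pos : ι → Y → X)
    (J : Finset (Fin k)) (p : Fin k → ι) {e : ClauseEnv X S k} (he : GoodEnv ε e) :
    |mixedLog B ν lam pos J p e - Real.log (∫ r, B.total r ^ lam ∂ν)|
      ≤ lam * Real.log ((ε ^ (k + 1))⁻¹) := by
  have hfst : ∫ a, B.total a.1 ^ lam ∂(ν.prod (rhoLaw e)) = ∫ r, B.total r ^ lam ∂ν := by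
    rw [integral_fun_fst (fun r => B.total r ^ lam)]
    simp
  have hgi : Integrable (fun a : R × (Fin k → M0 X) => B.total a.1 ^ lam)
      (ν.prod (rhoLaw e)) := (B.integrable_total_rpow ν lam).comp_fst (rhoLaw e)
  rw [← hfst]
  refine (abs_log_integral_rpow_sub_le (f := fun a : R × (Fin k → M0 X) =>
      ∑ y, B.w a.1 y * mixedU J e a.2 fun j => pos (p j) y)
    (g := fun a => B.total a.1) (κ := ε ^ (k + 1)) (by positivity) hl ?_
    (fun a => (B.total_pos a.1).le) hgi ?_ ?_ ?_).2.2
  · refine Finset.measurable_sum _ fun y _ => ?_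
    have m1 : Measurable fun a : R × (Fin k → M0 X) => B.w a.1 y := (B.meas y).comp measurable_fst
    have m2 : Measurable fun a : R × (Fin k → M0 X) => mixedU J e a.2 fun j => pos (p j) y :=
      (measurable_mixedU_right J e fun j => pos (p j) y).comp measurable_snd
    exact m1.mul m2
  · rw [hfst]
    exact B.integral_total_rpow_pos ν lam
  · intro a
    unfold BaseWeight.total
    rw [Finset.mul_sum]
    refine Finset.sum_le_sum fun y _ => ?_
    rw [mul_comm]
    exact mul_le_mul_of_nonneg_left (mixedU_bounds hε hε1 J he _ _).1
      (B.lo_pos.le.trans (B.lo_le _ _))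
  · intro a
    unfold BaseWeight.total
    rw [Finset.mul_sum]
    refine Finset.sum_le_sum fun y _ => ?_
    rw [mul_comm _ (B.w a.1 y)]
    refine mul_le_mul_of_nonneg_left ?_ (B.lo_pos.le.trans (B.lo_le _ _))
    have := (mixedU_bounds hε hε1 J he a.2 fun j => pos (p j) y).2
    rwa [one_div, inv_pow] at this

theorem integrable_mixedLog (B : BaseWeight R Y) (ν : Measure R) [IsProbabilityMeasure ν]
    {M : FactorModel X S} {ε lam : ℝ} (hM : M.BoundedPotentials k ε) (ζ : M2 X)
    (hε : 0 < ε) (hε1 : ε ≤ 1) (hl : 0 ≤ lam) (pos : ι → Y → X)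
    (J : Finset (Fin k)) (p : Fin k → ι) :
    Integrable (fun e => mixedLog B ν lam pos J p e) (envLaw M ζ k) := by
  refine Integrable.of_bound (measurable_mixedLog B ν lam pos J p).aestronglyMeasurable
    (lam * Real.log ((ε ^ (k + 1))⁻¹) + |Real.log (∫ r, B.total r ^ lam ∂ν)|) ?_
  filter_upwards [ae_goodEnv hM ζ] with e he
  have h := abs_mixedLog_sub_le B ν hε hε1 hl pos J p he
  have := abs_sub_abs_le_abs_sub (mixedLog B ν lam pos J p e)
    (Real.log (∫ r, B.total r ^ lam ∂ν))
  rw [Real.norm_eq_abs]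
  linarith

omit [DecidableEq X] in
theorem integrable_slotLog {M : FactorModel X S} {ε lam : ℝ} (hM : M.BoundedPotentials k ε)
    (ζ : M2 X) (hε : 0 < ε) (hl : 0 ≤ lam) (j : Fin k) :
    Integrable (fun e : ClauseEnv X S k => slotLog lam (e.2.1 j) (e.2.2 j)) (envLaw M ζ k) := by
  have h2 : Measurable fun e : ClauseEnv X S k => (e.2.1 j, e.2.2 j) := by fun_prop
  refine Integrable.of_bound ((measurable_slotLog lam).comp h2).aestronglyMeasurable
    (lam * Real.log (1 / ε)) ?_
  filter_upwards [ae_goodEnv hM ζ] with e he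
  exact slotLog_bounds hε hl (he.slot j) _

omit [DecidableEq X] in
theorem integral_slotLog (M : FactorModel X S) (lam : ℝ) (ζ : M2 X) (j : Fin k) :
    ∫ e : ClauseEnv X S k, slotLog lam (e.2.1 j) (e.2.2 j) ∂(envLaw M ζ k)
      = ∫ s, slotLog lam s.1 s.2 ∂((M.hLaw : Measure (Potential X)).prod (ζ : Measure (M1 X))) := by
  have h1 : MeasurePreserving (fun e : ClauseEnv X S k => e.2) (envLaw M ζ k)
      ((Measure.pi fun _ : Fin k => (M.hLaw : Measure (Potential X))).prod
      (Measure.pi fun _ : Fin k => (ζ : Measure (M1 X)))) := measurePreserving_snd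
  have h2 := (measurePreserving_eval (fun _ : Fin k => (M.hLaw : Measure (Potential X))) j).prod
    (measurePreserving_eval (fun _ : Fin k => (ζ : Measure (M1 X))) j)
  have h3 := h2.comp h1
  rw [← h3.map_eq, integral_map h3.measurable.aemeasurable
    (measurable_slotLog lam).aestronglyMeasurable]
  rfl

theorem gap_nonneg (B : BaseWeight R Y) (ν : Measure R) [IsProbabilityMeasure ν]
    {ε lam : ℝ} (hε : 0 < ε) (hl : 0 < lam) (pos : ι → Y → X)
    (J : Finset (Fin k)) (p : Fin k → ι) {e : ClauseEnv X S k} (he : GoodEnv ε e) :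
    0 ≤ gap ε B ν lam pos J p e := by
  have hD1 := integral_tiltDensity B ν hε hl.le J he
  have hDi : Integrable (tiltDensity B ν lam J e) (ν.prod (rhoLaw e)) := by
    by_contra h
    rw [integral_undef h] at hD1
    exact zero_ne_one hD1
  have hb : ∀ a, 0 ≤ (1 - annealedTheta ε B pos J p e a) ^ lam ∧
      (1 - annealedTheta ε B pos J p e a) ^ lam ≤ 1 := fun a => by
    have h := annealedTheta_bounds hε B pos J p he a
    exact ⟨Real.rpow_nonneg (by nlinarith [sq_nonneg ε]) _,
      Real.rpow_le_one (by nlinarith [sq_nonneg ε]) (by linarith) hl.le⟩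
  rw [gap_eq B ν hε hl pos J p he, neg_nonneg]
  refine Real.log_nonpos (integral_nonneg fun a =>
    mul_nonneg (tiltDensity_nonneg B ν lam J e a) (hb a).1) ?_
  refine le_of_le_of_eq ?_ hD1
  exact integral_mono_of_nonneg (Filter.Eventually.of_forall fun a =>
    mul_nonneg (tiltDensity_nonneg B ν lam J e a) (hb a).1) hDi
    (Filter.Eventually.of_forall fun a =>
      mul_le_of_le_one_right (tiltDensity_nonneg B ν lam J e a) (hb a).2)

theorem integral_gap (B : BaseWeight R Y) (ν : Measure R) [IsProbabilityMeasure ν]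
    {M : FactorModel X S} {ε lam : ℝ} (hM : M.BoundedPotentials k ε) (ζ : M2 X)
    (hε : 0 < ε) (hε1 : ε ≤ 1) (hl : 0 ≤ lam) (pos : ι → Y → X)
    (J : Finset (Fin k)) (p : Fin k → ι) :
    Integrable (fun e => gap ε B ν lam pos J p e) (envLaw M ζ k) ∧
    ∫ e, gap ε B ν lam pos J p e ∂(envLaw M ζ k)
      = (lam * Real.log (1 / ε) + Real.log (∫ r, B.total r ^ lam ∂ν) + J.card *
          ∫ s, slotLog lam s.1 s.2 ∂((M.hLaw : Measure (Potential X)).prod (ζ : Measure (M1 X))))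
        - ∫ e, mixedLog B ν lam pos J p e ∂(envLaw M ζ k) := by
  have hi1 := integrable_mixedLog B ν hM ζ hε hε1 hl pos J p
  have hi2 : Integrable (fun e : ClauseEnv X S k => ∑ j ∈ J, slotLog lam (e.2.1 j) (e.2.2 j))
      (envLaw M ζ k) := integrable_finsetSum _ fun j _ => integrable_slotLog hM ζ hε hl j
  have hi3 : Integrable (fun e : ClauseEnv X S k =>
      lam * Real.log (1 / ε) + Real.log (∫ r, B.total r ^ lam ∂ν)
        + ∑ j ∈ J, slotLog lam (e.2.1 j) (e.2.2 j)) (envLaw M ζ k) :=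
    (integrable_const _).add hi2
  refine ⟨hi3.sub hi1, ?_⟩
  unfold gap
  rw [integral_sub hi3 hi1, integral_add (integrable_const _) hi2, integral_finsetSum _ fun j _ =>
    integrable_slotLog hM ζ hε hl j]
  simp_rw [integral_slotLog M lam ζ]
  simp

variable [Fintype ι] [Nonempty ι] [NeZero k]

/-- The gap is a normalisation minus `mixedLog`, which reverses the inequality. The normalisations
cancel: the part free of `J` occurs 1 + (k-1) times against k, and the slot logarithms k(k-1) times
on both sides. -/
theorem mixedLog_interpolation (B : BaseWeight R Y) (ν : Measure R) [IsProbabilityMeasure ν]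
    {M : FactorModel X S} {ε lam : ℝ} (hM : M.BoundedPotentials k ε) (hM2 : M.NonnegMoments)
    (ζ : M2 X) (hε : 0 < ε) (hε1 : ε ≤ 1) (hl : 0 < lam) (hl1 : lam < 1) (pos : ι → Y → X) :
    avgPi (fun p : Fin k → ι => ∫ e, mixedLog B ν lam pos ∅ p e ∂(envLaw M ζ k))
      + ((k : ℝ) - 1) * avgPi (fun p : Fin k → ι =>
        ∫ e, mixedLog B ν lam pos Finset.univ p e ∂(envLaw M ζ k))
      ≤ k * avgPi (fun p : Fin k → ι =>
        ∫ e, mixedLog B ν lam pos (Finset.univ.erase 0) p e ∂(envLaw M ζ k)) := by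
  have h := lintegral_gap_interpolation B ν hM hM2 ζ hε hε1 hl hl1 pos
  have hint : ∀ (J : Finset (Fin k)) (p : Fin k → ι),
      ∫⁻ e, ENNReal.ofReal (gap ε B ν lam pos J p e) ∂(envLaw M ζ k)
        = ENNReal.ofReal (∫ e, gap ε B ν lam pos J p e ∂(envLaw M ζ k)) := fun J p =>
    (ofReal_integral_eq_lintegral_ofReal (integral_gap B ν hM ζ hε hε1 hl.le pos J p).1
      ((ae_goodEnv hM ζ).mono fun e he => gap_nonneg B ν hε hl pos J p he)).symm
  have hnn : ∀ (J : Finset (Fin k)) (p : Fin k → ι),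
      0 ≤ ∫ e, gap ε B ν lam pos J p e ∂(envLaw M ζ k) := fun J p =>
    integral_nonneg_of_ae ((ae_goodEnv hM ζ).mono fun e he => gap_nonneg B ν hε hl pos J p he)
  simp_rw [hint] at h
  have hfin : ∀ J : Finset (Fin k), ENNReal_avg_pi (fun p : Fin k → ι =>
      ENNReal.ofReal (∫ e, gap ε B ν lam pos J p e ∂(envLaw M ζ k))) ≠ ⊤ := fun J =>
    avg_pi_ne_top fun p => ENNReal.ofReal_ne_top
  have h' := ENNReal.toReal_mono (ENNReal.add_ne_top.2 ⟨hfin _,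
    ENNReal.mul_ne_top (ENNReal.natCast_ne_top _) (hfin _)⟩) h
  rw [ENNReal.toReal_add (hfin _) (ENNReal.mul_ne_top (ENNReal.natCast_ne_top _) (hfin _)),
    ENNReal.toReal_mul, ENNReal.toReal_mul, ENNReal.toReal_natCast, ENNReal.toReal_natCast,
    toReal_avg_pi fun p => ENNReal.ofReal_ne_top, toReal_avg_pi fun p => ENNReal.ofReal_ne_top,
    toReal_avg_pi fun p => ENNReal.ofReal_ne_top] at h'
  simp_rw [ENNReal.toReal_ofReal (hnn _ _), (integral_gap B ν hM ζ hε hε1 hl.le pos _ _).2,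
    avgPi_sub, avgPi_const] at h'
  have hk : 1 ≤ k := NeZero.one_le
  rw [Nat.cast_sub hk, Finset.card_empty, Finset.card_univ, Fintype.card_fin,
    Finset.card_erase_of_mem (Finset.mem_univ _), Finset.card_univ, Fintype.card_fin,
    Nat.cast_sub hk] at h'
  push_cast at h'
  linarith

/-- One interpolation step over a fixed environment: a clause attached to `k` independent
uniform positions is compared with `k` cavity factors attached to one uniform position each. -/
theorem base_interpolation (B : BaseWeight R Y) (ν : Measure R) [IsProbabilityMeasure ν]
    {M : FactorModel X S} {ε lam : ℝ} (hM : M.BoundedPotentials k ε) (hM2 : M.NonnegMoments)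
    (ζ : M2 X) (hε : 0 < ε) (hε1 : ε ≤ 1) (hl : 0 < lam) (hl1 : lam < 1) (pos : ι → Y → X) :
    avgPi (fun p : Fin k → ι => ∫ c, Real.log (∫ r,
        (∑ y, B.w r y * (1 - theta c fun j => pos (p j) y)) ^ lam ∂ν) ∂(M.clauseLaw k))
      + ((k : ℝ) - 1) * (Real.log (∫ r, B.total r ^ lam ∂ν) + clauseTerm M ζ k lam)
      ≤ k * ((Fintype.card ι : ℝ)⁻¹ * ∑ i, ∫ e, Real.log (∫ a,
        (∑ y, B.w a.1 y * uVar e a.2 (pos i y)) ^ lam ∂(ν.prod (rhoLaw e))) ∂(envLaw M ζ k)) := by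
  have h := mixedLog_interpolation B ν hM hM2 ζ hε hε1 hl hl1 pos
  have h1 : ∀ p : Fin k → ι, ∫ e, mixedLog B ν lam pos ∅ p e ∂(envLaw M ζ k)
      = ∫ c, Real.log (∫ r, (∑ y, B.w r y * (1 - theta c fun j => pos (p j) y)) ^ lam ∂ν)
          ∂(M.clauseLaw k) := by
    intro p
    have e1 : ∀ e : ClauseEnv X S k, mixedLog B ν lam pos ∅ p e = Real.log (∫ r,
        (∑ y, B.w r y * (1 - theta e.1 fun j => pos (p j) y)) ^ lam ∂ν) := by
      intro e
      unfold mixedLog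
      simp_rw [mixedU_empty]
      rw [integral_fun_fst (fun r => (∑ y, B.w r y *
        (1 - theta e.1 fun j => pos (p j) y)) ^ lam)]
      simp
    simp_rw [e1]
    unfold envLaw
    rw [integral_fun_fst (fun c => Real.log (∫ r,
        (∑ y, B.w r y * (1 - theta c fun j => pos (p j) y)) ^ lam ∂ν))]
    simp
  have h2 : ∀ p : Fin k → ι, ∫ e, mixedLog B ν lam pos Finset.univ p e ∂(envLaw M ζ k)
      = Real.log (∫ r, B.total r ^ lam ∂ν) + clauseTerm M ζ k lam := by
    intro p
    -- With every slot filled, the factor does not see the configuration of the system; the λ-moment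
    -- factorises and only the integrand of `clauseTerm` remains.
    have e1 : ∀ᵐ e ∂(envLaw M ζ k), mixedLog B ν lam pos Finset.univ p e
        - Real.log (∫ r, B.total r ^ lam ∂ν)
        = Real.log (∫ ρ : Fin k → M0 X, (uClause e ρ) ^ lam ∂(rhoLaw e)) := by
      filter_upwards [ae_goodEnv hM ζ] with e he
      have hpos : ∀ q : Fin k → M0 X, 0 < uClause e q := by
        intro q
        obtain ⟨y⟩ := ‹Nonempty Y›
        rw [← mixedU_univ e q fun j => pos (p j) y]
        exact lt_of_lt_of_le (by positivity) (mixedU_bounds hε hε1 _ he _ _).1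
      unfold mixedLog
      simp_rw [mixedU_univ, ← Finset.sum_mul]
      have e2 : ∀ a : R × (Fin k → M0 X), ((∑ y, B.w a.1 y) * uClause e a.2) ^ lam
          = B.total a.1 ^ lam * uClause e a.2 ^ lam := fun a =>
        Real.mul_rpow (B.total_pos a.1).le (hpos a.2).le
      simp_rw [e2]
      rw [integral_prod_mul (fun r => B.total r ^ lam) (fun q => uClause e q ^ lam)]
      have hb := B.integral_total_rpow_pos ν lam
      have hm : 0 < ∫ q, uClause e q ^ lam ∂(rhoLaw e) := by
        have hone : ∀ q : Fin k → M0 X, ε ^ (k + 1) * 1 ≤ uClause e q ∧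
            uClause e q ≤ (ε ^ (k + 1))⁻¹ * 1 := by
          intro q
          obtain ⟨y⟩ := ‹Nonempty Y›
          rw [← mixedU_univ e q fun j => pos (p j) y, mul_one, mul_one, ← inv_pow, ← one_div]
          exact mixedU_bounds hε hε1 _ he _ _
        have hmeas : Measurable fun q => uClause e q := by
          obtain ⟨y⟩ := ‹Nonempty Y›
          simp_rw [← mixedU_univ e _ fun j => pos (p j) y]
          exact measurable_mixedU_right Finset.univ e fun j => pos (p j) y
        exact (abs_log_integral_rpow_sub_le (g := fun _ => 1) (by positivity) hl.le hmeas
          (fun _ => zero_le_one) (by simp) (by simp) (fun q => (hone q).1)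
          fun q => (hone q).2).2.1
      rw [Real.log_mul hb.ne' hm.ne']
      ring
    have hi := integrable_mixedLog B ν hM ζ hε hε1 hl.le pos Finset.univ p
    have e3 : clauseTerm M ζ k lam = ∫ e, (mixedLog B ν lam pos Finset.univ p e
        - Real.log (∫ r, B.total r ^ lam ∂ν)) ∂(envLaw M ζ k) := by
      unfold clauseTerm
      exact (integral_congr_ae e1).symm
    rw [e3, integral_sub hi (integrable_const _)]
    simp
  have h3 : ∀ p : Fin k → ι,
      ∫ e, mixedLog B ν lam pos (Finset.univ.erase 0) p e ∂(envLaw M ζ k)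
      = ∫ e, Real.log (∫ a, (∑ y, B.w a.1 y * uVar e a.2 (pos (p 0) y)) ^ lam
          ∂(ν.prod (rhoLaw e))) ∂(envLaw M ζ k) := by
    intro p
    unfold mixedLog
    simp_rw [mixedU_erase]
  simp_rw [h1, h2, h3, avgPi_const] at h
  rwa [avgPi_eval fun i => ∫ e, Real.log (∫ a, (∑ y, B.w a.1 y * uVar e a.2 (pos i y)) ^ lam
          ∂(ν.prod (rhoLaw e))) ∂(envLaw M ζ k)] at h

end Fixed

/-! ### Appending and regrouping independent coordinates -/

theorem measurePreserving_snoc {α : Type*} [MeasurableSpace α] {n : ℕ}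
    (μ : Fin (n + 1) → Measure α) [∀ i, IsProbabilityMeasure (μ i)] :
    MeasurePreserving (fun p : (Fin n → α) × α => (Fin.snoc p.1 p.2 : Fin (n + 1) → α))
      ((Measure.pi fun i : Fin n => μ i.castSucc).prod (μ (Fin.last n))) (Measure.pi μ) := by
  have hm : Measurable fun p : (Fin n → α) × α => (Fin.snoc p.1 p.2 : Fin (n + 1) → α) := by
    refine measurable_pi_lambda _ fun i => ?_
    refine Fin.lastCases ?_ (fun i => ?_) i
    · simpa using measurable_snd
    · simp only [Fin.snoc_castSucc]
      fun_prop
  refine ⟨hm, (Measure.pi_eq fun s hs => ?_).symm⟩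
  rw [Measure.map_apply hm (MeasurableSet.univ_pi hs)]
  have : (fun p : (Fin n → α) × α => (Fin.snoc p.1 p.2 : Fin (n + 1) → α)) ⁻¹' (Set.univ.pi s)
      = (Set.univ.pi fun i : Fin n => s i.castSucc) ×ˢ s (Fin.last n) := by
    ext p
    simp [Set.mem_pi, Fin.forall_fin_succ']
  rw [this, Measure.prod_prod, Measure.pi_pi, Fin.prod_univ_castSucc]

theorem measurePreserving_snoc_middle {α β γ : Type*} [MeasurableSpace α] [MeasurableSpace β]
    [MeasurableSpace γ] {n : ℕ} (μ : Measure α) (ν : Measure β) (τ : Measure γ)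
    [IsProbabilityMeasure μ] [IsProbabilityMeasure ν] [IsProbabilityMeasure τ] :
    MeasurePreserving (fun p : ((α × (Fin n → β)) × γ) × β =>
        ((p.1.1.1, (Fin.snoc p.1.1.2 p.2 : Fin (n + 1) → β)), p.1.2))
      (((μ.prod (Measure.pi fun _ : Fin n => ν)).prod τ).prod ν)
      ((μ.prod (Measure.pi fun _ : Fin (n + 1) => ν)).prod τ) := by
  have h1 := measurePreserving_prodAssoc (μ.prod (Measure.pi fun _ : Fin n => ν)) τ ν
  have h2 := (MeasurePreserving.id (μ.prod (Measure.pi fun _ : Fin n => ν))).prod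
    (Measure.measurePreserving_swap (μ := τ) (ν := ν))
  have h3 := (measurePreserving_prodAssoc (μ.prod (Measure.pi fun _ : Fin n => ν)) ν τ).symm
  have h4 := measurePreserving_prodAssoc μ (Measure.pi fun _ : Fin n => ν) ν
  have h5 := (MeasurePreserving.id μ).prod (measurePreserving_snoc fun _ : Fin (n + 1) => ν)
  have h6 := (h5.comp h4).prod (MeasurePreserving.id τ)
  exact ((h6.comp h3).comp h2).comp h1

theorem measurePreserving_uncurry {ι κ β α : Type*} [Fintype ι] [Fintype κ] [Fintype β]
    [MeasurableSpace α] (e : β ≃ ι × κ) (μ : β → Measure α) [∀ b, IsProbabilityMeasure (μ b)] :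
    MeasurePreserving (fun (f : ι → κ → α) b => f (e b).1 (e b).2)
      (Measure.pi fun i => Measure.pi fun j => μ (e.symm (i, j))) (Measure.pi μ) := by
  have hm : Measurable fun (f : ι → κ → α) b => f (e b).1 (e b).2 := by fun_prop
  refine ⟨hm, (Measure.pi_eq fun s hs => ?_).symm⟩
  rw [Measure.map_apply hm (MeasurableSet.univ_pi hs)]
  have : (fun (f : ι → κ → α) b => f (e b).1 (e b).2) ⁻¹' (Set.univ.pi s)
      = Set.univ.pi fun i => Set.univ.pi fun j => s (e.symm (i, j)) := by
    ext f
    simp only [Set.mem_preimage, Set.mem_pi, Set.mem_univ, true_imp_iff]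
    constructor
    · intro h i j
      simpa using h (e.symm (i, j))
    · intro h b
      simpa using h (e b).1 (e b).2
  rw [this, Measure.pi_pi]
  simp_rw [Measure.pi_pi]
  rw [← Fintype.prod_prod_type' (fun i j => μ (e.symm (i, j)) (s (e.symm (i, j)))),
    ← e.symm.prod_comp]

/-! ### Hybrid systems of clauses and cavity factors -/

section Hybrid

variable {X S V A B : Type*} [MeasurableSpace X] [Fintype X] [DecidableEq X]
  [DiscreteMeasurableSpace X] [Fintype S] {k : ℕ} [NeZero k] [Fintype V] [DecidableEq V]
  [Fintype A] [Fintype B]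

/-- The disorder of a hybrid system with variables `V`, clauses `A` and cavity factors `B`. -/
abbrev HybridEnv (X S V A B : Type*) [MeasurableSpace X] (k : ℕ) : Type _ :=
  ((V → Potential X) × (A → ClauseLabel X S k)) × (B → ClauseEnv X S k)

/-- The law of the disorder of a hybrid system. -/
def hybridLaw (M : FactorModel X S) (ζ : M2 X) (V A B : Type*) [Fintype V] [Fintype A]
    [Fintype B] (k : ℕ) : Measure (HybridEnv X S V A B k) :=
  ((Measure.pi fun _ : V => (M.hLaw : Measure (Potential X))).prod
    (Measure.pi fun _ : A => M.clauseLaw k)).prod (Measure.pi fun _ : B => envLaw M ζ k)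

instance (M : FactorModel X S) (ζ : M2 X) : IsProbabilityMeasure (hybridLaw M ζ V A B k) := by
  unfold hybridLaw
  infer_instance

/-- The weight of a configuration of a hybrid system. -/
def hybridWeight (w : A → Fin k → V) (c : B → V) (ω : HybridEnv X S V A B k)
    (ρ : B → Fin k → M0 X) (x : V → X) : ℝ :=
  (∏ v, (ω.1.1 v (x v) : ℝ)) * (∏ a, (1 - theta (ω.1.2 a) fun j => x (w a j)))
    * ∏ b, uVar (ω.2 b) (ρ b) (x (c b))

/-- `log 𝔼'` of the `lam`-th power of the partition function of a hybrid system. -/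
def hybridLog (lam : ℝ) (w : A → Fin k → V) (c : B → V) (ω : HybridEnv X S V A B k) : ℝ :=
  Real.log (∫ ρ : B → Fin k → M0 X, (∑ x, hybridWeight w c ω ρ x) ^ lam
    ∂(Measure.pi fun b => rhoLaw (ω.2 b)))

/-- The expectation of `hybridLog`. -/
def hybridEnergy (M : FactorModel X S) (ζ : M2 X) (lam : ℝ) (w : A → Fin k → V) (c : B → V) : ℝ :=
  ∫ ω, hybridLog lam w c ω ∂(hybridLaw M ζ V A B k)

/-- All potentials of the hybrid system are within their almost sure bounds. -/
structure GoodHybrid (ε : ℝ) (ω : HybridEnv X S V A B k) : Prop where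
  potential : ∀ v x, ε ≤ (ω.1.1 v x : ℝ) ∧ (ω.1.1 v x : ℝ) ≤ 1 / ε
  clause : ∀ a (x : Fin k → X), ε ≤ 1 - theta (ω.1.2 a) x ∧ 1 - theta (ω.1.2 a) x ≤ 1 / ε
  env : ∀ b, GoodEnv ε (ω.2 b)

theorem ae_goodHybrid {M : FactorModel X S} {ε : ℝ} (hM : M.BoundedPotentials k ε) (ζ : M2 X) :
    ∀ᵐ ω ∂(hybridLaw M ζ V A B k), GoodHybrid ε ω := by
  have h1 : ∀ᵐ ω ∂(hybridLaw M ζ V A B k), ∀ v x,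
      ε ≤ (ω.1.1 v x : ℝ) ∧ (ω.1.1 v x : ℝ) ≤ 1 / ε := by
    rw [ae_all_iff]
    intro v
    have hq : Measure.QuasiMeasurePreserving (fun ω : HybridEnv X S V A B k => ω.1.1 v)
        (hybridLaw M ζ V A B k) (M.hLaw : Measure (Potential X)) :=
      (measurePreserving_eval _ v).quasiMeasurePreserving.comp
        (Measure.quasiMeasurePreserving_fst.comp Measure.quasiMeasurePreserving_fst)
    exact hq.ae hM.1
  have h2 : ∀ᵐ ω ∂(hybridLaw M ζ V A B k), ∀ a (x : Fin k → X),
      ε ≤ 1 - theta (ω.1.2 a) x ∧ 1 - theta (ω.1.2 a) x ≤ 1 / ε := by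
    rw [ae_all_iff]
    intro a
    have hq : Measure.QuasiMeasurePreserving (fun ω : HybridEnv X S V A B k => ω.1.2 a)
        (hybridLaw M ζ V A B k) (M.clauseLaw k) :=
      (measurePreserving_eval _ a).quasiMeasurePreserving.comp
        (Measure.quasiMeasurePreserving_snd.comp Measure.quasiMeasurePreserving_fst)
    exact hq.ae hM.2
  have h3 : ∀ᵐ ω ∂(hybridLaw M ζ V A B k), ∀ b, GoodEnv ε (ω.2 b) := by
    rw [ae_all_iff]
    intro b
    have hq : Measure.QuasiMeasurePreserving (fun ω : HybridEnv X S V A B k => ω.2 b)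
        (hybridLaw M ζ V A B k) (envLaw M ζ k) :=
      (measurePreserving_eval _ b).quasiMeasurePreserving.comp
        Measure.quasiMeasurePreserving_snd
    exact hq.ae (ae_goodEnv hM ζ)
  filter_upwards [h1, h2, h3] with ω h1 h2 h3
  exact ⟨h1, h2, h3⟩

theorem uVar_bounds {ε : ℝ} (hε : 0 < ε) (hε1 : ε ≤ 1) {e : ClauseEnv X S k} (he : GoodEnv ε e)
    (q : Fin k → M0 X) (y : X) :
    ε ^ (k + 1) ≤ uVar e q y ∧ uVar e q y ≤ (ε ^ (k + 1))⁻¹ := by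
  have h := mixedU_bounds hε hε1 (Finset.univ.erase 0) he q fun _ => y
  rwa [mixedU_erase, one_div, inv_pow] at h

theorem measurable_uVar (y : X) :
    Measurable fun p : ClauseEnv X S k × (Fin k → M0 X) => uVar p.1 p.2 y := by
  have h := measurable_mixedU (S := S) (Finset.univ.erase (0 : Fin k)) fun _ => y
  simp_rw [mixedU_erase] at h
  exact h

/-- The exponent in the crude bounds on the weights of a hybrid system. -/
def hybridSize (V A B : Type*) [Fintype V] [Fintype A] [Fintype B] (k : ℕ) : ℕ :=
  Fintype.card V + Fintype.card A + (k + 1) * Fintype.card B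

theorem hybridWeight_bounds {ε : ℝ} (hε : 0 < ε) (hε1 : ε ≤ 1) (w : A → Fin k → V) (c : B → V)
    {ω : HybridEnv X S V A B k} (hω : GoodHybrid ε ω) (ρ : B → Fin k → M0 X) (x : V → X) :
    ε ^ hybridSize V A B k ≤ hybridWeight w c ω ρ x ∧
      hybridWeight w c ω ρ x ≤ (ε ^ hybridSize V A B k)⁻¹ := by
  have hp : 0 < ε ^ (k + 1) := by positivity
  have e1 : ε ^ hybridSize V A B k
      = (∏ _v : V, ε) * (∏ _a : A, ε) * ∏ _b : B, ε ^ (k + 1) := by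
    simp only [Finset.prod_const, Finset.card_univ, hybridSize, pow_add, pow_mul]
  have e2 : (ε ^ hybridSize V A B k)⁻¹
      = (∏ _v : V, ε⁻¹) * (∏ _a : A, ε⁻¹) * ∏ _b : B, (ε ^ (k + 1))⁻¹ := by
    rw [e1]
    simp only [Finset.prod_const, Finset.card_univ, mul_inv, inv_pow]
  have b1 : ∀ v, 0 ≤ (ω.1.1 v (x v) : ℝ) := fun v => NNReal.coe_nonneg _
  have b2 : ∀ a, 0 ≤ 1 - theta (ω.1.2 a) fun j => x (w a j) := fun a =>
    hε.le.trans (hω.clause a _).1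
  have b3 : ∀ b, 0 ≤ uVar (ω.2 b) (ρ b) (x (c b)) := fun b =>
    hp.le.trans (uVar_bounds hε hε1 (hω.env b) _ _).1
  have p1 : ∏ _v : V, ε ≤ ∏ v, (ω.1.1 v (x v) : ℝ) :=
    Finset.prod_le_prod (fun _ _ => hε.le) fun v _ => (hω.potential v _).1
  have p2 : ∏ _a : A, ε ≤ ∏ a, (1 - theta (ω.1.2 a) fun j => x (w a j)) :=
    Finset.prod_le_prod (fun _ _ => hε.le) fun a _ => (hω.clause a _).1
  have p3 : ∏ _b : B, ε ^ (k + 1) ≤ ∏ b, uVar (ω.2 b) (ρ b) (x (c b)) :=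
    Finset.prod_le_prod (fun _ _ => hp.le) fun b _ => (uVar_bounds hε hε1 (hω.env b) _ _).1
  have q1 : ∏ v, (ω.1.1 v (x v) : ℝ) ≤ ∏ _v : V, ε⁻¹ :=
    Finset.prod_le_prod (fun v _ => b1 v) fun v _ => by
      simpa using (hω.potential v (x v)).2
  have q2 : ∏ a, (1 - theta (ω.1.2 a) fun j => x (w a j)) ≤ ∏ _a : A, ε⁻¹ :=
    Finset.prod_le_prod (fun a _ => b2 a) fun a _ => by
      simpa only [one_div] using (hω.clause a _).2
  have q3 : ∏ b, uVar (ω.2 b) (ρ b) (x (c b)) ≤ ∏ _b : B, (ε ^ (k + 1))⁻¹ :=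
    Finset.prod_le_prod (fun b _ => b3 b) fun b _ => (uVar_bounds hε hε1 (hω.env b) _ _).2
  have n1 := Finset.prod_nonneg fun v (_ : v ∈ Finset.univ) => b1 v
  have n2 := Finset.prod_nonneg fun a (_ : a ∈ Finset.univ) => b2 a
  have n3 := Finset.prod_nonneg fun b (_ : b ∈ Finset.univ) => b3 b
  rw [e1]
  unfold hybridWeight
  constructor
  · exact mul_le_mul (mul_le_mul p1 p2 (by positivity) n1) p3 (by positivity) (mul_nonneg n1 n2)
  · rw [← e1, e2]
    exact mul_le_mul (mul_le_mul q1 q2 n2 (by positivity)) q3 n3 (by positivity)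

theorem measurable_hybridWeight (w : A → Fin k → V) (c : B → V) (x : V → X) :
    Measurable fun p : HybridEnv X S V A B k × (B → Fin k → M0 X) =>
      hybridWeight w c p.1 p.2 x := by
  unfold hybridWeight
  have m1 : Measurable fun p : HybridEnv X S V A B k × (B → Fin k → M0 X) =>
      ∏ v, (p.1.1.1 v (x v) : ℝ) := by fun_prop
  have m2 : Measurable fun p : HybridEnv X S V A B k × (B → Fin k → M0 X) =>
      ∏ a, (1 - theta (p.1.1.2 a) fun j => x (w a j)) := by fun_prop
  have m3 : Measurable fun p : HybridEnv X S V A B k × (B → Fin k → M0 X) =>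
      ∏ b, uVar (p.1.2 b) (p.2 b) (x (c b)) := by
    refine Finset.measurable_prod _ fun b _ => ?_
    have h : Measurable fun p : HybridEnv X S V A B k × (B → Fin k → M0 X) =>
      (p.1.2 b, p.2 b) := by fun_prop
    have h2 := (measurable_uVar (S := S) (x (c b))).comp h
    exact h2
  exact (m1.mul m2).mul m3

/-- The conditional law of the `ρ`'s of a hybrid system as a kernel. -/
def hybridKernel (X S V A B : Type*) [MeasurableSpace X] [Fintype B] (k : ℕ) :
    ProbabilityTheory.Kernel (HybridEnv X S V A B k) (B → Fin k → M0 X) :=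
  ⟨fun ω => Measure.pi fun b => rhoLaw (ω.2 b),
    measurable_measure_pi (fun (ω : HybridEnv X S V A B k) b => rhoLaw (ω.2 b))
      fun b => (rhoKernel X S k).measurable.comp
        ((measurable_pi_apply b).comp measurable_snd)⟩

instance : ProbabilityTheory.IsMarkovKernel (hybridKernel X S V A B k) :=
  ⟨fun ω => inferInstanceAs (IsProbabilityMeasure (Measure.pi fun b => rhoLaw (ω.2 b)))⟩

theorem measurable_hybridLog (lam : ℝ) (w : A → Fin k → V) (c : B → V) :
    Measurable fun ω : HybridEnv X S V A B k => hybridLog lam w c ω := by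
  refine Measurable.log ?_
  have hm : StronglyMeasurable fun p : HybridEnv X S V A B k × (B → Fin k → M0 X) =>
      (∑ x, hybridWeight w c p.1 p.2 x) ^ lam :=
    ((Finset.measurable_sum _ fun x _ =>
      measurable_hybridWeight w c x).pow_const _).stronglyMeasurable
  have := hm.integral_kernel_prod_right' (κ := hybridKernel X S V A B k)
  exact this.measurable

variable [Nonempty X]

/-- The weights of a hybrid system with fixed disorder. -/
def GoodHybrid.baseWeight {ε : ℝ} (hε : 0 < ε) (hε1 : ε ≤ 1) (w : A → Fin k → V) (c : B → V)
    {ω : HybridEnv X S V A B k} (hω : GoodHybrid ε ω) :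
    BaseWeight (B → Fin k → M0 X) (V → X) where
  w := fun ρ x => hybridWeight w c ω ρ x
  lo := ε ^ hybridSize V A B k
  hi := (ε ^ hybridSize V A B k)⁻¹
  lo_pos := by positivity
  lo_le := fun ρ x => (hybridWeight_bounds hε hε1 w c hω ρ x).1
  le_hi := fun ρ x => (hybridWeight_bounds hε hε1 w c hω ρ x).2
  meas := fun x => by
    have h : Measurable fun ρ : B → Fin k → M0 X => (ω, ρ) := measurable_prodMk_left
    have h2 := (measurable_hybridWeight w c x).comp h
    exact h2

theorem abs_hybridLog_le {ε lam : ℝ} (hε : 0 < ε) (hε1 : ε ≤ 1) (hl : 0 ≤ lam)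
    (w : A → Fin k → V) (c : B → V) {ω : HybridEnv X S V A B k} (hω : GoodHybrid ε ω) :
    |hybridLog lam w c ω| ≤ lam * Real.log
      (((Fintype.card (V → X) : ℝ)⁻¹ * ε ^ hybridSize V A B k))⁻¹ := by
  set N : ℝ := (Fintype.card (V → X) : ℝ) with hN
  have hN1 : 1 ≤ N := by
    rw [hN]
    exact_mod_cast Fintype.card_pos
  let Bw := hω.baseWeight hε hε1 w c
  have hlow : ∀ ρ, ε ^ hybridSize V A B k ≤ ∑ x, hybridWeight w c ω ρ x := fun ρ =>
    Bw.lo_le_total ρ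
  have hup : ∀ ρ, ∑ x, hybridWeight w c ω ρ x ≤ N * (ε ^ hybridSize V A B k)⁻¹ := fun ρ =>
    Bw.total_le ρ
  have hs : 0 < ε ^ hybridSize V A B k := by positivity
  have h := (abs_log_integral_rpow_sub_le (π := Measure.pi fun b => rhoLaw (ω.2 b))
    (f := fun ρ => ∑ x, hybridWeight w c ω ρ x) (g := fun _ => 1)
    (κ := N⁻¹ * ε ^ hybridSize V A B k) (by positivity) hl Bw.measurable_total
    (fun _ => zero_le_one) (by simp) (by simp) (fun ρ => ?_) (fun ρ => ?_)).2.2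
  · simpa [hybridLog] using h
  · rw [mul_one]
    refine le_trans ?_ (hlow ρ)
    exact mul_le_of_le_one_left hs.le (inv_le_one_of_one_le₀ hN1)
  · rw [mul_one, mul_inv, inv_inv]
    exact hup ρ

theorem integrable_hybridLog {M : FactorModel X S} {ε lam : ℝ} (hM : M.BoundedPotentials k ε)
    (ζ : M2 X) (hε : 0 < ε) (hε1 : ε ≤ 1) (hl : 0 ≤ lam) (w : A → Fin k → V) (c : B → V) :
    Integrable (fun ω => hybridLog lam w c ω) (hybridLaw M ζ V A B k) :=
  Integrable.of_bound (measurable_hybridLog lam w c).aestronglyMeasurable _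
    ((ae_goodHybrid hM ζ).mono fun _ hω => abs_hybridLog_le hε hε1 hl w c hω)

end Hybrid

/-! ### Adding one factor to a hybrid system -/

section Steps

variable {X S V : Type*} [MeasurableSpace X] [Fintype X] [DecidableEq X]
  [DiscreteMeasurableSpace X] [Fintype S] {k : ℕ} [NeZero k] [Fintype V] [DecidableEq V]
  {a b : ℕ}

/-- Adding one clause label to the disorder. -/
def addClause (p : HybridEnv X S V (Fin a) (Fin b) k × ClauseLabel X S k) :
    HybridEnv X S V (Fin (a + 1)) (Fin b) k :=
  ((p.1.1.1, Fin.snoc p.1.1.2 p.2), p.1.2)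

/-- Adding one cavity environment to the disorder. -/
def addCavity (p : HybridEnv X S V (Fin a) (Fin b) k × ClauseEnv X S k) :
    HybridEnv X S V (Fin a) (Fin (b + 1)) k :=
  (p.1.1, Fin.snoc p.1.2 p.2)

theorem measurePreserving_addCavity (M : FactorModel X S) (ζ : M2 X) :
    MeasurePreserving (addCavity (X := X) (S := S) (V := V) (k := k) (a := a) (b := b))
      ((hybridLaw M ζ V (Fin a) (Fin b) k).prod (envLaw M ζ k))
      (hybridLaw M ζ V (Fin a) (Fin (b + 1)) k) := by
  have h1 := measurePreserving_prodAssoc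
    ((Measure.pi fun _ : V => (M.hLaw : Measure (Potential X))).prod
      (Measure.pi fun _ : Fin a => M.clauseLaw k)) (Measure.pi fun _ : Fin b => envLaw M ζ k)
      (envLaw M ζ k)
  have h2 := (MeasurePreserving.id
    ((Measure.pi fun _ : V => (M.hLaw : Measure (Potential X))).prod
      (Measure.pi fun _ : Fin a => M.clauseLaw k))).prod
      (measurePreserving_snoc fun _ : Fin (b + 1) => envLaw M ζ k)
  exact h2.comp h1

theorem measurePreserving_addClause (M : FactorModel X S) (ζ : M2 X) :
    MeasurePreserving (addClause (X := X) (S := S) (V := V) (k := k) (a := a) (b := b))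
      ((hybridLaw M ζ V (Fin a) (Fin b) k).prod (M.clauseLaw k))
      (hybridLaw M ζ V (Fin (a + 1)) (Fin b) k) :=
  measurePreserving_snoc_middle _ _ _

theorem hybridLog_addClause (lam : ℝ) (w : Fin a → Fin k → V) (w' : Fin k → V) (c : Fin b → V)
    (p : HybridEnv X S V (Fin a) (Fin b) k × ClauseLabel X S k) :
    hybridLog lam (Fin.snoc w w' : Fin (a + 1) → Fin k → V) c (addClause p)
      = Real.log (∫ ρ : Fin b → Fin k → M0 X,
          (∑ x, hybridWeight w c p.1 ρ x * (1 - theta p.2 fun j => x (w' j))) ^ lam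
          ∂(Measure.pi fun b => rhoLaw (p.1.2 b))) := by
  have h : ∀ (ρ : Fin b → Fin k → M0 X) (x : V → X),
      hybridWeight (Fin.snoc w w' : Fin (a + 1) → Fin k → V) c (addClause p) ρ x
        = hybridWeight w c p.1 ρ x * (1 - theta p.2 fun j => x (w' j)) := by
    intro ρ x
    unfold hybridWeight addClause
    simp only [Fin.prod_univ_castSucc, Fin.snoc_castSucc, Fin.snoc_last]
    ring
  unfold hybridLog
  simp_rw [h]
  rfl

theorem hybridLog_addCavity (lam : ℝ) (w : Fin a → Fin k → V) (c : Fin b → V) (v : V)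
    (p : HybridEnv X S V (Fin a) (Fin b) k × ClauseEnv X S k) :
    hybridLog lam w (Fin.snoc c v : Fin (b + 1) → V) (addCavity p)
      = Real.log (∫ q : (Fin b → Fin k → M0 X) × (Fin k → M0 X),
          (∑ x, hybridWeight w c p.1 q.1 x * uVar p.2 q.2 (x v)) ^ lam
          ∂((Measure.pi fun b => rhoLaw (p.1.2 b)).prod (rhoLaw p.2))) := by
  have h : ∀ (q : (Fin b → Fin k → M0 X) × (Fin k → M0 X)) (x : V → X),
      hybridWeight w (Fin.snoc c v : Fin (b + 1) → V) (addCavity p) (Fin.snoc q.1 q.2) x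
        = hybridWeight w c p.1 q.1 x * uVar p.2 q.2 (x v) := by
    intro q x
    unfold hybridWeight addCavity
    simp only [Fin.prod_univ_castSucc, Fin.snoc_castSucc, Fin.snoc_last]
    ring
  have hmp := measurePreserving_snoc fun i : Fin (b + 1) => rhoLaw ((addCavity p).2 i)
  have hm : Measurable fun ρ : Fin (b + 1) → Fin k → M0 X =>
      (∑ x, hybridWeight w (Fin.snoc c v : Fin (b + 1) → V) (addCavity p) ρ x) ^ lam := by
    refine Measurable.pow_const (Finset.measurable_sum _ fun x _ => ?_) _
    have h1 : Measurable fun ρ : Fin (b + 1) → Fin k → M0 X => (addCavity p, ρ) :=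
      measurable_prodMk_left
    have h2 := (measurable_hybridWeight w (Fin.snoc c v : Fin (b + 1) → V) x).comp h1
    exact h2
  unfold hybridLog
  rw [← hmp.map_eq, integral_map hmp.measurable.aemeasurable hm.aestronglyMeasurable]
  simp_rw [h]
  simp only [addCavity, Fin.snoc_castSucc, Fin.snoc_last]

end Steps

/-! ### Energies of hybrid systems: interpolation, Lipschitz bounds, endpoints -/

section Energy

variable {X S V : Type*} [MeasurableSpace X] [Fintype X] [DecidableEq X]
  [DiscreteMeasurableSpace X] [Fintype S] {k : ℕ} [NeZero k] [Fintype V] [DecidableEq V]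
  {a b : ℕ} [Nonempty X] {M : FactorModel X S} {ε lam : ℝ}

theorem integrable_addClause (hM : M.BoundedPotentials k ε) (ζ : M2 X) (hε : 0 < ε) (hε1 : ε ≤ 1)
    (hl : 0 ≤ lam) (w : Fin (a + 1) → Fin k → V) (c : Fin b → V) :
    Integrable (fun p => hybridLog lam w c (addClause p))
      ((hybridLaw M ζ V (Fin a) (Fin b) k).prod (M.clauseLaw k)) :=
  (measurePreserving_addClause M ζ).integrable_comp_of_integrable
    (integrable_hybridLog hM ζ hε hε1 hl w c)

theorem integrable_addCavity (hM : M.BoundedPotentials k ε) (ζ : M2 X) (hε : 0 < ε) (hε1 : ε ≤ 1)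
    (hl : 0 ≤ lam) (w : Fin a → Fin k → V) (c : Fin (b + 1) → V) :
    Integrable (fun p => hybridLog lam w c (addCavity p))
      ((hybridLaw M ζ V (Fin a) (Fin b) k).prod (envLaw M ζ k)) :=
  (measurePreserving_addCavity M ζ).integrable_comp_of_integrable
    (integrable_hybridLog hM ζ hε hε1 hl w c)

omit [Nonempty X] in
theorem hybridEnergy_addClause (ζ : M2 X) (w : Fin (a + 1) → Fin k → V) (c : Fin b → V) :
    hybridEnergy M ζ lam w c = ∫ p, hybridLog lam w c (addClause p)
      ∂((hybridLaw M ζ V (Fin a) (Fin b) k).prod (M.clauseLaw k)) := by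
  unfold hybridEnergy
  rw [← (measurePreserving_addClause M ζ).map_eq,
    integral_map (measurePreserving_addClause M ζ).measurable.aemeasurable
      (measurable_hybridLog lam w c).aestronglyMeasurable]

omit [Nonempty X] in
theorem hybridEnergy_addCavity (ζ : M2 X) (w : Fin a → Fin k → V) (c : Fin (b + 1) → V) :
    hybridEnergy M ζ lam w c = ∫ p, hybridLog lam w c (addCavity p)
      ∂((hybridLaw M ζ V (Fin a) (Fin b) k).prod (envLaw M ζ k)) := by
  unfold hybridEnergy
  rw [← (measurePreserving_addCavity M ζ).map_eq,
    integral_map (measurePreserving_addCavity M ζ).measurable.aemeasurable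
      (measurable_hybridLog lam w c).aestronglyMeasurable]

/-- Conditionally on the disorder already present, the hybrid system is a `BaseWeight` whose
internal randomness is the ρ's, and the disorder of the added factor is independent of it. Fubini
reduces the claim to `base_interpolation`, with `pos` evaluating a configuration at the chosen
variable. -/
theorem hybridEnergy_interpolation {ι : Type*} [Fintype ι] [Nonempty ι]
    (hM : M.BoundedPotentials k ε) (hM2 : M.NonnegMoments) (ζ : M2 X) (hε : 0 < ε) (hε1 : ε ≤ 1)
    (hl : 0 < lam) (hl1 : lam < 1) (w : Fin a → Fin k → V) (c : Fin b → V) (pos : ι → V) :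
    avgPi (fun p : Fin k → ι =>
        hybridEnergy M ζ lam (Fin.snoc w fun j => pos (p j) : Fin (a + 1) → Fin k → V) c)
      + ((k : ℝ) - 1) * (hybridEnergy M ζ lam w c + clauseTerm M ζ k lam)
      ≤ k * ((Fintype.card ι : ℝ)⁻¹ *
        ∑ i, hybridEnergy M ζ lam w (Fin.snoc c (pos i) : Fin (b + 1) → V)) := by
  have e1 : ∀ w' : Fin (a + 1) → Fin k → V, hybridEnergy M ζ lam w' c
      = ∫ ω, ∫ c', hybridLog lam w' c (addClause (ω, c')) ∂(M.clauseLaw k)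
        ∂(hybridLaw M ζ V (Fin a) (Fin b) k) := fun w' => by
    rw [hybridEnergy_addClause ζ w' c,
      integral_prod _ (integrable_addClause hM ζ hε hε1 hl.le w' c)]
  have e2 : ∀ c' : Fin (b + 1) → V, hybridEnergy M ζ lam w c'
      = ∫ ω, ∫ e, hybridLog lam w c' (addCavity (ω, e)) ∂(envLaw M ζ k)
        ∂(hybridLaw M ζ V (Fin a) (Fin b) k) := fun c' => by
    rw [hybridEnergy_addCavity ζ w c',
      integral_prod _ (integrable_addCavity hM ζ hε hε1 hl.le w c')]
  have i1 : ∀ w' : Fin (a + 1) → Fin k → V, Integrable (fun ω =>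
      ∫ c', hybridLog lam w' c (addClause (ω, c')) ∂(M.clauseLaw k))
      (hybridLaw M ζ V (Fin a) (Fin b) k) := fun w' =>
    (integrable_addClause hM ζ hε hε1 hl.le w' c).integral_prod_left
  have i2 : ∀ c' : Fin (b + 1) → V, Integrable (fun ω =>
      ∫ e, hybridLog lam w c' (addCavity (ω, e)) ∂(envLaw M ζ k))
      (hybridLaw M ζ V (Fin a) (Fin b) k) := fun c' =>
    (integrable_addCavity hM ζ hε hε1 hl.le w c').integral_prod_left
  have i0 := integrable_hybridLog hM ζ hε hε1 hl.le w c
  have j1 : Integrable (fun ω => avgPi (fun p : Fin k → ι => ∫ c', hybridLog lam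
          (Fin.snoc w fun j => pos (p j) : Fin (a + 1) → Fin k → V) c
          (addClause (ω, c')) ∂(M.clauseLaw k))) (hybridLaw M ζ V (Fin a) (Fin b) k) :=
    (integrable_finsetSum _ fun p _ => i1 _).const_mul _
  have j2 : Integrable (fun ω => ((k : ℝ) - 1) * (hybridLog lam w c ω + clauseTerm M ζ k lam))
      (hybridLaw M ζ V (Fin a) (Fin b) k) := (i0.add (integrable_const _)).const_mul _
  have hL : avgPi (fun p : Fin k → ι =>
        hybridEnergy M ζ lam (Fin.snoc w fun j => pos (p j) : Fin (a + 1) → Fin k → V) c)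
      + ((k : ℝ) - 1) * (hybridEnergy M ζ lam w c + clauseTerm M ζ k lam)
      = ∫ ω, (avgPi (fun p : Fin k → ι => ∫ c', hybridLog lam
          (Fin.snoc w fun j => pos (p j) : Fin (a + 1) → Fin k → V) c
          (addClause (ω, c')) ∂(M.clauseLaw k))
        + ((k : ℝ) - 1) * (hybridLog lam w c ω + clauseTerm M ζ k lam))
        ∂(hybridLaw M ζ V (Fin a) (Fin b) k) := by
    rw [integral_add j1 j2, integral_const_mul, integral_add i0 (integrable_const _)]
    unfold avgPi
    rw [integral_const_mul, integral_finsetSum _ fun p _ => i1 _]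
    simp_rw [e1]
    simp [hybridEnergy]
  have hR : (k : ℝ) * ((Fintype.card ι : ℝ)⁻¹ *
        ∑ i, hybridEnergy M ζ lam w (Fin.snoc c (pos i) : Fin (b + 1) → V))
      = ∫ ω, (k : ℝ) * ((Fintype.card ι : ℝ)⁻¹ * ∑ i, ∫ e, hybridLog lam w
          (Fin.snoc c (pos i) : Fin (b + 1) → V) (addCavity (ω, e)) ∂(envLaw M ζ k))
        ∂(hybridLaw M ζ V (Fin a) (Fin b) k) := by
    rw [integral_const_mul, integral_const_mul, integral_finsetSum _ fun i _ => i2 _]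
    simp_rw [e2]
  rw [hL, hR]
  refine integral_mono_ae ?_ ?_ ?_
  · exact j1.add j2
  · exact ((integrable_finsetSum _ fun i _ => i2 _).const_mul _).const_mul _
  · filter_upwards [ae_goodHybrid hM ζ] with ω hω
    have h := base_interpolation (hω.baseWeight hε hε1 w c)
      (Measure.pi fun b => rhoLaw (ω.2 b)) hM hM2 ζ hε hε1 hl hl1 fun i (x : V → X) => x (pos i)
    simp_rw [hybridLog_addClause, hybridLog_addCavity]
    exact h

theorem abs_hybridEnergy_addClause_sub_le (hM : M.BoundedPotentials k ε) (ζ : M2 X) (hε : 0 < ε)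
    (hε1 : ε ≤ 1) (hl : 0 ≤ lam) (w : Fin a → Fin k → V) (w' : Fin k → V) (c : Fin b → V) :
    |hybridEnergy M ζ lam (Fin.snoc w w' : Fin (a + 1) → Fin k → V) c - hybridEnergy M ζ lam w c|
      ≤ lam * Real.log ((ε ^ (k + 1))⁻¹) := by
  have i0 := integrable_hybridLog hM ζ hε hε1 hl w c
  have i0' : Integrable (fun p : HybridEnv X S V (Fin a) (Fin b) k × ClauseLabel X S k =>
      hybridLog lam w c p.1) ((hybridLaw M ζ V (Fin a) (Fin b) k).prod (M.clauseLaw k)) :=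
    i0.comp_fst _
  have e0 : hybridEnergy M ζ lam w c = ∫ p : HybridEnv X S V (Fin a) (Fin b) k × ClauseLabel X S k,
      hybridLog lam w c p.1 ∂((hybridLaw M ζ V (Fin a) (Fin b) k).prod (M.clauseLaw k)) := by
    rw [integral_fun_fst (fun ω => hybridLog lam w c ω)]
    simp [hybridEnergy]
  rw [hybridEnergy_addClause, e0, ← integral_sub (integrable_addClause hM ζ hε hε1 hl _ c) i0',
    ← Real.norm_eq_abs]
  have hae : ∀ᵐ p ∂((hybridLaw M ζ V (Fin a) (Fin b) k).prod (M.clauseLaw k)),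
      ‖hybridLog lam (Fin.snoc w w' : Fin (a + 1) → Fin k → V) c (addClause p)
        - hybridLog lam w c p.1‖ ≤ lam * Real.log ((ε ^ (k + 1))⁻¹) := by
    have g1 : ∀ᵐ p ∂((hybridLaw M ζ V (Fin a) (Fin b) k).prod (M.clauseLaw k)),
      GoodHybrid ε p.1 := Measure.quasiMeasurePreserving_fst.ae (ae_goodHybrid hM ζ)
    have g2 : ∀ᵐ p ∂((hybridLaw M ζ V (Fin a) (Fin b) k).prod (M.clauseLaw k)),
      ∀ x : Fin k → X, ε ≤ 1 - theta p.2 x ∧ 1 - theta p.2 x ≤ 1 / ε :=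
      Measure.quasiMeasurePreserving_snd.ae hM.2
    filter_upwards [g1, g2] with p h1 h2
    let Bw := h1.baseWeight hε hε1 w c
    rw [hybridLog_addClause, Real.norm_eq_abs]
    -- A clause alone would only cost ε; the weaker ε^(k+1) gives clause steps and cavity steps a
    -- common Lipschitz constant.
    have hpk : ε ^ (k + 1) ≤ ε := pow_le_of_le_one hε.le hε1 (Nat.succ_ne_zero k)
    refine (abs_log_integral_rpow_sub_le (g := Bw.total) (κ := ε ^ (k + 1)) (by positivity) hl ?_
      (fun ρ => (Bw.total_pos ρ).le) (Bw.integrable_total_rpow _ lam)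
      (Bw.integral_total_rpow_pos _ lam) (fun ρ => ?_) fun ρ => ?_).2.2
    · exact Finset.measurable_sum _ fun x _ => (Bw.meas x).mul_const _
    · unfold BaseWeight.total
      rw [Finset.mul_sum]
      refine Finset.sum_le_sum fun x _ => ?_
      rw [mul_comm]
      exact mul_le_mul_of_nonneg_left (hpk.trans (h2 _).1) (Bw.lo_pos.le.trans (Bw.lo_le _ _))
    · unfold BaseWeight.total
      rw [Finset.mul_sum]
      refine Finset.sum_le_sum fun x _ => ?_
      rw [mul_comm _ (Bw.w ρ x)]
      refine mul_le_mul_of_nonneg_left ((h2 _).2.trans ?_) (Bw.lo_pos.le.trans (Bw.lo_le _ _))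
      rw [one_div]
      exact inv_anti₀ (by positivity) hpk
  exact (norm_integral_le_of_norm_le_const hae).trans (by simp)

theorem abs_hybridEnergy_addCavity_sub_le (hM : M.BoundedPotentials k ε) (ζ : M2 X) (hε : 0 < ε)
    (hε1 : ε ≤ 1) (hl : 0 ≤ lam) (w : Fin a → Fin k → V) (c : Fin b → V) (v : V) :
    |hybridEnergy M ζ lam w (Fin.snoc c v : Fin (b + 1) → V) - hybridEnergy M ζ lam w c|
      ≤ lam * Real.log ((ε ^ (k + 1))⁻¹) := by
  have i0 := integrable_hybridLog hM ζ hε hε1 hl w c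
  have i0' : Integrable (fun p : HybridEnv X S V (Fin a) (Fin b) k × ClauseEnv X S k =>
      hybridLog lam w c p.1) ((hybridLaw M ζ V (Fin a) (Fin b) k).prod (envLaw M ζ k)) :=
    i0.comp_fst _
  have e0 : hybridEnergy M ζ lam w c = ∫ p : HybridEnv X S V (Fin a) (Fin b) k × ClauseEnv X S k,
      hybridLog lam w c p.1 ∂((hybridLaw M ζ V (Fin a) (Fin b) k).prod (envLaw M ζ k)) := by
    rw [integral_fun_fst (fun ω => hybridLog lam w c ω)]
    simp [hybridEnergy]
  rw [hybridEnergy_addCavity, e0, ← integral_sub (integrable_addCavity hM ζ hε hε1 hl w _) i0',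
    ← Real.norm_eq_abs]
  have hae : ∀ᵐ p ∂((hybridLaw M ζ V (Fin a) (Fin b) k).prod (envLaw M ζ k)),
      ‖hybridLog lam w (Fin.snoc c v : Fin (b + 1) → V) (addCavity p)
        - hybridLog lam w c p.1‖ ≤ lam * Real.log ((ε ^ (k + 1))⁻¹) := by
    have g1 : ∀ᵐ p ∂((hybridLaw M ζ V (Fin a) (Fin b) k).prod (envLaw M ζ k)),
      GoodHybrid ε p.1 := Measure.quasiMeasurePreserving_fst.ae (ae_goodHybrid hM ζ)
    have g2 : ∀ᵐ p ∂((hybridLaw M ζ V (Fin a) (Fin b) k).prod (envLaw M ζ k)),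
      GoodEnv ε p.2 := Measure.quasiMeasurePreserving_snd.ae (ae_goodEnv hM ζ)
    filter_upwards [g1, g2] with p h1 h2
    -- A cavity factor is the mixed factor with only slot 0 unfilled; the single vertex `v` is
    -- encoded by the one-point index type `Unit`.
    have h := abs_mixedLog_sub_le (h1.baseWeight hε hε1 w c)
      (Measure.pi fun b => rhoLaw (p.1.2 b)) hε hε1 hl (fun (_ : Unit) (x : V → X) => x v)
      (Finset.univ.erase 0) (fun _ => ()) h2
    unfold mixedLog at h
    simp_rw [mixedU_erase] at h
    rw [hybridLog_addCavity, Real.norm_eq_abs]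
    exact h
  exact (norm_integral_le_of_norm_le_const hae).trans (by simp)

/-- Without cavity factors the space of ρ's is a single point, so 𝔼' is trivial and λ comes out of
the logarithm. -/
theorem hybridEnergy_of_no_cavity (hM : M.BoundedPotentials k ε) (ζ : M2 X) (hε : 0 < ε)
    (hε1 : ε ≤ 1) (w : Fin a → Fin k → V) (c : Fin 0 → V) :
    hybridEnergy M ζ lam w c = lam * ∫ ω : (V → Potential X) × (Fin a → ClauseLabel X S k),
      Real.log (∑ x : V → X, (∏ v, (ω.1 v (x v) : ℝ)) * ∏ i, (1 - theta (ω.2 i) fun j => x (w i j)))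
      ∂((Measure.pi fun _ : V => (M.hLaw : Measure (Potential X))).prod
        (Measure.pi fun _ : Fin a => M.clauseLaw k)) := by
  have hae : ∀ᵐ ω ∂(hybridLaw M ζ V (Fin a) (Fin 0) k), hybridLog lam w c ω = lam *
      Real.log (∑ x : V → X, (∏ v, (ω.1.1 v (x v) : ℝ)) *
        ∏ i, (1 - theta (ω.1.2 i) fun j => x (w i j))) := by
    filter_upwards [ae_goodHybrid hM ζ] with ω hω
    have hw : ∀ (ρ : Fin 0 → Fin k → M0 X) x, hybridWeight w c ω ρ x
        = (∏ v, (ω.1.1 v (x v) : ℝ)) * ∏ i, (1 - theta (ω.1.2 i) fun j => x (w i j)) := by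
      intro ρ x
      simp [hybridWeight]
    have hpos := (hω.baseWeight hε hε1 w c).total_pos (fun i => i.elim0)
    unfold BaseWeight.total GoodHybrid.baseWeight at hpos
    simp only [hw] at hpos
    unfold hybridLog
    simp_rw [hw]
    rw [integral_const, probReal_univ, one_smul, Real.log_rpow hpos]
  unfold hybridEnergy
  rw [integral_congr_ae hae, integral_const_mul]
  congr 1
  unfold hybridLaw
  rw [integral_fun_fst (fun ω : (V → Potential X) × (Fin a → ClauseLabel X S k) =>
    Real.log (∑ x : V → X, (∏ v, (ω.1 v (x v) : ℝ)) *
      ∏ i, (1 - theta (ω.2 i) fun j => x (w i j))))]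
  simp

/-- The integrand of `variableTerm`. -/
def variableLog {d : ℕ} (lam : ℝ) (ω : Potential X × (Fin d → ClauseEnv X S k)) : ℝ :=
  Real.log (∫ ρ : Fin d → Fin k → M0 X,
      (∑ x : X, (ω.1 x : ℝ) * ∏ a, uVar (ω.2 a) (ρ a) x) ^ lam
      ∂(Measure.pi fun a => rhoLaw (ω.2 a)))

/-- A single variable as a hybrid system. -/
def singleEnv {d : ℕ} (ω : Potential X × (Fin d → ClauseEnv X S k)) :
    HybridEnv X S Unit (Fin 0) (Fin d) k :=
  ((fun _ => ω.1, fun i => i.elim0), ω.2)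

omit [Nonempty X] in
theorem sum_hybridWeight_singleEnv {d : ℕ} (ω : Potential X × (Fin d → ClauseEnv X S k))
    (ρ : Fin d → Fin k → M0 X) :
    ∑ x, hybridWeight (fun (i : Fin 0) (_ : Fin k) => (i.elim0 : Unit)) (fun _ => ())
      (singleEnv ω) ρ x = ∑ x : X, (ω.1 x : ℝ) * ∏ a, uVar (ω.2 a) (ρ a) x := by
  rw [← (Equiv.funUnique Unit X).symm.sum_comp]
  refine Finset.sum_congr rfl fun x _ => ?_
  simp [hybridWeight, singleEnv]

omit [Nonempty X] in
theorem variableLog_eq_hybridLog {d : ℕ} (ω : Potential X × (Fin d → ClauseEnv X S k)) :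
    variableLog lam ω = hybridLog lam (fun (i : Fin 0) (_ : Fin k) => (i.elim0 : Unit))
      (fun _ => ()) (singleEnv ω) := by
  unfold variableLog hybridLog
  simp_rw [sum_hybridWeight_singleEnv]
  rfl

omit [Nonempty X] in
theorem measurable_variableLog {d : ℕ} :
    Measurable (variableLog (X := X) (S := S) (k := k) (d := d) lam) := by
  have h : (variableLog (X := X) (S := S) (k := k) (d := d) lam) = fun ω =>
      hybridLog lam (fun (i : Fin 0) (_ : Fin k) => (i.elim0 : Unit))
      (fun _ => ()) (singleEnv ω) :=
    funext variableLog_eq_hybridLog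
  have h1 := measurable_hybridLog (X := X) (S := S) lam
    (fun (i : Fin 0) (_ : Fin k) => (i.elim0 : Unit)) (fun _ : Fin d => ())
  have h2 : Measurable (singleEnv (X := X) (S := S) (k := k) (d := d)) := by
    refine Measurable.prodMk (Measurable.prodMk ?_ measurable_const) measurable_snd
    exact measurable_pi_lambda _ fun _ => measurable_fst
  rw [h]
  exact h1.comp h2

omit [Nonempty X] in
theorem goodHybrid_singleEnv {d : ℕ} {ω : Potential X × (Fin d → ClauseEnv X S k)}
    (h1 : ∀ x, ε ≤ (ω.1 x : ℝ) ∧ (ω.1 x : ℝ) ≤ 1 / ε) (h2 : ∀ i, GoodEnv ε (ω.2 i)) :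
    GoodHybrid ε (singleEnv ω) :=
  ⟨fun _ => h1, fun i => i.elim0, h2⟩

theorem integrable_variableLog {d : ℕ} (hM : M.BoundedPotentials k ε) (ζ : M2 X) (hε : 0 < ε)
    (hε1 : ε ≤ 1) (hl : 0 ≤ lam) :
    Integrable (variableLog (d := d) (k := k) lam)
      ((M.hLaw : Measure (Potential X)).prod (Measure.pi fun _ : Fin d => envLaw M ζ k)) := by
  refine Integrable.of_bound measurable_variableLog.aestronglyMeasurable
    (lam * Real.log (((Fintype.card (Unit → X) : ℝ)⁻¹ *
      ε ^ hybridSize Unit (Fin 0) (Fin d) k))⁻¹) ?_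
  have h1 : ∀ᵐ ω ∂((M.hLaw : Measure (Potential X)).prod
      (Measure.pi fun _ : Fin d => envLaw M ζ k)),
      ∀ x, ε ≤ (ω.1 x : ℝ) ∧ (ω.1 x : ℝ) ≤ 1 / ε := Measure.quasiMeasurePreserving_fst.ae hM.1
  have h2 : ∀ᵐ ω ∂((M.hLaw : Measure (Potential X)).prod
      (Measure.pi fun _ : Fin d => envLaw M ζ k)), ∀ i, GoodEnv ε (ω.2 i) := by
    rw [ae_all_iff]
    intro i
    have hq : Measure.QuasiMeasurePreserving
        (fun ω : Potential X × (Fin d → ClauseEnv X S k) => ω.2 i)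
        ((M.hLaw : Measure (Potential X)).prod (Measure.pi fun _ : Fin d => envLaw M ζ k))
        (envLaw M ζ k) :=
      (measurePreserving_eval _ i).quasiMeasurePreserving.comp
        Measure.quasiMeasurePreserving_snd
    exact hq.ae (ae_goodEnv hM ζ)
  filter_upwards [h1, h2] with ω h1 h2
  rw [variableLog_eq_hybridLog]
  exact abs_hybridLog_le hε hε1 hl _ _ (goodHybrid_singleEnv h1 h2)

/-- A hybrid system without clauses decouples over the variables. -/
theorem hybridLog_decouple {B : Type*} [Fintype B] {d : ℕ} (hε : 0 < ε) (hε1 : ε ≤ 1)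
    (e : B ≃ V × Fin d) (w : Fin 0 → Fin k → V)
    (h : V → Potential X) (cl : Fin 0 → ClauseLabel X S k) (es : V → Fin d → ClauseEnv X S k)
    (h1 : ∀ v x, ε ≤ (h v x : ℝ) ∧ (h v x : ℝ) ≤ 1 / ε) (h2 : ∀ v i, GoodEnv ε (es v i)) :
    hybridLog lam w (fun b => (e b).1) ((h, cl), fun b => es (e b).1 (e b).2)
      = ∑ v, variableLog lam (h v, es v) := by
  have hpos : ∀ v, 0 < ∫ ρ : Fin d → Fin k → M0 X,
      (∑ x : X, (h v x : ℝ) * ∏ i, uVar (es v i) (ρ i) x) ^ lam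
      ∂(Measure.pi fun i => rhoLaw (es v i)) := by
    intro v
    have hg := goodHybrid_singleEnv (ω := (h v, es v)) (h1 v) (h2 v)
    have := (hg.baseWeight hε hε1 (fun (i : Fin 0) (_ : Fin k) => (i.elim0 : Unit))
      fun _ => ()).integral_total_rpow_pos (Measure.pi fun i => rhoLaw (es v i)) lam
    unfold BaseWeight.total GoodHybrid.baseWeight at this
    simp only [sum_hybridWeight_singleEnv] at this
    exact this
  have hnn : ∀ v (ρ : Fin d → Fin k → M0 X),
      0 ≤ ∑ x : X, (h v x : ℝ) * ∏ i, uVar (es v i) (ρ i) x := fun v ρ =>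
    Finset.sum_nonneg fun x _ => mul_nonneg (NNReal.coe_nonneg _) (Finset.prod_nonneg fun i _ =>
      le_trans (by positivity) (uVar_bounds hε hε1 (h2 v i) _ _).1)
  have hmp := measurePreserving_uncurry e fun b => rhoLaw (es (e b).1 (e b).2)
  simp only [Equiv.apply_symm_apply] at hmp
  have hm : Measurable fun ρ : B → Fin k → M0 X => (∑ x, hybridWeight w (fun b => (e b).1)
      ((h, cl), fun b => es (e b).1 (e b).2) ρ x) ^ lam := by
    refine Measurable.pow_const (Finset.measurable_sum _ fun x _ => ?_) _
    have m1 : Measurable fun ρ : B → Fin k → M0 X =>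
        ((((h, cl), fun b => es (e b).1 (e b).2) : HybridEnv X S V (Fin 0) B k), ρ) :=
      measurable_prodMk_left
    have m2 := (measurable_hybridWeight w (fun b => (e b).1) x).comp m1
    exact m2
  have hfac : ∀ ρ : V → Fin d → Fin k → M0 X, (∑ x, hybridWeight w (fun b => (e b).1)
      ((h, cl), fun b => es (e b).1 (e b).2) (fun b => ρ (e b).1 (e b).2) x) ^ lam
      = ∏ v, (∑ x : X, (h v x : ℝ) * ∏ i, uVar (es v i) (ρ v i) x) ^ lam := by
    intro ρ
    rw [Real.finsetProd_rpow _ _ fun v _ => hnn v (ρ v), Finset.prod_univ_sum,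
      Fintype.piFinset_univ]
    congr 1
    refine Finset.sum_congr rfl fun x _ => ?_
    unfold hybridWeight
    rw [Finset.prod_mul_distrib]
    simp only [Finset.univ_eq_empty, Finset.prod_empty, mul_one]
    congr 1
    rw [e.prod_comp fun vi => uVar (es vi.1 vi.2) (ρ vi.1 vi.2) (x vi.1), Fintype.prod_prod_type]
  unfold hybridLog
  rw [← hmp.map_eq, integral_map hmp.measurable.aemeasurable hm.aestronglyMeasurable]
  simp_rw [hfac]
  rw [integral_fintype_prod_eq_prod (f := fun v (ρ : Fin d → Fin k → M0 X) =>
    (∑ x : X, (h v x : ℝ) * ∏ i, uVar (es v i) (ρ i) x) ^ lam),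
    Real.log_prod fun v _ => (hpos v).ne']
  rfl

/-- The bijection `e` hands every variable exactly `d` cavity factors. Regrouped by variable, the
disorder seen by each one has the law used in `variableTerm`, and the logarithm of the decoupled
product is a sum. -/
theorem hybridEnergy_of_no_clause {B : Type*} [Fintype B] {d : ℕ} (hM : M.BoundedPotentials k ε)
    (ζ : M2 X) (hε : 0 < ε)
    (hε1 : ε ≤ 1) (hl : 0 ≤ lam) (e : B ≃ V × Fin d) (w : Fin 0 → Fin k → V) :
    hybridEnergy M ζ lam w (fun b => (e b).1)
      = Fintype.card V * variableTerm M ζ d k lam := by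
  have hmp := (MeasurePreserving.id
    ((Measure.pi fun _ : V => (M.hLaw : Measure (Potential X))).prod
      (Measure.pi fun _ : Fin 0 => M.clauseLaw k))).prod
      (measurePreserving_uncurry e fun _ => envLaw M ζ k)
  have hproj : ∀ v, MeasurePreserving
      (fun ω : ((V → Potential X) × (Fin 0 → ClauseLabel X S k)) × (V → Fin d → ClauseEnv X S k) =>
        (ω.1.1 v, ω.2 v))
      (((Measure.pi fun _ : V => (M.hLaw : Measure (Potential X))).prod
      (Measure.pi fun _ : Fin 0 => M.clauseLaw k)).prod
        (Measure.pi fun _ : V => Measure.pi fun _ : Fin d => envLaw M ζ k))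
      ((M.hLaw : Measure (Potential X)).prod (Measure.pi fun _ : Fin d => envLaw M ζ k)) := by
    intro v
    have p1 : MeasurePreserving
        (fun q : (V → Potential X) × (Fin 0 → ClauseLabel X S k) => q.1 v)
        ((Measure.pi fun _ : V => (M.hLaw : Measure (Potential X))).prod
          (Measure.pi fun _ : Fin 0 => M.clauseLaw k)) (M.hLaw : Measure (Potential X)) :=
      (measurePreserving_eval (fun _ : V => (M.hLaw : Measure (Potential X))) v).comp
        measurePreserving_fst
    exact p1.prod (measurePreserving_eval
      (fun _ : V => Measure.pi fun _ : Fin d => envLaw M ζ k) v)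
  have hvar : ∀ v, ∫ ω, variableLog lam (ω.1.1 v, ω.2 v)
      ∂(((Measure.pi fun _ : V => (M.hLaw : Measure (Potential X))).prod
      (Measure.pi fun _ : Fin 0 => M.clauseLaw k)).prod
        (Measure.pi fun _ : V => Measure.pi fun _ : Fin d => envLaw M ζ k))
      = variableTerm M ζ d k lam := by
    intro v
    have : variableTerm M ζ d k lam = ∫ ω, variableLog lam ω
      ∂((M.hLaw : Measure (Potential X)).prod (Measure.pi fun _ : Fin d => envLaw M ζ k)) := rfl
    rw [this, ← (hproj v).map_eq, integral_map (hproj v).measurable.aemeasurable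
      measurable_variableLog.aestronglyMeasurable]
  have hvi : ∀ v, Integrable (fun ω : ((V → Potential X) × (Fin 0 → ClauseLabel X S k)) ×
      (V → Fin d → ClauseEnv X S k) => variableLog lam (ω.1.1 v, ω.2 v))
      (((Measure.pi fun _ : V => (M.hLaw : Measure (Potential X))).prod
      (Measure.pi fun _ : Fin 0 => M.clauseLaw k)).prod
        (Measure.pi fun _ : V => Measure.pi fun _ : Fin d => envLaw M ζ k)) := fun v =>
    (hproj v).integrable_comp_of_integrable (integrable_variableLog hM ζ hε hε1 hl)
  unfold hybridEnergy hybridLaw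
  rw [← hmp.map_eq, integral_map hmp.measurable.aemeasurable
    (measurable_hybridLog lam w _).aestronglyMeasurable]
  have hae : ∀ᵐ ω ∂(((Measure.pi fun _ : V => (M.hLaw : Measure (Potential X))).prod
      (Measure.pi fun _ : Fin 0 => M.clauseLaw k)).prod
        (Measure.pi fun _ : V => Measure.pi fun _ : Fin d => envLaw M ζ k)),
      hybridLog lam w (fun b => (e b).1) (Prod.map id
        (fun (f : V → Fin d → ClauseEnv X S k) b => f (e b).1 (e b).2) ω)
      = ∑ v, variableLog lam (ω.1.1 v, ω.2 v) := by
    have g1 : ∀ᵐ ω ∂(((Measure.pi fun _ : V => (M.hLaw : Measure (Potential X))).prod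
      (Measure.pi fun _ : Fin 0 => M.clauseLaw k)).prod
        (Measure.pi fun _ : V => Measure.pi fun _ : Fin d => envLaw M ζ k)),
        GoodHybrid ε (Prod.map id
        (fun (f : V → Fin d → ClauseEnv X S k) b => f (e b).1 (e b).2) ω) :=
      hmp.quasiMeasurePreserving.ae (ae_goodHybrid hM ζ)
    filter_upwards [g1] with ω hω
    exact hybridLog_decouple hε hε1 e w ω.1.1 ω.1.2 ω.2 hω.potential fun v i => by
      have := hω.env (e.symm (v, i))
      simpa using this
  rw [integral_congr_ae hae, integral_finsetSum _ fun v _ => hvi v]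
  simp_rw [hvar]
  simp

end Energy

/-! ### Exchangeability of the half-edges and the cost of collisions -/

section Symmetry

/-- A uniformly random bijection is exchangeable on any set of positions: functions that see the
bijection only outside the set `free` cannot tell two injective families in `free` apart. -/
theorem sum_equiv_comp_eq_of_injective {P Q κ : Type*} [Fintype P] [DecidableEq P] [Fintype Q]
    [DecidableEq Q] (free : P → Prop) [DecidablePred free] {q q' : κ → P}
    (hq : Function.Injective q) (hq' : Function.Injective q') (hf : ∀ i, free (q i))
    (hf' : ∀ i, free (q' i)) (g : (P ≃ Q) → (κ → Q) → ℝ)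
    (hg : ∀ σ σ' : P ≃ Q, (∀ p, ¬ free p → σ p = σ' p) → ∀ v, g σ v = g σ' v) :
    ∑ σ, g σ (fun i => σ (q i)) = ∑ σ, g σ (fun i => σ (q' i)) := by
  classical
  let r : κ → {p // free p} := fun i => ⟨q i, hf i⟩
  let r' : κ → {p // free p} := fun i => ⟨q' i, hf' i⟩
  have hr : Function.Injective r := fun i j h => hq (congrArg Subtype.val h)
  have hr' : Function.Injective r' := fun i j h => hq' (congrArg Subtype.val h)
  -- The matching of the two ranges extends to a permutation of the free positions, and by the
  -- identity to all of `P`. Reindexing by it changes no bijection outside `free`.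
  let e : {x // x ∈ Set.range r'} ≃ {x // x ∈ Set.range r} :=
    (Equiv.ofInjective r' hr').symm.trans (Equiv.ofInjective r hr)
  let τ₀ : Equiv.Perm {p // free p} := e.extendSubtype
  have hτ₀ : ∀ i, τ₀ (r' i) = r i := fun i => by
    have h1 : τ₀ (r' i) = e ⟨r' i, i, rfl⟩ :=
      Equiv.extendSubtype_apply_of_mem e (r' i) ⟨i, rfl⟩
    rw [h1]
    have h2 : (Equiv.ofInjective r' hr').symm ⟨r' i, i, rfl⟩ = i := by
      rw [Equiv.symm_apply_eq]; rfl
    simp only [e, Equiv.trans_apply, h2]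
    rfl
  let τ : Equiv.Perm P := Equiv.Perm.ofSubtype τ₀
  have hτ : ∀ i, τ (q' i) = q i := fun i => by
    have := Equiv.Perm.ofSubtype_apply_of_mem τ₀ (hf' i)
    rw [show τ (q' i) = _ from this]
    exact congrArg Subtype.val (hτ₀ i)
  have hfix : ∀ p, ¬ free p → τ p = p := fun p hp =>
    Equiv.Perm.ofSubtype_apply_of_not_mem τ₀ hp
  rw [← Equiv.sum_comp (Equiv.equivCongr τ.symm (Equiv.refl Q))
    (fun σ => g σ (fun i => σ (q' i)))]
  refine Finset.sum_congr rfl fun σ _ => ?_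
  have h1 : (fun i => (Equiv.equivCongr τ.symm (Equiv.refl Q)) σ (q' i)) = fun i => σ (q i) := by
    funext i
    simp [hτ]
  rw [h1]
  refine hg _ _ (fun p hp => ?_) _
  simp [hfix p hp]

/-- Averaging over uniformly random families of points, the non-injective ones cost at most
`k² / F`. -/
theorem le_avgPi_of_injective {k F : ℕ} (hF : 0 < F) {f : (Fin k → Fin F) → ℝ} {A B : ℝ}
    (hB : 0 ≤ B) (h : ∀ p, A - B ≤ f p) (hinj : ∀ p, Function.Injective p → A ≤ f p) :
    A - B * (k ^ 2 / F) ≤ avgPi f := by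
  classical
  have hF' : (0 : ℝ) < F := by exact_mod_cast hF
  have hcard : (Fintype.card (Fin k → Fin F) : ℝ) = (F : ℝ) ^ k := by simp
  have hinjcard : (((Finset.univ.filter fun p : Fin k → Fin F => Function.Injective p).card : ℕ) : ℝ)
      = (F.descFactorial k : ℕ) := by
    have := Fintype.card_embedding_eq (α := Fin k) (β := Fin F)
    simp only [Fintype.card_fin] at this
    rw [← this, ← Fintype.card_congr (Equiv.subtypeInjectiveEquivEmbedding (Fin k) (Fin F)),
      Fintype.card_subtype]
  have hcount : (F : ℝ) ^ k * (1 - k ^ 2 / F) ≤ (F.descFactorial k : ℕ) := by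
    rcases le_or_gt k F with hk | hk
    -- The number of injective families is at least (F + 1 - k)^k, to which Bernoulli's inequality
    -- applies.
    · have h1 : (((F + 1 - k) ^ k : ℕ) : ℝ) ≤ (F.descFactorial k : ℕ) := by
        exact_mod_cast Nat.pow_sub_le_descFactorial F k
      refine le_trans ?_ h1
      have hk' : (k : ℝ) ≤ F := by exact_mod_cast hk
      have h2 : (((F + 1 - k) ^ k : ℕ) : ℝ) = ((F : ℝ) + 1 - k) ^ k := by
        rw [Nat.cast_pow, Nat.cast_sub (by omega)]
        push_cast
        ring
      have h3 : ((F : ℝ) + 1 - k) ^ k = (F : ℝ) ^ k * (1 + (-((k - 1) / F))) ^ k := by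
        rw [← mul_pow]
        congr 1
        field_simp
        ring
      rw [h2, h3]
      refine mul_le_mul_of_nonneg_left ?_ (by positivity)
      have h4 : (((k : ℝ) - 1) / F) ≤ 1 := by
        rw [div_le_one hF']
        linarith
      refine le_trans ?_ (one_add_mul_le_pow (a := -(((k : ℝ) - 1) / F)) (by linarith) k)
      have h5 : (k : ℝ) ^ 2 / F - k * ((k - 1) / F) = k / F := by
        field_simp
        ring
      have h6 : (0 : ℝ) ≤ k / F := by positivity
      linarith
    -- With fewer positions than slots k²/F ≥ 1, so the bound to be proved is at most 0.
    · have hk' : (F : ℝ) ≤ k := by exact_mod_cast hk.le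
      have h1 : (1 : ℝ) ≤ k ^ 2 / F := by
        rw [le_div_iff₀ hF']
        have : (1 : ℝ) ≤ k := by exact_mod_cast (by omega : 1 ≤ k)
        nlinarith
      have h2 : (F : ℝ) ^ k * (1 - k ^ 2 / F) ≤ 0 :=
        mul_nonpos_of_nonneg_of_nonpos (by positivity) (by linarith)
      exact h2.trans (Nat.cast_nonneg _)
  have hsum : ∑ p : Fin k → Fin F, (A - B + B * if Function.Injective p then 1 else 0)
      ≤ ∑ p, f p := by
    refine Finset.sum_le_sum fun p _ => ?_
    split_ifs with hp
    · linarith [hinj p hp]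
    · linarith [h p]
  rw [Finset.sum_add_distrib, ← Finset.mul_sum, Finset.sum_boole, hinjcard, Finset.sum_const,
    Finset.card_univ, nsmul_eq_mul, hcard] at hsum
  unfold avgPi
  rw [Fintype.card_fin, inv_pow, ← div_eq_inv_mul, le_div_iff₀ (by positivity)]
  refine le_trans ?_ hsum
  nlinarith [mul_le_mul_of_nonneg_left hcount hB]

end Symmetry

/-! ### The two-parameter recursion -/

section Recursion

/-- A two-parameter array that is Lipschitz and satisfies an approximate martingale inequality,
whose error is small as long as about `N` half-edges remain, is bounded below by a quadratic
barrier. -/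
theorem recursion_barrier {k : ℕ} (hk : 2 ≤ k) {L c N D Φ₀ α₀ β₀ : ℝ} (hL : 0 ≤ L) (hc : c ≤ 3 * L)
    (hN : 0 < N) {Φ : ℕ → ℕ → ℝ}
    (hLa : ∀ a b, |Φ (a + 1) b - Φ a b| ≤ L) (hLb : ∀ a b, |Φ a (b + 1) - Φ a b| ≤ L)
    (hI : ∀ a b : ℕ, 0 < D - a * k - b → Φ (a + 1) b + ((k : ℝ) - 1) * (Φ a b + c)
      ≤ k * Φ a (b + 1) + 2 * L * (k ^ 2 / (D - a * k - b)))
    (hbase : ∀ a : ℕ, Φ₀ - α₀ - β₀ * (D - a * k - N) ^ 2 ≤ Φ a 0) (b : ℕ) (hb : (b : ℝ) ≤ D)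
    (a : ℕ) :
    k * (Φ₀ - (α₀ + b * ((k - 1) * (β₀ + D * (32 * L / N ^ 2)) + (4 * k * L / N + 32 * L / N ^ 2)))
      - (β₀ + b * (32 * L / N ^ 2)) * (D - a * k - b - N) ^ 2) + b * ((k - 1) * c)
      ≤ k * Φ a b := by
  have hk2 : (2 : ℝ) ≤ k := by exact_mod_cast hk
  -- A version of the step valid everywhere. For f ≥ N/2 the error is at most 4k²L/N. For smaller f,
  -- where the step may not even be available, the Lipschitz bounds and c ≤ 3L cost at most 4kL, and
  -- this is dominated by the quadratic term because (f - N)² ≥ N²/4.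
  have herr : ∀ a b : ℕ, Φ (a + 1) b + ((k : ℝ) - 1) * (Φ a b + c)
      ≤ k * Φ a (b + 1) + 4 * k ^ 2 * L / N + 16 * k * L / N ^ 2 * (D - a * k - b - N) ^ 2 := by
    intro a b
    set f : ℝ := D - a * k - b with hf
    have e2 : 0 ≤ 16 * k * L / N ^ 2 * (f - N) ^ 2 := by positivity
    have e1 : 0 ≤ 4 * k ^ 2 * L / N := by positivity
    rcases le_or_gt (N / 2) f with hfN | hfN
    · have hf0 : 0 < f := by linarith
      have h1 : (k : ℝ) ^ 2 / f ≤ k ^ 2 / (N / 2) := by gcongr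
      have h2 : 2 * L * ((k : ℝ) ^ 2 / (N / 2)) = 4 * k ^ 2 * L / N := by
        field_simp
        ring
      have h3 := hI a b hf0
      have h4 := mul_le_mul_of_nonneg_left h1 (show 0 ≤ 2 * L by linarith)
      linarith
    · have h1 : N ^ 2 / 4 ≤ (f - N) ^ 2 := by
        nlinarith only [hN, hfN]
      have h2 : 4 * k * L ≤ 16 * k * L / N ^ 2 * (f - N) ^ 2 := by
        refine le_trans (le_of_eq ?_) (mul_le_mul_of_nonneg_left h1 (by positivity))
        field_simp
        ring
      have h3 := (abs_le.mp (hLa a b)).2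
      have h4 := (abs_le.mp (hLb a b)).1
      have h5 : ((k : ℝ) - 1) * c ≤ (k - 1) * (3 * L) :=
        mul_le_mul_of_nonneg_left hc (by linarith)
      have h6 : (k : ℝ) * (Φ a b - L) ≤ k * Φ a (b + 1) :=
        mul_le_mul_of_nonneg_left (by linarith) (by linarith)
      linarith
  induction b generalizing a with
  | zero => simpa using mul_le_mul_of_nonneg_left (hbase a) (by linarith : (0 : ℝ) ≤ k)
  | succ b ih =>
    have hb' : (b : ℝ) ≤ D := by push_cast at hb; linarith
    have h1 := ih hb' a
    have h2 := ih hb' (a + 1)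
    have h3 := herr a b
    push_cast at h1 h2 h3 ⊢
    set r : ℝ := 32 * L / N ^ 2 with hr
    have hr0 : 0 ≤ r := by positivity
    set s : ℝ := 4 * k * L / N with hs
    have hs' : 4 * (k : ℝ) ^ 2 * L / N = k * s := by rw [hs]; ring
    have hr' : 16 * (k : ℝ) * L / N ^ 2 = k * r / 2 := by rw [hr]; ring
    rw [hs', hr'] at h3
    set A : ℝ := (k - 1) * (β₀ + D * r) + (s + r) with hA
    set f : ℝ := D - a * k - b with hf
    have e1 : D - (a + 1) * k - b - N = f - k - N := by rw [hf]; ring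
    have e2 : D - a * k - (b + 1) - N = f - 1 - N := by rw [hf]; ring
    rw [e1] at h2
    rw [e2]
    set β : ℝ := β₀ + b * r with hβ
    have hβD : β ≤ β₀ + D * r := by
      have := mul_le_mul_of_nonneg_right hb' hr0
      linarith
    have hAge : (k - 1) * β + (s + r) ≤ A := by
      have := mul_le_mul_of_nonneg_left hβD (by linarith : (0 : ℝ) ≤ k - 1)
      linarith
    have hβs : β₀ + (b + 1) * r = β + r := by rw [hβ]; ring
    rw [hβs]
    -- The martingale identity: from f - 1 the number of free half-edges moves to f - k with weight
    -- 1/k and to f with weight (k-1)/k. The mean is preserved and the variance is k - 1, so one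
    -- step costs the barrier (k-1)β.
    have hvar : (f - k - N) ^ 2 + (k - 1) * (f - N) ^ 2
        = k * (f - 1 - N) ^ 2 + k * (k - 1) := by ring
    have hsq : (f - N) ^ 2 ≤ 2 * (f - 1 - N) ^ 2 + 2 := by linear_combination sq_nonneg (f - N - 2)
    have hkr : k * r / 2 * (f - N) ^ 2 ≤ k * r / 2 * (2 * (f - 1 - N) ^ 2 + 2) :=
      mul_le_mul_of_nonneg_left hsq (by positivity)
    have h1' := mul_le_mul_of_nonneg_left h1 (by linarith : (0 : ℝ) ≤ k - 1)
    have h3' := mul_le_mul_of_nonneg_left h3 (by linarith : (0 : ℝ) ≤ k)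
    have hAk := mul_le_mul_of_nonneg_left hAge (by positivity : (0 : ℝ) ≤ (k : ℝ) ^ 2)
    have hkr' := mul_le_mul_of_nonneg_left hkr (by linarith : (0 : ℝ) ≤ k)
    have hkpos : (0 : ℝ) < k := by linarith
    refine le_of_mul_le_mul_left ?_ hkpos
    have hvar' : k * β * ((f - k - N) ^ 2 + (k - 1) * (f - N) ^ 2)
        = k * β * (k * (f - 1 - N) ^ 2 + k * (k - 1)) := by rw [hvar]
    have h123 : k * (Φ (a + 1) b + ((k : ℝ) - 1) * (Φ a b + c))
        = k * Φ (a + 1) b + (k - 1) * (k * Φ a b) + k * ((k - 1) * c) := by ring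
    generalize hP1 : Φ (a + 1) b = P1 at *
    generalize hP2 : Φ a b = P2 at *
    generalize hP3 : Φ a (b + 1) = P3 at *
    clear_value A β f r s
    clear herr ih hLa hLb hI hbase hP1 hP2 hP3 hβs hr hs hs' hr' hA hf e1 e2 hAge hvar hsq hkr h3 hb hb'
    generalize (b : ℝ) = b' at *
    generalize (k : ℝ) = K at *
    linear_combination h3' + h2 + h1' + hkr' + hAk - hvar'

/-- With t = n^(1/3) and N about t², every loss is of order L t² at most: N Lipschitz steps at the
end, variance of order n weighted by L/t, and the growth of the quadratic coefficient, of order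
n²/N². The summed ordinary errors, of order n/N, are only of order t. -/
theorem recursion_bound {k m n d : ℕ} (hk : 2 ≤ k) (hn : 1 ≤ n) (hd : 1 ≤ d) (hnm : n * d = m * k)
    {L c : ℝ} (hL : 0 ≤ L) (hc : c ≤ 3 * L) {Φ : ℕ → ℕ → ℝ}
    (hLa : ∀ a b, |Φ (a + 1) b - Φ a b| ≤ L) (hLb : ∀ a b, |Φ a (b + 1) - Φ a b| ≤ L)
    (hI : ∀ a b : ℕ, 0 < (m * k : ℝ) - a * k - b → Φ (a + 1) b + ((k : ℝ) - 1) * (Φ a b + c)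
      ≤ k * Φ a (b + 1) + 2 * L * (k ^ 2 / ((m * k : ℝ) - a * k - b))) :
    Φ m 0 + m * (((k : ℝ) - 1) * c) ≤
      Φ 0 (m * k) + L * (11 + d * (5 * k + 32 * k * d + 32)) * (n : ℝ) ^ (2 / 3 : ℝ) := by
  have hk2 : (2 : ℝ) ≤ k := by exact_mod_cast hk
  set t : ℝ := (n : ℝ) ^ (1 / 3 : ℝ) with ht
  have hn1 : (1 : ℝ) ≤ n := by exact_mod_cast hn
  have hd1 : (1 : ℝ) ≤ d := by exact_mod_cast hd
  have ht1 : 1 ≤ t := Real.one_le_rpow hn1 (by norm_num)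
  have ht3 : t ^ 3 = n := by
    rw [ht, ← Real.rpow_natCast, ← Real.rpow_mul (by positivity)]
    norm_num
  have ht2 : (n : ℝ) ^ (2 / 3 : ℝ) = t ^ 2 := by
    rw [ht, ← Real.rpow_natCast, ← Real.rpow_mul (by positivity)]
    norm_num
  have ht0 : 0 < t := by linarith
  have htt : t ^ 2 ≤ t ^ 3 := pow_le_pow_right₀ ht1 (by norm_num)
  have ht12 : t ≤ t ^ 2 := by nlinarith only [ht1]
  set N : ℕ := ⌈t ^ 2⌉₊ with hN
  have hN1 : t ^ 2 ≤ N := Nat.le_ceil _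
  have hN2 : (N : ℝ) ≤ 2 * t ^ 2 := by
    have := (Nat.ceil_lt_add_one (by positivity : 0 ≤ t ^ 2)).le
    linarith
  have hNn : N ≤ n := Nat.ceil_le.2 (by rw [← ht3]; exact htt)
  have hNmk : N ≤ m * k := hNn.trans (hnm ▸ Nat.le_mul_of_pos_right n hd)
  have hN0 : (0 : ℝ) < N := lt_of_lt_of_le (by positivity) hN1
  have hlip : ∀ a b j : ℕ, |Φ (a + j) b - Φ a b| ≤ L * j := by
    intro a b j
    induction j with
    | zero => simp
    | succ j ih =>
      have h1 := abs_le.mp ih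
      have h2 := abs_le.mp (hLa (a + j) b)
      rw [← add_assoc, abs_le]
      push_cast
      constructor <;> linarith [h1.1, h1.2, h2.1, h2.2]
  have hlipb : ∀ a b j : ℕ, |Φ a (b + j) - Φ a b| ≤ L * j := by
    intro a b j
    induction j with
    | zero => simp
    | succ j ih =>
      have h1 := abs_le.mp ih
      have h2 := abs_le.mp (hLb a (b + j))
      rw [← add_assoc, abs_le]
      push_cast
      constructor <;> linarith [h1.1, h1.2, h2.1, h2.2]
  -- The Lipschitz loss L |a - m| is at most L (N + |g|), and |g| ≤ t + g²/t converts it to a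
  -- quadratic with the small coefficient L/t. Values a > m are included, since the walk may
  -- overshoot.
  have hbase : ∀ a : ℕ, Φ m 0 - L * (N + t) - L / t * ((m * k : ℝ) - a * k - N) ^ 2 ≤ Φ a 0 := by
    intro a
    have h1 : |Φ a 0 - Φ m 0| ≤ L * |(a : ℝ) - m| := by
      rcases le_total a m with h | h
      · obtain ⟨j, rfl⟩ := Nat.exists_eq_add_of_le h
        have := hlip a 0 j
        rw [abs_sub_comm] at this
        refine this.trans (le_of_eq ?_)
        push_cast
        rw [show (a : ℝ) - (a + j) = -j by ring, abs_neg, Nat.abs_cast]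
      · obtain ⟨j, rfl⟩ := Nat.exists_eq_add_of_le h
        refine (hlip m 0 j).trans (le_of_eq ?_)
        push_cast
        rw [show (m : ℝ) + j - m = j by ring, Nat.abs_cast]
    set g : ℝ := (m * k : ℝ) - a * k - N with hg
    have h2 : |(a : ℝ) - m| ≤ N + |g| := by
      have e : g + N = (m - a) * k := by rw [hg]; ring
      have h3 : |(a : ℝ) - m| * 1 ≤ |(a : ℝ) - m| * k :=
        mul_le_mul_of_nonneg_left (by linarith) (abs_nonneg _)
      have h4 : |(a : ℝ) - m| * k = |g + N| := by
        rw [e, abs_mul, Nat.abs_cast, abs_sub_comm]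
      have h5 := abs_add_le g N
      rw [Nat.abs_cast] at h5
      linarith
    have h3 : |g| ≤ t + g ^ 2 / t := by
      rw [← sub_nonneg, ← sq_abs g]
      have : t + |g| ^ 2 / t - |g| = ((t - |g|) ^ 2 + t * |g|) / t := by
        field_simp
        ring
      rw [this]
      positivity
    have h4 := (abs_le.mp h1).1
    have h5 := mul_le_mul_of_nonneg_left (h2.trans (add_le_add_right h3 (N : ℝ))) hL
    have h6 : L * (N + (t + g ^ 2 / t)) = L * (N + t) + L / t * g ^ 2 := by ring
    linarith
  have hD : (((m * k - N : ℕ) : ℕ) : ℝ) = m * k - N := by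
    rw [Nat.cast_sub hNmk]
    push_cast
    ring
  -- The barrier is evaluated at a = 0 with exactly N half-edges free, where its quadratic term
  -- vanishes; the last N cavity factors are added by the Lipschitz bound.
  have key := recursion_barrier hk hL hc hN0 hLa hLb hI hbase (m * k - N)
    (by rw [hD]; linarith) 0
  have hend := (abs_le.mp (hlipb 0 (m * k - N) N)).1
  rw [Nat.sub_add_cancel hNmk] at hend
  rw [hD] at key
  simp only [Nat.cast_zero, zero_mul, sub_zero] at key
  rw [show (m * k : ℝ) - (m * k - N) - N = 0 by ring] at key
  have hmk : (m * k : ℝ) = d * t ^ 3 := by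
    rw [ht3]
    have : ((n * d : ℕ) : ℝ) = ((m * k : ℕ) : ℝ) := by rw [hnm]
    push_cast at this
    linarith
  set A : ℝ := (k - 1) * (L / t + m * k * (32 * L / N ^ 2)) + (4 * k * L / N + 32 * L / N ^ 2)
    with hA
  have hN2' : (1 : ℝ) / N ^ 2 ≤ 1 / t ^ 4 := by
    rw [show t ^ 4 = (t ^ 2) ^ 2 by ring]
    gcongr
  have hA0 : 0 ≤ A := by
    have : (0 : ℝ) ≤ k - 1 := by linarith
    positivity
  have hAt : A * t ≤ L * (5 * k + 32 * k * d + 32) := by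
    have f1 : (32 * L / N ^ 2 : ℝ) ≤ 32 * L / t ^ 4 := by
      rw [show t ^ 4 = (t ^ 2) ^ 2 by ring]
      gcongr
    have f2 : (4 * k * L / N : ℝ) ≤ 4 * k * L / t ^ 2 := by gcongr
    have f3 : A ≤ k * (L / t + d * t ^ 3 * (32 * L / t ^ 4)) + (4 * k * L / t ^ 2 + 32 * L / t ^ 4)
        := by
      rw [hA, hmk]
      gcongr
      linarith
    have f4 : (k * (L / t + d * t ^ 3 * (32 * L / t ^ 4)) + (4 * k * L / t ^ 2 + 32 * L / t ^ 4)) * t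
        = L * (k + 32 * k * d + 4 * k * (1 / t) + 32 * (1 / t ^ 3)) := by
      field_simp
      ring
    have f5 : 1 / t ≤ 1 := by rw [div_le_one ht0]; exact ht1
    have f6 : 1 / t ^ 3 ≤ 1 := by
      rw [div_le_one (by positivity)]
      exact one_le_pow₀ ht1
    refine (mul_le_mul_of_nonneg_right f3 ht0.le).trans ?_
    rw [f4]
    refine mul_le_mul_of_nonneg_left ?_ hL
    have := mul_le_mul_of_nonneg_left f5 (show (0 : ℝ) ≤ 4 * k by positivity)
    linarith
  have hAD : (m * k - N : ℝ) * A ≤ d * t ^ 2 * (L * (5 * k + 32 * k * d + 32)) := by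
    calc (m * k - N : ℝ) * A ≤ (m * k) * A := mul_le_mul_of_nonneg_right (by linarith) hA0
      _ = d * t ^ 2 * (A * t) := by rw [hmk]; ring
      _ ≤ _ := mul_le_mul_of_nonneg_left hAt (by positivity)
  have hNL : L * N ≤ L * (2 * t ^ 2) := mul_le_mul_of_nonneg_left hN2 hL
  have htL : L * t ≤ L * t ^ 2 := mul_le_mul_of_nonneg_left ht12 hL
  have hNc : (N : ℝ) * ((k - 1) * c) ≤ k * (N * (3 * L)) := by
    have h1 : ((k : ℝ) - 1) * c ≤ (k - 1) * (3 * L) :=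
      mul_le_mul_of_nonneg_left hc (by linarith)
    have h2 : ((k : ℝ) - 1) * (3 * L) ≤ k * (3 * L) :=
      mul_le_mul_of_nonneg_right (by linarith) (by linarith)
    calc (N : ℝ) * ((k - 1) * c) ≤ N * (k * (3 * L)) :=
          mul_le_mul_of_nonneg_left (h1.trans h2) hN0.le
      _ = _ := by ring
  rw [ht2]
  refine le_of_mul_le_mul_left ?_ (by linarith : (0 : ℝ) < k)
  have hend' := mul_le_mul_of_nonneg_left hend (by linarith : (0 : ℝ) ≤ k)
  -- The constant 11 collects 5LN + Lt with N ≤ 2t²: one LN from the base, 3LN from the missing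
  -- multiples of c and one from the final Lipschitz steps. The rest is the per-step loss A over at
  -- most d t³ steps.
  have hbound : (L * (N + t) + (m * k - N) * A) + N * (3 * L) + L * N
      ≤ L * (11 + d * (5 * k + 32 * k * d + 32)) * t ^ 2 := by
    linarith
  have hbound' := mul_le_mul_of_nonneg_left hbound (by linarith : (0 : ℝ) ≤ k)
  linarith

end Recursion

/-! ### Reading clauses and cavity factors off an ordering of the half-edges -/

section Matching

variable {V R : Type*} {D : ℕ} [NeZero D]

/-- The vertex at position `p` of the ordering `σ` of the half-edges. -/
def vertexAt (σ : Fin D ≃ V × R) (p : ℕ) : V := (σ (Fin.ofNat D p)).1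

/-- The first `a` blocks of `k` half-edges are joined to clauses. -/
def clausePart (σ : Fin D ≃ V × R) (k a : ℕ) : Fin a → Fin k → V :=
  fun i j => vertexAt σ (i * k + j)

/-- The last `b` half-edges are joined to cavity fields. -/
def cavityPart (σ : Fin D ≃ V × R) (b : ℕ) : Fin b → V :=
  fun j => vertexAt σ (D - 1 - j)

theorem clausePart_succ (σ : Fin D ≃ V × R) (k a : ℕ) :
    clausePart σ k (a + 1) = Fin.snoc (clausePart σ k a) fun j : Fin k => vertexAt σ (a * k + j) := by
  funext i
  refine Fin.lastCases ?_ (fun i => ?_) i <;> simp <;> rfl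

theorem cavityPart_succ (σ : Fin D ≃ V × R) (b : ℕ) :
    cavityPart σ (b + 1) = Fin.snoc (cavityPart σ b) (vertexAt σ (D - 1 - b)) := by
  funext i
  refine Fin.lastCases ?_ (fun i => ?_) i <;> simp [cavityPart]

/-- Positions wrap around modulo D, so that the hybrid systems, and with them the Lipschitz bounds,
make sense for all `a` and `b`. The wrapping is harmless wherever exchangeability is invoked, since
all positions are then in range. -/
theorem val_ofNat_of_lt {p : ℕ} (hp : p < D) : (Fin.ofNat D p).val = p := Nat.mod_eq_of_lt hp

/-- Only positions below a k are read, and these lie outside the free window from a k to D - b; this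
is the invariance that the exchangeability argument asks for. -/
theorem clausePart_congr {σ σ' : Fin D ≃ V × R} {k a b : ℕ} (hab : a * k + b < D)
    (h : ∀ p : Fin D, ¬ (a * k ≤ p.val ∧ p.val < D - b) → σ p = σ' p) :
    clausePart σ k a = clausePart σ' k a := by
  funext i j
  have h1 : (i : ℕ) * k + j < a * k := by
    calc (i : ℕ) * k + j < i * k + k := by omega
      _ = (i + 1) * k := by ring
      _ ≤ a * k := Nat.mul_le_mul_right k i.isLt
  unfold clausePart vertexAt
  rw [h]
  rw [val_ofNat_of_lt (by omega)]
  omega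

theorem cavityPart_congr {σ σ' : Fin D ≃ V × R} {k a b : ℕ} (hab : a * k + b < D)
    (h : ∀ p : Fin D, ¬ (a * k ≤ p.val ∧ p.val < D - b) → σ p = σ' p) :
    cavityPart σ b = cavityPart σ' b := by
  funext j
  unfold cavityPart vertexAt
  rw [h]
  rw [val_ofNat_of_lt (by omega)]
  omega

end Matching

/-! ### The mean energy over random orderings -/

section MeanEnergy

variable {X S V R : Type*} [MeasurableSpace X] [Fintype X] [DecidableEq X]
  [DiscreteMeasurableSpace X] [Fintype S] {k : ℕ} [NeZero k] [Fintype V] [DecidableEq V]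
  [Fintype R] [DecidableEq R] {D : ℕ} [NeZero D] [Nonempty X] {M : FactorModel X S} {ε lam : ℝ}

/-- Any `k` distinct free positions are as good as the next block of `k`, by exchangeability of the
ordering on the free window. -/
theorem sum_addClause_eq (ζ : M2 X) {a b F : ℕ} (hF : a * k + b + F = D)
    {p : Fin k → Fin F} (hp : Function.Injective p) :
    ∑ σ : Fin D ≃ V × R, hybridEnergy M ζ lam
        (Fin.snoc (clausePart σ k a) fun j => vertexAt σ (a * k + p j) : Fin (a + 1) → Fin k → V)
        (cavityPart σ b)
      = ∑ σ : Fin D ≃ V × R, hybridEnergy M ζ lam (clausePart σ k (a + 1)) (cavityPart σ b) := by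
  have hkF : k ≤ F := by simpa using Fintype.card_le_of_injective p hp
  have hk0 : 0 < k := Nat.pos_of_neZero k
  have hab : a * k + b < D := by omega
  simp only [clausePart_succ]
  have hp1 : ∀ j, a * k + (p j : ℕ) < D := fun j => by have := (p j).isLt; omega
  have hj1 : ∀ j : Fin k, a * k + (j : ℕ) < D := fun j => by have := j.isLt; omega
  refine sum_equiv_comp_eq_of_injective (fun q : Fin D => a * k ≤ q.val ∧ q.val < D - b)
    (q := fun j => Fin.ofNat D (a * k + p j)) (q' := fun j : Fin k => Fin.ofNat D (a * k + j))
    (fun i j h => ?_) (fun i j h => ?_) (fun j => ?_) (fun j => ?_)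
    (fun σ v => hybridEnergy M ζ lam
      (Fin.snoc (clausePart σ k a) fun j => (v j).1 : Fin (a + 1) → Fin k → V)
      (cavityPart σ b)) (fun σ σ' h v => ?_)
  · have h' := congrArg Fin.val h
    simp only [val_ofNat_of_lt (hp1 _)] at h'
    exact hp (Fin.ext (by omega))
  · have h' := congrArg Fin.val h
    simp only [val_ofNat_of_lt (hj1 _)] at h'
    exact Fin.ext (by omega)
  · have := (p j).isLt
    rw [val_ofNat_of_lt (hp1 _)]
    omega
  · rw [val_ofNat_of_lt (hj1 _)]
    omega
  · simp only [clausePart_congr hab h, cavityPart_congr hab h]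

/-- A single free position is exchangeable with the last free one, at D - 1 - b, which the next
cavity factor occupies. -/
theorem sum_addCavity_eq (ζ : M2 X) {a b F : ℕ} (hF : a * k + b + F = D) (i : Fin F) :
    ∑ σ : Fin D ≃ V × R, hybridEnergy M ζ lam (clausePart σ k a)
        (Fin.snoc (cavityPart σ b) (vertexAt σ (a * k + i)) : Fin (b + 1) → V)
      = ∑ σ : Fin D ≃ V × R, hybridEnergy M ζ lam (clausePart σ k a) (cavityPart σ (b + 1)) := by
  simp only [cavityPart_succ]
  have hi := i.isLt
  have hab : a * k + b < D := by omega
  refine sum_equiv_comp_eq_of_injective (κ := Unit)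
    (fun q : Fin D => a * k ≤ q.val ∧ q.val < D - b)
    (q := fun _ => Fin.ofNat D (a * k + i)) (q' := fun _ => Fin.ofNat D (D - 1 - b))
    (fun i j h => rfl) (fun i j h => rfl) (fun j => ?_) (fun j => ?_)
    (fun σ v => hybridEnergy M ζ lam (clausePart σ k a)
      (Fin.snoc (cavityPart σ b) (v ()).1 : Fin (b + 1) → V)) (fun σ σ' h v => ?_)
  · rw [val_ofNat_of_lt (by omega)]
    omega
  · rw [val_ofNat_of_lt (by omega)]
    omega
  · simp only [clausePart_congr hab h, cavityPart_congr hab h]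

variable (V R D) in
/-- The hybrid energy, averaged over the orderings of the half-edges. -/
def meanEnergy (M : FactorModel X S) (ζ : M2 X) (k : ℕ) [NeZero k]
    (lam : ℝ) (a b : ℕ) : ℝ :=
  (Fintype.card (Fin D ≃ V × R) : ℝ)⁻¹ *
    ∑ σ : Fin D ≃ V × R, hybridEnergy M ζ lam (clausePart σ k a) (cavityPart σ b)

theorem abs_average_sub_le {ι : Type*} [Fintype ι] [Nonempty ι] {f g : ι → ℝ} {K : ℝ}
    (h : ∀ i, |f i - g i| ≤ K) :
    |(Fintype.card ι : ℝ)⁻¹ * ∑ i, f i - (Fintype.card ι : ℝ)⁻¹ * ∑ i, g i| ≤ K := by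
  have hc : (0 : ℝ) < Fintype.card ι := by exact_mod_cast Fintype.card_pos
  rw [← mul_sub, ← Finset.sum_sub_distrib, abs_mul, abs_of_pos (inv_pos.2 hc),
    inv_mul_le_iff₀ hc]
  refine (Finset.abs_sum_le_sum_abs _ _).trans ((Finset.sum_le_sum fun i _ => h i).trans ?_)
  simp

theorem abs_meanEnergy_addClause_sub_le [Nonempty (Fin D ≃ V × R)] (hM : M.BoundedPotentials k ε)
    (ζ : M2 X) (hε : 0 < ε) (hε1 : ε ≤ 1) (hl : 0 ≤ lam) (a b : ℕ) :
    |meanEnergy V R D M ζ k lam (a + 1) b - meanEnergy V R D M ζ k lam a b|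
      ≤ lam * Real.log ((ε ^ (k + 1))⁻¹) := by
  refine abs_average_sub_le fun σ => ?_
  rw [clausePart_succ]
  exact abs_hybridEnergy_addClause_sub_le hM ζ hε hε1 hl _ _ _

theorem abs_meanEnergy_addCavity_sub_le [Nonempty (Fin D ≃ V × R)] (hM : M.BoundedPotentials k ε)
    (ζ : M2 X) (hε : 0 < ε) (hε1 : ε ≤ 1) (hl : 0 ≤ lam) (a b : ℕ) :
    |meanEnergy V R D M ζ k lam a (b + 1) - meanEnergy V R D M ζ k lam a b|
      ≤ lam * Real.log ((ε ^ (k + 1))⁻¹) := by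
  refine abs_average_sub_le fun σ => ?_
  rw [cavityPart_succ]
  exact abs_hybridEnergy_addCavity_sub_le hM ζ hε hε1 hl _ _ _

/-- The pointwise inequality concerns independent positions, possibly repeated. After averaging over
orderings, injective families all contribute A, and the others lie within 2L of it because both are
within L of the energy before the step; the weight of the others is at most k²/F. -/
theorem average_interpolation {ι : Type*} [Fintype ι] [Nonempty ι] {k F : ℕ} (hF0 : 0 < F)
    {E : ι → (Fin k → Fin F) → ℝ} {G : ι → Fin F → ℝ} {H : ι → ℝ} {A B c L : ℝ}
    (hpt : ∀ σ, avgPi (E σ) + ((k : ℝ) - 1) * (H σ + c)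
      ≤ k * ((Fintype.card (Fin F) : ℝ)⁻¹ * ∑ i, G σ i))
    (hE : ∀ p, Function.Injective p → ∑ σ, E σ p = A) (hG : ∀ i, ∑ σ, G σ i = B)
    (hEH : ∀ σ p, |E σ p - H σ| ≤ L)
    (hA : |(Fintype.card ι : ℝ)⁻¹ * A - (Fintype.card ι : ℝ)⁻¹ * ∑ σ, H σ| ≤ L) :
    (Fintype.card ι : ℝ)⁻¹ * A
        + ((k : ℝ) - 1) * ((Fintype.card ι : ℝ)⁻¹ * ∑ σ, H σ + c)
      ≤ k * ((Fintype.card ι : ℝ)⁻¹ * B) + 2 * L * (k ^ 2 / F) := by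
  have hc : (0 : ℝ) < Fintype.card ι := by exact_mod_cast Fintype.card_pos
  have hEp : ∀ p, |(Fintype.card ι : ℝ)⁻¹ * ∑ σ, E σ p - (Fintype.card ι : ℝ)⁻¹ * ∑ σ, H σ| ≤ L :=
    fun p => abs_average_sub_le fun σ => hEH σ p
  set κ : ℝ := (Fintype.card ι : ℝ)⁻¹ with hκ
  have hκ0 : 0 ≤ κ := (inv_pos.2 hc).le
  have hκc : κ * Fintype.card ι = 1 := inv_mul_cancel₀ hc.ne'
  have hsum := mul_le_mul_of_nonneg_left
    (Finset.sum_le_sum fun σ (_ : σ ∈ Finset.univ) => hpt σ) hκ0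
  have hleft : κ * ∑ σ, (avgPi (E σ) + ((k : ℝ) - 1) * (H σ + c))
      = avgPi (fun p => κ * ∑ σ, E σ p) + ((k : ℝ) - 1) * (κ * ∑ σ, H σ + c) := by
    have h1 : κ * ∑ σ, avgPi (E σ) = avgPi (fun p => κ * ∑ σ, E σ p) := by
      unfold avgPi
      rw [← Finset.mul_sum, ← Finset.mul_sum, Finset.sum_comm]
      ring
    rw [Finset.sum_add_distrib, mul_add, h1, ← Finset.mul_sum, Finset.sum_add_distrib,
      Finset.sum_const, Finset.card_univ, nsmul_eq_mul]
    linear_combination ((k : ℝ) - 1) * c * hκc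
  have hright : κ * ∑ σ, k * ((Fintype.card (Fin F) : ℝ)⁻¹ * ∑ i, G σ i) = k * (κ * B) := by
    rw [← Finset.mul_sum, ← Finset.mul_sum, Finset.sum_comm,
      Finset.sum_congr rfl fun i _ => hG i, Finset.sum_const,
      Finset.card_univ, nsmul_eq_mul, inv_mul_cancel_left₀ (by simpa using hF0.ne')]
    ring
  rw [hleft, hright] at hsum
  have havg : κ * A - 2 * L * (k ^ 2 / F) ≤ avgPi (fun p => κ * ∑ σ, E σ p) := by
    refine le_avgPi_of_injective hF0 (by linarith [(abs_nonneg _).trans hA]) (fun p => ?_)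
      fun p hp => ?_
    · have h3 := (abs_le.mp (hEp p)).1
      have h4 := (abs_le.mp hA).2
      linarith
    · rw [hE p hp]
  linarith

theorem meanEnergy_interpolation [Nonempty (Fin D ≃ V × R)] (hM : M.BoundedPotentials k ε)
    (hM2 : M.NonnegMoments) (ζ : M2 X) (hε : 0 < ε) (hε1 : ε ≤ 1) (hl : 0 < lam) (hl1 : lam < 1)
    {a b F : ℕ} (hF : a * k + b + F = D) (hF0 : 0 < F) :
    meanEnergy V R D M ζ k lam (a + 1) b
        + ((k : ℝ) - 1) * (meanEnergy V R D M ζ k lam a b + clauseTerm M ζ k lam)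
      ≤ k * meanEnergy V R D M ζ k lam a (b + 1)
        + 2 * (lam * Real.log ((ε ^ (k + 1))⁻¹)) * (k ^ 2 / F) := by
  have : NeZero F := ⟨hF0.ne'⟩
  exact average_interpolation hF0
    (fun σ => hybridEnergy_interpolation hM hM2 ζ hε hε1 hl hl1 (clausePart σ k a)
      (cavityPart σ b) fun i : Fin F => vertexAt σ (a * k + i))
    (fun p hp => sum_addClause_eq ζ hF hp) (fun i => sum_addCavity_eq ζ hF i)
    (fun σ p => abs_hybridEnergy_addClause_sub_le hM ζ hε hε1 hl.le _ _ _)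
    (abs_meanEnergy_addClause_sub_le hM ζ hε hε1 hl.le a b)

/-- The clause term is at most of the order of a single Lipschitz step. -/
theorem clauseTerm_le [Nonempty V] (hk : 2 ≤ k) (hM : M.BoundedPotentials k ε)
    (hM2 : M.NonnegMoments) (ζ : M2 X) (hε : 0 < ε) (hε1 : ε ≤ 1) (hl : 0 < lam) (hl1 : lam < 1) :
    clauseTerm M ζ k lam ≤ 3 * (lam * Real.log ((ε ^ (k + 1))⁻¹)) := by
  obtain ⟨v⟩ := ‹Nonempty V›
  let w : Fin 0 → Fin k → V := Fin.elim0
  let c : Fin 0 → V := Fin.elim0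
  -- The interpolation step on a system without factors and with a single attachment point bounds
  -- `clauseTerm` by energy differences.
  have h1 := hybridEnergy_interpolation hM hM2 ζ hε hε1 hl hl1 w c (fun _ : Unit => v)
  simp only [avgPi, Fintype.card_unit, Nat.cast_one, inv_one, one_pow, one_mul,
    Finset.univ_unique, Finset.sum_singleton] at h1
  have h2 := (abs_le.mp (abs_hybridEnergy_addClause_sub_le hM ζ hε hε1 hl.le w (fun _ => v) c))
  have h3 := (abs_le.mp (abs_hybridEnergy_addCavity_sub_le hM ζ hε hε1 hl.le w c v))
  have hk2 : (2 : ℝ) ≤ k := by exact_mod_cast hk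
  set K := lam * Real.log ((ε ^ (k + 1))⁻¹) with hK
  have hK0 : 0 ≤ K := by linarith [h2.1, h2.2]
  have h4 := mul_le_mul_of_nonneg_left h3.2 (by linarith : (0 : ℝ) ≤ k)
  -- The two Lipschitz bounds give (k-1) c ≤ (k+1) K; the slack up to 3(k-1) K is 2(k-2) K, which is
  -- where k ≥ 2 enters.
  have h5 : 0 ≤ 2 * ((k : ℝ) - 2) * K := by
    have : (0 : ℝ) ≤ k - 2 := by linarith
    positivity
  refine le_of_mul_le_mul_left ?_ (by linarith : (0 : ℝ) < k - 1)
  linarith [h2.1]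

theorem meanEnergy_full_cavity {n d : ℕ} (hD : D = n * d) [Nonempty (Fin D ≃ Fin n × Fin d)]
    (hM : M.BoundedPotentials k ε) (ζ : M2 X) (hε : 0 < ε) (hε1 : ε ≤ 1) (hl : 0 ≤ lam) :
    meanEnergy (Fin n) (Fin d) D M ζ k lam 0 D = n * variableTerm M ζ d k lam := by
  have h : ∀ σ : Fin D ≃ Fin n × Fin d, hybridEnergy M ζ lam (clausePart σ k 0) (cavityPart σ D)
      = n * variableTerm M ζ d k lam := fun σ => by
    -- Cavity factors fill the ordering from the back, so at b = D they enumerate all half-edges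
    -- through the reversed ordering.
    have h1 : cavityPart σ D = fun j => ((Fin.revPerm.trans σ) j).1 := by
      funext j
      have : Fin.ofNat D (D - 1 - j) = Fin.rev j := by
        ext
        rw [val_ofNat_of_lt (by omega), Fin.val_rev]
        omega
      change (σ (Fin.ofNat D (D - 1 - j))).1 = _
      rw [this]
      rfl
    rw [h1, hybridEnergy_of_no_clause hM ζ hε hε1 hl, Fintype.card_fin]
  have hc : (Fintype.card (Fin D ≃ Fin n × Fin d) : ℝ) ≠ 0 := by
    exact_mod_cast Fintype.card_ne_zero
  rw [meanEnergy, Finset.sum_congr rfl fun σ _ => h σ]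
  rw [Finset.sum_const, Finset.card_univ, nsmul_eq_mul, inv_mul_cancel_left₀ hc]

/-- Numbering the clause half-edges by (i, j) ↦ i k + j turns an ordering of the variable half-edges
into a perfect matching. A uniform ordering is thus a uniform regular graph. -/
theorem meanEnergy_full_clause {n m d : ℕ} [NeZero (m * k)] (hn : n ≠ 0)
    (hM : M.BoundedPotentials k ε) (ζ : M2 X) (hε : 0 < ε) (hε1 : ε ≤ 1) :
    meanEnergy (Fin n) (Fin d) (m * k) M ζ k lam m 0 = lam * (n * freeEnergy M n m d k) := by
  let e : RegularGraph n m d k ≃ (Fin (m * k) ≃ Fin n × Fin d) :=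
    (Equiv.equivCongr (Equiv.refl _) finProdFinEquiv).trans (Equiv.symmEquiv _ _)
  have hvar : ∀ (G : RegularGraph n m d k) (i : Fin m) (j : Fin k),
      clausePart (e G) k m i j = G.var i j := fun G i j => by
    have hlt : (i : ℕ) * k + j < m * k := by
      calc (i : ℕ) * k + j < i * k + k := by omega
        _ = (i + 1) * k := by ring
        _ ≤ m * k := Nat.mul_le_mul_right k i.isLt
    have h1 : Fin.ofNat (m * k) (i * k + j) = finProdFinEquiv (i, j) := by
      ext
      rw [val_ofNat_of_lt hlt]
      simp
      ring
    change (e G (Fin.ofNat (m * k) (i * k + j))).1 = _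
    rw [h1]
    simp [RegularGraph.var, e]
  have hn' : (n : ℝ) ≠ 0 := by exact_mod_cast hn
  rw [meanEnergy, freeEnergy, mul_inv_cancel_left₀ hn', Fintype.card_congr e,
    ← Equiv.sum_comp e, mul_left_comm lam, Finset.mul_sum _ _ lam]
  refine congrArg _ (Finset.sum_congr rfl fun G _ => ?_)
  rw [hybridEnergy_of_no_cavity hM ζ hε hε1]
  simp only [hvar]
  rfl

end MeanEnergy

/-! ### Assembly of the bound -/

section Bound

theorem nonempty_of_M2 {X : Type*} [MeasurableSpace X] (ζ : M2 X) : Nonempty X := by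
  obtain ⟨η⟩ := (ζ : Measure (M1 X)).nonempty_of_neZero
  obtain ⟨ρ⟩ := (η : Measure (M0 X)).nonempty_of_neZero
  exact (ρ : Measure X).nonempty_of_neZero

variable {X S : Type*} [Fintype S] {M : FactorModel X S} {k : ℕ} {ε lam : ℝ}

theorem FactorModel.BoundedPotentials.le_one [Nonempty X] (hM : M.BoundedPotentials k ε)
    (hε : 0 < ε) : ε ≤ 1 := by
  obtain ⟨h, hh⟩ := hM.1.exists
  obtain ⟨x⟩ := ‹Nonempty X›
  have h1 := (hh x).1.trans (hh x).2
  rw [le_div_iff₀ hε] at h1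
  nlinarith

/-- The Lipschitz constant is λ log(ε^(-(k+1))), so dividing the recursion by λ n removes λ from the
error and turns n^(2/3) into n^(-1/3). The identity m = n d/k produces the coefficient (k-1) d/k of
the clause term. -/
theorem freeEnergy_le [Fintype X] [DecidableEq X] [MeasurableSpace X] [DiscreteMeasurableSpace X]
    [NeZero k] {n m d : ℕ} (hd : 1 ≤ d) (hk : 2 ≤ k) (hε : 0 < ε) (hM : M.BoundedPotentials k ε)
    (hM2 : M.NonnegMoments) (hn : 1 ≤ n) (hnm : n * d = m * k) (hl : 0 < lam) (hl1 : lam < 1)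
    (ζ : M2 X) :
    freeEnergy M n m d k ≤ lam⁻¹ * variableTerm M ζ d k lam
      - ((k : ℝ) - 1) * ((d : ℝ) / k) * lam⁻¹ * clauseTerm M ζ k lam
      + Real.log ((ε ^ (k + 1))⁻¹) * (11 + d * (5 * k + 32 * k * d + 32))
        * (n : ℝ) ^ (-(1 / 3 : ℝ)) := by
  -- The mere existence of ζ forces the alphabet to be nonempty, and then ε ≤ h ≤ 1/ε at one point
  -- forces ε ≤ 1.
  have hX : Nonempty X := nonempty_of_M2 ζ
  have hε1 : ε ≤ 1 := hM.le_one hε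
  have hD : NeZero (m * k) := ⟨by rw [← hnm]; positivity⟩
  have hV : Nonempty (Fin n) := ⟨⟨0, hn⟩⟩
  have hσ : Nonempty (Fin (m * k) ≃ Fin n × Fin d) :=
    ⟨(finCongr hnm.symm).trans finProdFinEquiv.symm⟩
  have hlog : 0 ≤ Real.log ((ε ^ (k + 1))⁻¹) :=
    Real.log_nonneg ((one_le_inv₀ (by positivity)).2 (pow_le_one₀ hε.le hε1))
  have key := recursion_bound hk hn hd hnm (mul_nonneg hl.le hlog)
    (clauseTerm_le (V := Fin n) hk hM hM2 ζ hε hε1 hl hl1)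
    (Φ := meanEnergy (Fin n) (Fin d) (m * k) M ζ k lam)
    (abs_meanEnergy_addClause_sub_le hM ζ hε hε1 hl.le)
    (abs_meanEnergy_addCavity_sub_le hM ζ hε hε1 hl.le)
    (fun a b hF => by
      have h1 : a * k + b < m * k := by
        have : ((a * k + b : ℕ) : ℝ) < ((m * k : ℕ) : ℝ) := by
          push_cast
          linarith
        exact_mod_cast this
      have h2 := meanEnergy_interpolation (V := Fin n) (R := Fin d) hM hM2 ζ hε hε1 hl hl1
        (F := m * k - (a * k + b)) (Nat.add_sub_of_le h1.le) (by omega)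
      rw [Nat.cast_sub h1.le] at h2
      push_cast at h2
      rwa [← sub_sub] at h2)
  rw [meanEnergy_full_clause (by omega) hM ζ hε hε1,
    meanEnergy_full_cavity hnm.symm hM ζ hε hε1 hl.le] at key
  have hn0 : (0 : ℝ) < n := by exact_mod_cast hn
  have hk0 : (0 : ℝ) < k := by
    have := Nat.pos_of_neZero k
    exact_mod_cast this
  have hm : (m : ℝ) = n * (d / k) := by
    have : ((n * d : ℕ) : ℝ) = ((m * k : ℕ) : ℝ) := by rw [hnm]
    push_cast at this
    field_simp
    linarith
  have hpow : (n : ℝ) ^ (2 / 3 : ℝ) = n * (n : ℝ) ^ (-(1 / 3 : ℝ)) := by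
    rw [← Real.rpow_one_add' hn0.le (by norm_num)]
    norm_num
  rw [hm, hpow] at key
  refine le_of_mul_le_mul_left ?_ (mul_pos hl hn0)
  have e1 : ∀ A B E : ℝ, lam * n * (lam⁻¹ * A - (k - 1) * (d / k) * lam⁻¹ * B + E)
      = n * A - n * (d / k) * ((k - 1) * B) + lam * n * E := fun A B E => by
    field_simp
  rw [e1]
  linarith

end Bound

end RegularFactorModel

end

theorem theoremt (d k : ℕ) [NeZero k] (hd : 1 ≤ d) (hk : 2 ≤ k) (ε : ℝ) (hε : 0 < ε) :
    ∃ C : ℝ, ∀ (X S : Type*) [Fintype X] [DecidableEq X] [MeasurableSpace X]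
      [DiscreteMeasurableSpace X] [Fintype S] (M : RegularFactorModel.FactorModel X S),
      M.BoundedPotentials k ε → M.NonnegMoments →
      ∀ n m : ℕ, 1 ≤ n → n * d = m * k →
      ∀ lam : ℝ, 0 < lam → lam < 1 → ∀ ζ : RegularFactorModel.M2 X,
        RegularFactorModel.freeEnergy M n m d k ≤
          lam⁻¹ * RegularFactorModel.variableTerm M ζ d k lam
            - ((k : ℝ) - 1) * ((d : ℝ) / (k : ℝ)) * lam⁻¹ *
                RegularFactorModel.clauseTerm M ζ k lam
            + C * (n : ℝ) ^ (-(1 / 3 : ℝ)) := by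
  exact ⟨_, fun X S _ _ _ _ _ M hM hM2 n m hn hnm lam hl hl1 ζ =>
    RegularFactorModel.freeEnergy_le hd hk hε hM hM2 hn hnm hl hl1 ζ⟩
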